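/- Let $m\ge 1$ be a fixed integer. For each dimension $d$ consider a population $x=\mu+H\Lambda^{1/2}z$ in $\mathbb R^d$, where $\mu\in\mathbb R^d$, $\Lambda=\mathrm{diag}(\lambda_1,\dots,\lambda_d)$ with $\lambda_1\ge\dots\ge\lambda_d\ge 0$, $H=(h_1,\dots,h_d)$ is orthogonal, and $z=(z_1,\dots,z_d)^T$ has mean $0$ and identity covariance matrix (all depending on $d$), so that the covariance matrix of $x$ is $\Sigma=H\Lambda H^T=\Sigma_1+\Sigma_2$ with $\Sigma_1=\sum_{s\le m}\lambda_sh_sh_s^T$ and $\Sigma_2=\sum_{s>m}\lambda_sh_sh_s^T$. Assume: (A-i) $E(z_{j_1}^2z_{j_2}^2)=1$ for $j_1\ne j_2$, and $E(z_{j_1}z_{j_2}z_{j_3})=0$, $E(z_{j_1}z_{j_2}z_{j_3}z_{j_4})=0$ whenever $j_1\ne j_2,j_3,j_4$; and $\limsup_{d\to\infty}\max_{j\le d}\mathrm{Var}(z_j^2)<\infty$. (C-i) $\liminf_{d\to\infty}(\lambda_j/\lambda_{j'}-1)>0$ for $1\le j<j'\le m$, $\ \liminf_{d\to\infty}\lambda_m^2/\mathrm{tr}(\Sigma_2^2)>0$,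 and $\lambda_{m+1}^2/\mathrm{tr}(\Sigma_2^2)\to 0$ as $d\to\infty$. Let $x_1,\dots,x_n$ be i.i.d. copies of $x$, let $S=(n-1)^{-1}\sum_{i=1}^n(x_i-\bar x)(x_i-\bar x)^T=\sum_{s=1}^d\hat\lambda_s\hat h_s\hat h_s^T$ be an eigendecomposition with $\hat\lambda_1\ge\dots\ge\hat\lambda_d$ and orthonormal $\hat h_s$, and put $\hat\Sigma_1=\sum_{s=1}^m\hat\lambda_s\hat h_s\hat h_s^T$ and $\delta=\sum_{s=m+1}^d\lambda_s/(n-1)$. Then, as $d\to\infty$ and $n\to\infty$ (in any joint regime), $$\|\hat\Sigma_1-\Sigma_1\|_F^2=m\delta^2+2\sum_{s=1}^m\lambda_s\delta\{1+o_P(1)\}+O_P(\lambda_1^2/n).$$ Moreover, $\hat\Sigma_1$ is inconsistent unless $\delta/\lambda_m\to0$: in any such regime, if $\|\hat\Sigma_1-\Sigma_1\|_F^2=o_P(\lambda_m^2)$, then $\delta/\lambda_m\to 0$. -/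

import Mathlib

open Filter Topology MeasureTheory ProbabilityTheory
open scoped ENNReal

noncomputable section

/-- The matrix `v vᵀ`. -/
def outerSelf {d : ℕ} (v : EuclideanSpace ℝ (Fin d)) : Matrix (Fin d) (Fin d) ℝ :=
  Matrix.vecMulVec v.ofLp v.ofLp

section Frobenius
attribute [local instance] Matrix.frobeniusNormedAddCommGroup

/-- The Frobenius norm of a real square matrix. -/
def frobNorm {d : ℕ} (A : Matrix (Fin d) (Fin d) ℝ) : ℝ := ‖A‖

end Frobenius

/-- A `d`-dimensional population `x = μ + H Λ^{1/2} z`: a mean `μ`, ordered eigenvalues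
`λ₁ ≥ ⋯ ≥ λ_d ≥ 0` of the covariance matrix `Σ = H Λ Hᵀ`, corresponding orthonormal eigenvectors
(the columns of `H`), and the law of the sphered vector `z = (z₁, …, z_d)`, which has mean zero and
identity covariance matrix. The entries of `eigval` and `eigvec` are numbered from `0`. -/
structure Population (d : ℕ) where
  /-- The mean vector. -/
  mean : EuclideanSpace ℝ (Fin d)
  /-- The eigenvalues of the covariance matrix in decreasing order. -/
  eigval : Fin d → ℝ
  eigval_antitone : Antitone eigval
  eigval_nonneg : ∀ j, 0 ≤ eigval j
  /-- The corresponding orthonormal eigenvectors. -/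
  eigvec : OrthonormalBasis (Fin d) ℝ (EuclideanSpace ℝ (Fin d))
  /-- The law of the sphered vector. -/
  law : Measure (Fin d → ℝ)
  law_prob : IsProbabilityMeasure law
  law_memLp : ∀ j, MemLp (fun z : Fin d → ℝ => z j) 2 law
  law_mean : ∀ j, ∫ z, z j ∂law = 0
  law_cov : ∀ j j', ∫ z, z j * z j' ∂law = if j = j' then 1 else 0

namespace Population

variable {d : ℕ} (M : Population d)

/-- The eigenvalue `λ_j`, numbered from `1` as usual (and `0` unless `1 ≤ j ≤ d`). -/
def lam (j : ℕ) : ℝ :=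
  if h : 1 ≤ j ∧ j ≤ d then M.eigval ⟨j - 1, by omega⟩ else 0

/-- The intrinsic part `Σ₁ = ∑_{s ≤ m} λ_s h_s h_sᵀ` of the covariance matrix. -/
def sigma1 (m : ℕ) : Matrix (Fin d) (Fin d) ℝ :=
  ∑ s : Fin d with s.val < m, M.eigval s • outerSelf (M.eigvec s)

/-- The noise part `Σ₂ = ∑_{s > m} λ_s h_s h_sᵀ` of the covariance matrix. -/
def sigma2 (m : ℕ) : Matrix (Fin d) (Fin d) ℝ :=
  ∑ s : Fin d with m ≤ s.val, M.eigval s • outerSelf (M.eigvec s)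

/-- `δ = ∑_{s = m+1}^d λ_s / (n - 1)`. -/
def delta (m n : ℕ) : ℝ :=
  (∑ s ∈ Finset.Icc (m + 1) d, M.lam s) / ((n : ℝ) - 1)

/-- The observation `x = μ + ∑_j λ_j^{1/2} z_j h_j` that belongs to the sphered vector `z`. -/
def observation (z : Fin d → ℝ) : EuclideanSpace ℝ (Fin d) :=
  M.mean + ∑ j, (Real.sqrt (M.eigval j) * z j) • M.eigvec j

end Population

/-- The moment condition on the sphered vectors. The last clause says that the variances
`M_j = Var(z_j²)`, `1 ≤ j ≤ d`, are bounded as `d → ∞`; `evariance` is the variance with values in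
`[0, ∞]`, which is `∞` where the fourth moment is. -/
structure MomentCondition (M : ∀ d, Population d) : Prop where
  sq_sq : ∀ d, ∀ j₁ j₂ : Fin d, j₁ ≠ j₂ → ∫ z, z j₁ ^ 2 * z j₂ ^ 2 ∂(M d).law = 1
  three : ∀ d, ∀ j₁ j₂ j₃ : Fin d, j₁ ≠ j₂ → j₁ ≠ j₃ →
    ∫ z, z j₁ * z j₂ * z j₃ ∂(M d).law = 0
  four : ∀ d, ∀ j₁ j₂ j₃ j₄ : Fin d, j₁ ≠ j₂ → j₁ ≠ j₃ → j₁ ≠ j₄ →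
    ∫ z, z j₁ * z j₂ * z j₃ * z j₄ ∂(M d).law = 0
  limsup_var : limsup (fun d => ⨆ j : Fin d, evariance (fun z => z j ^ 2) (M d).law) atTop < ∞

/-- The strongly spiked eigenvalue condition with `m` spikes. Lower limits are taken in the
extended reals, as the ratios may diverge. -/
structure SpikeCondition (m : ℕ) (M : ∀ d, Population d) : Prop where
  distinct : ∀ j j', 1 ≤ j → j < j' → j' ≤ m →
    0 < liminf (fun d => (((M d).lam j / (M d).lam j' - 1 : ℝ) : EReal)) atTop
  spiked : 0 < liminf (fun d =>
    (((M d).lam m ^ 2 / ((M d).sigma2 m * (M d).sigma2 m).trace : ℝ) : EReal)) atTop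
  noise : Tendsto (fun d =>
    (M d).lam (m + 1) ^ 2 / ((M d).sigma2 m * (M d).sigma2 m).trace) atTop (𝓝 0)

/-- The sample covariance matrix `(n - 1)⁻¹ ∑_i (x_i - x̄)(x_i - x̄)ᵀ`. -/
def sampleCov {d n : ℕ} (x : Fin n → EuclideanSpace ℝ (Fin d)) : Matrix (Fin d) (Fin d) ℝ :=
  ((n : ℝ) - 1)⁻¹ • ∑ i, outerSelf (x i - (n : ℝ)⁻¹ • ∑ i', x i')

/-- `S = ∑_s ev_s h_s h_sᵀ` with `ev_1 ≥ ⋯ ≥ ev_d` and orthonormal `h_1, …, h_d`. -/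
structure IsEigenDecomposition {d : ℕ} (S : Matrix (Fin d) (Fin d) ℝ) (ev : Fin d → ℝ)
    (h : OrthonormalBasis (Fin d) ℝ (EuclideanSpace ℝ (Fin d))) : Prop where
  antitone : Antitone ev
  eq_sum : S = ∑ s, ev s • outerSelf (h s)

/-- The conventional estimator `∑_{s ≤ m} ev_s h_s h_sᵀ` of the intrinsic part. -/
def sigma1Hat {d : ℕ} (m : ℕ) (ev : Fin d → ℝ)
    (h : OrthonormalBasis (Fin d) ℝ (EuclideanSpace ℝ (Fin d))) : Matrix (Fin d) (Fin d) ℝ :=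
  ∑ s : Fin d with s.val < m, ev s • outerSelf (h s)

/-- `R_k = o_P(1)` along the filter `l`: convergence to `0` in probability. -/
def IsLittleOPOne {ι : Type*} (l : Filter ι) {Ω : ι → Type*} [∀ k, MeasurableSpace (Ω k)]
    (P : ∀ k, Measure (Ω k)) (R : ∀ k, Ω k → ℝ) : Prop :=
  ∀ ε : ℝ, 0 < ε → Tendsto (fun k => P k {ω | ε < |R k ω|}) l (𝓝 0)

/-- `R_k = O_P(1)` along the filter `l`: boundedness in probability. -/
def IsBigOPOne {ι : Type*} (l : Filter ι) {Ω : ι → Type*} [∀ k, MeasurableSpace (Ω k)]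
    (P : ∀ k, Measure (Ω k)) (R : ∀ k, Ω k → ℝ) : Prop :=
  ∀ ε : ℝ≥0∞, 0 < ε → ∃ C : ℝ, ∀ᶠ k in l, P k {ω | C < |R k ω|} ≤ ε

end

/-! Let T be the centred data matrix divided by √(n-1), read as a map from ℝ^d to ℝ^n, so that S =
TᵀT. Its dual TTᵀ acts on the vectors of ℝ^n with zero sum. Since T h_a = √λ_a p_a, where p_a is the
standardized a-th coordinate of the sample, the dual is ∑_{t≤m} λ_t p_t p_tᵀ + δI + B on these
vectors: the noise contributes δ times the identity and a fluctuation B. For a typical sample, with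
L = λ_m, the p_t are orthonormal up to O(n^(-1/2)), and B is O(L/n) between two p's, O(L n^(-1/2))
between a p and a unit vector, and at most L/4 on all unit vectors (`TypicalSample.nearFrame`).

The rest is deterministic perturbation theory. The min-max principle puts the m leading sample
eigenvalues above δ + 3L/4. The unit vectors u_s = λ̂_s^(-1/2) T ĥ_s then lie within O(n^(-1/2)) of
the span of the p_t, so the m × m matrix b_ts = ⟨p_t, u_s⟩ is orthogonal up to O(n^(-1/2)), while
B(u_s, u_s') = O(L/n). Testing the eigenvector equation on u_s' gives bᵀ diag(λ) b = diag(λ̂ - δ) -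
B(u, u). Its trace yields ∑(λ̂_s - δ) = ∑λ_t + O(λ_1 n^(-1/2)), the source of the o_P(1) term. As
λ̂_s⟨ĥ_s, h_t⟩² = λ_t b_ts², the squared distance equals mδ² + 2δ∑(λ̂_s - δ) plus the remainder
∑(λ̂_s - δ)² + ∑λ_t² - 2∑λ_t²(bbᵀ)_tt. Completing the square turns the remainder into ∑λ_tλ_t'((bbᵀ
- I)_tt')² plus terms in B(u, u), and all of these are O(λ_1²/n)
(`SpikedEigenvectors.abs_remainder_le`).

Typicality follows from Chebyshev's inequality (`Population.measure_not_typicalSample_le`): all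
conditions but one have probability close to 1 once the constant C is large. The exception asks the
off-diagonal part O of B to have operator norm below a fixed fraction of L. It is handled through tr
O⁴, whose mean is of order ∑_{s>m} λ_s⁴ + (tr Σ₂²)²/n, with ∑_{s>m} λ_s⁴ ≤ λ_{m+1}² tr Σ₂²; both
terms are negligible against L⁴.

For the last claim, λ̂_m ≥ δ + λ_m(1 - O(n^(-1/2))) on a typical sample, whereas λ̂_m - λ_m is at
most the Frobenius distance. -/

noncomputable section

/-! ### Near-orthonormal frames. -/

section Perturbation

open scoped InnerProductSpace

variable {σ V : Type*} [Fintype σ] [NormedAddCommGroup V] [InnerProductSpace ℝ V]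

lemma sq_sum_abs_le_card_mul_sum_sq (c : σ → ℝ) :
    (∑ t, |c t|) ^ 2 ≤ Fintype.card σ * ∑ t, c t ^ 2 := by
  simpa using sq_sum_le_card_mul_sum_sq (s := Finset.univ) (f := fun t => |c t|)

lemma abs_sum_sum_mul_le {f : σ → σ → ℝ} {a : ℝ} (hf : ∀ s t, |f s t| ≤ a) (c e : σ → ℝ) :
    |∑ s, ∑ t, c s * e t * f s t| ≤ a * ((∑ s, |c s|) * ∑ t, |e t|) := by
  rw [Finset.sum_mul_sum, Finset.mul_sum]
  refine (Finset.abs_sum_le_sum_abs _ _).trans (Finset.sum_le_sum fun s _ => ?_)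
  rw [Finset.mul_sum]
  refine (Finset.abs_sum_le_sum_abs _ _).trans (Finset.sum_le_sum fun t _ => ?_)
  rw [abs_mul, abs_mul]
  have := mul_le_mul_of_nonneg_left (hf s t) (by positivity : 0 ≤ |c s| * |e t|)
  linarith

lemma norm_sq_sum_smul (p : σ → V) (c : σ → ℝ) :
    ‖∑ t, c t • p t‖ ^ 2 = ∑ s, ∑ t, c s * c t * ⟪p s, p t⟫_ℝ := by
  rw [← real_inner_self_eq_norm_sq, sum_inner]
  refine Finset.sum_congr rfl fun s _ => ?_
  rw [inner_sum]
  refine Finset.sum_congr rfl fun t _ => ?_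
  rw [real_inner_smul_left, real_inner_smul_right]
  ring

lemma apply_sum_smul_sum_smul (B : V →ₗ[ℝ] V →ₗ[ℝ] ℝ) (p : σ → V) (c e : σ → ℝ) :
    B (∑ t, c t • p t) (∑ t, e t • p t) = ∑ s, ∑ t, c s * e t * B (p s) (p t) := by
  simp only [map_sum, map_smul, LinearMap.coe_sum, Finset.sum_apply, LinearMap.smul_apply,
    smul_eq_mul, Finset.mul_sum]
  rw [Finset.sum_comm]
  exact Finset.sum_congr rfl fun _ _ => Finset.sum_congr rfl fun _ _ => by ring

variable [DecidableEq σ]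

/-- The error is a quadratic form in `c` whose entries are at most `η`, and (∑|c_t|)² is at most the
cardinality times ∑c_t². -/
lemma abs_norm_sq_sum_smul_sub_le {p : σ → V} {η : ℝ}
    (hp : ∀ s t, |⟪p s, p t⟫_ℝ - if s = t then 1 else 0| ≤ η) (c : σ → ℝ) :
    |‖∑ t, c t • p t‖ ^ 2 - ∑ t, c t ^ 2| ≤ Fintype.card σ * η * ∑ t, c t ^ 2 := by
  have h1 : ‖∑ t, c t • p t‖ ^ 2 - ∑ t, c t ^ 2 =
      ∑ s, ∑ t, c s * c t * (⟪p s, p t⟫_ℝ - if s = t then 1 else 0) := by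
    rw [norm_sq_sum_smul, ← Finset.sum_sub_distrib]
    refine Finset.sum_congr rfl fun s _ => ?_
    simp only [mul_sub, Finset.sum_sub_distrib]
    simp [sq]
  rw [h1]
  rcases isEmpty_or_nonempty σ with hσ | ⟨⟨s₀⟩⟩
  · simp
  have hη : 0 ≤ η := (abs_nonneg _).trans (hp s₀ s₀)
  refine (abs_sum_sum_mul_le hp c c).trans ?_
  rw [← sq, mul_comm (Fintype.card σ : ℝ) η, mul_assoc]
  exact mul_le_mul_of_nonneg_left (sq_sum_abs_le_card_mul_sum_sq c) hη

/-- Bessel's inequality with an error. The sum is ⟨y, x⟩ for y = ∑⟨p_t, x⟩p_t, and ‖y‖² exceeds the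
sum by the stated factor at most, so Cauchy–Schwarz closes the estimate. -/
lemma sum_sq_inner_le {p : σ → V} {η : ℝ}
    (hp : ∀ s t, |⟪p s, p t⟫_ℝ - if s = t then 1 else 0| ≤ η) (x : V) :
    ∑ t, ⟪p t, x⟫_ℝ ^ 2 ≤ (1 + Fintype.card σ * η) * ‖x‖ ^ 2 := by
  rcases isEmpty_or_nonempty σ with hσ | ⟨⟨s₀⟩⟩
  · simp
  have hη : 0 ≤ η := (abs_nonneg _).trans (hp s₀ s₀)
  set S := ∑ t, ⟪p t, x⟫_ℝ ^ 2 with hS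
  have hS0 : 0 ≤ S := Finset.sum_nonneg fun _ _ => sq_nonneg _
  have h1 : S = ⟪∑ t, ⟪p t, x⟫_ℝ • p t, x⟫_ℝ := by
    rw [sum_inner]
    exact Finset.sum_congr rfl fun t _ => by rw [real_inner_smul_left, sq]
  have h2 := (abs_le.1 (abs_norm_sq_sum_smul_sub_le hp fun t => ⟪p t, x⟫_ℝ)).2
  have h3 : S ^ 2 ≤ ‖∑ t, ⟪p t, x⟫_ℝ • p t‖ ^ 2 * ‖x‖ ^ 2 := by
    rw [← mul_pow]
    nth_rw 1 [h1]
    exact sq_le_sq' (by linarith [neg_le_of_abs_le (abs_real_inner_le_norm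
      (∑ t, ⟪p t, x⟫_ℝ • p t) x)]) (real_inner_le_norm _ _)
  by_contra! hlt
  have hpos : 0 < S := lt_of_le_of_lt (by positivity) hlt
  have h4 : S ^ 2 ≤ ((1 + Fintype.card σ * η) * S) * ‖x‖ ^ 2 :=
    h3.trans (mul_le_mul_of_nonneg_right (by linarith) (sq_nonneg _))
  nlinarith

/-- The converse of Bessel's inequality, available on the span only: there ‖x‖² = ∑ c_t⟨p_t, x⟩, and
∑c_t² is controlled by ‖x‖². -/
lemma le_sum_sq_inner {p : σ → V} {η : ℝ}
    (hp : ∀ s t, |⟪p s, p t⟫_ℝ - if s = t then 1 else 0| ≤ η)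
    (hη : Fintype.card σ * η ≤ 1 / 2) (c : σ → ℝ) :
    (1 - Fintype.card σ * η) * ‖∑ s, c s • p s‖ ^ 2 ≤
      ∑ t, ⟪p t, ∑ s, c s • p s⟫_ℝ ^ 2 := by
  set x := ∑ s, c s • p s with hx
  have h2 := (abs_le.1 (abs_norm_sq_sum_smul_sub_le hp c)).1
  rw [← hx] at h2
  have h1 : ‖x‖ ^ 2 = ∑ t, c t * ⟪p t, x⟫_ℝ := by
    rw [← real_inner_self_eq_norm_sq]
    nth_rw 1 [hx]
    rw [sum_inner]
    exact Finset.sum_congr rfl fun t _ => by rw [real_inner_smul_left]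
  have h3 : (‖x‖ ^ 2) ^ 2 ≤ (∑ t, c t ^ 2) * ∑ t, ⟪p t, x⟫_ℝ ^ 2 := by
    rw [h1]; exact Finset.sum_mul_sq_le_sq_mul_sq _ _ _
  have hc0 : 0 ≤ ∑ t, c t ^ 2 := Finset.sum_nonneg fun _ _ => sq_nonneg _
  have hS0 : 0 ≤ ∑ t, ⟪p t, x⟫_ℝ ^ 2 := Finset.sum_nonneg fun _ _ => sq_nonneg _
  have h4 : (1 - Fintype.card σ * η) * ∑ t, c t ^ 2 ≤ ‖x‖ ^ 2 := by linarith
  rcases (sq_nonneg ‖x‖).eq_or_lt with h0 | h0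
  · rw [← h0, mul_zero]; exact hS0
  have h5 : (1 - Fintype.card σ * η) * (‖x‖ ^ 2) ^ 2 ≤ ‖x‖ ^ 2 * ∑ t, ⟪p t, x⟫_ℝ ^ 2 := by
    calc _ ≤ (1 - Fintype.card σ * η) * ((∑ t, c t ^ 2) * ∑ t, ⟪p t, x⟫_ℝ ^ 2) :=
          mul_le_mul_of_nonneg_left h3 (by linarith)
      _ ≤ _ := by
          rw [← mul_assoc]
          exact mul_le_mul_of_nonneg_right h4 hS0
  refine le_of_mul_le_mul_left ?_ h0
  linarith

/-- Vectors `p t` that are orthonormal up to `C * h`, in a subspace `K` on which the symmetric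
bilinear form `B` is at most `L / 4`, and smaller at the `p t`. -/
structure NearFrame (K : Submodule ℝ V) (B : V →ₗ[ℝ] V →ₗ[ℝ] ℝ) (p : σ → V) (C L h : ℝ) : Prop where
  mem : ∀ t, p t ∈ K
  symm : ∀ x y, B x y = B y x
  gram : ∀ s t, |⟪p s, p t⟫_ℝ - if s = t then 1 else 0| ≤ C * h
  apply_apply : ∀ s t, |B (p s) (p t)| ≤ C * L * h ^ 2
  apply : ∀ t, ∀ x ∈ K, |B (p t) x| ≤ C * L * h * ‖x‖
  bound : ∀ x ∈ K, ∀ y ∈ K, |B x y| ≤ L / 4 * ‖x‖ * ‖y‖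

variable {K : Submodule ℝ V} {B : V →ₗ[ℝ] V →ₗ[ℝ] ℝ} {p : σ → V} {C L h : ℝ}

namespace NearFrame

/-- The smallness of `h` under which the frame is used. -/
def Small (σ : Type*) [Fintype σ] (C L h : ℝ) : Prop :=
  1 ≤ C ∧ 0 < L ∧ 0 < h ∧ h ≤ 1 ∧ 1 ≤ (Fintype.card σ : ℝ) ∧ 12 * (Fintype.card σ * C * h) ≤ 1

/-- Bounds on `B` at the frame vectors pass to their span through the ℓ¹ norm of the coefficients,
which near-orthonormality controls by the norm of the vector. -/
lemma sum_abs_sq_le (hF : NearFrame K B p C L h) (hS : Small σ C L h) (c : σ → ℝ) :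
    (∑ t, |c t|) ^ 2 ≤ 2 * Fintype.card σ * ‖∑ t, c t • p t‖ ^ 2 := by
  obtain ⟨hC, hL, hh, hh1, hm, hs⟩ := hS
  have h1 := (abs_le.1 (abs_norm_sq_sum_smul_sub_le hF.gram c)).1
  have h2 := sq_sum_abs_le_card_mul_sum_sq c
  have hc0 : 0 ≤ ∑ t, c t ^ 2 := Finset.sum_nonneg fun _ _ => sq_nonneg _
  have h3 : Fintype.card σ * (C * h) * ∑ t, c t ^ 2 ≤ 1 / 2 * ∑ t, c t ^ 2 :=
    mul_le_mul_of_nonneg_right (by linarith) hc0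
  have h4 : ∑ t, c t ^ 2 ≤ 2 * ‖∑ t, c t • p t‖ ^ 2 := by linarith
  have h5 := mul_le_mul_of_nonneg_left h4 (by linarith : (0 : ℝ) ≤ Fintype.card σ)
  linarith

lemma sum_abs_le (hF : NearFrame K B p C L h) (hS : Small σ C L h) (c : σ → ℝ) :
    ∑ t, |c t| ≤ 2 * Fintype.card σ * ‖∑ t, c t • p t‖ := by
  refine abs_le_of_sq_le_sq' ?_ (by positivity) |>.2
  refine (hF.sum_abs_sq_le hS c).trans ?_
  have := hS.2.2.2.2.1
  have h1 : 2 * (Fintype.card σ : ℝ) ≤ (2 * Fintype.card σ) ^ 2 := by nlinarith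
  rw [mul_pow (2 * (Fintype.card σ : ℝ))]
  exact mul_le_mul_of_nonneg_right h1 (sq_nonneg _)

lemma abs_apply_le (hF : NearFrame K B p C L h) (hS : Small σ C L h) (c : σ → ℝ) {x : V}
    (hx : x ∈ K) :
    |B (∑ t, c t • p t) x| ≤ 2 * Fintype.card σ * (C * L * h) * ‖∑ t, c t • p t‖ * ‖x‖ := by
  have h1 : B (∑ t, c t • p t) x = ∑ t, c t * B (p t) x := by simp
  have h2 : |B (∑ t, c t • p t) x| ≤ (∑ t, |c t|) * (C * L * h * ‖x‖) := by
    rw [h1, Finset.sum_mul]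
    refine (Finset.abs_sum_le_sum_abs _ _).trans (Finset.sum_le_sum fun t _ => ?_)
    rw [abs_mul]
    exact mul_le_mul_of_nonneg_left (hF.apply t x hx) (abs_nonneg _)
  obtain ⟨hC, hL, hh, -⟩ := id hS
  have h3 := mul_le_mul_of_nonneg_right (hF.sum_abs_le hS c) (by positivity : 0 ≤ C * L * h * ‖x‖)
  linarith

lemma abs_apply_apply_le (hF : NearFrame K B p C L h) (hS : Small σ C L h) (c e : σ → ℝ) :
    |B (∑ t, c t • p t) (∑ t, e t • p t)| ≤
      4 * Fintype.card σ ^ 2 * (C * L * h ^ 2) * ‖∑ t, c t • p t‖ * ‖∑ t, e t • p t‖ := by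
  rw [apply_sum_smul_sum_smul]
  refine (abs_sum_sum_mul_le hF.apply_apply c e).trans ?_
  obtain ⟨hC, hL, hh, -⟩ := id hS
  have h2 := mul_le_mul (hF.sum_abs_le hS c) (hF.sum_abs_le hS e)
    (Finset.sum_nonneg fun _ _ => abs_nonneg _) (by positivity)
  have h3 := mul_le_mul_of_nonneg_left h2 (by positivity : 0 ≤ C * L * h ^ 2)
  linarith

/-- On the diagonal the squared ℓ¹ bound applies directly and costs one factor of the cardinality
instead of two. This form serves the min-max bound for the sample eigenvalues. -/
lemma abs_apply_self_le (hF : NearFrame K B p C L h) (hS : Small σ C L h) (c : σ → ℝ) :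
    |B (∑ t, c t • p t) (∑ t, c t • p t)| ≤
      2 * Fintype.card σ * (C * L * h ^ 2) * ‖∑ t, c t • p t‖ ^ 2 := by
  rw [apply_sum_smul_sum_smul]
  refine (abs_sum_sum_mul_le hF.apply_apply c c).trans ?_
  obtain ⟨hC, hL, hh, -⟩ := id hS
  have h3 := mul_le_mul_of_nonneg_left (hF.sum_abs_sq_le hS c)
    (by positivity : 0 ≤ C * L * h ^ 2)
  rw [← sq]
  linarith

end NearFrame

end Perturbation

/-! ### Perturbation of the spiked eigenvectors. -/

section Perturbation

open scoped InnerProductSpace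

variable {σ V : Type*} [Fintype σ] [NormedAddCommGroup V] [InnerProductSpace ℝ V]
  {K : Submodule ℝ V} {B : V →ₗ[ℝ] V →ₗ[ℝ] ℝ} {p : σ → V} {C L h : ℝ}

/-- With Λ = diag(lam), both sides are traces of the same cyclic word: tr (bᵀΛb bᵀΛb) = tr (Λbbᵀ
Λbbᵀ). -/
lemma sum_sq_weighted_gram_eq (lam : σ → ℝ) (b : σ → σ → ℝ) :
    ∑ s, ∑ s', (∑ t, lam t * b t s * b t s') ^ 2 =
      ∑ t, ∑ t', lam t * lam t' * (∑ s, b t s * b t' s) ^ 2 := by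
  have h1 : ∀ s s', (∑ t, lam t * b t s * b t s') ^ 2 =
      ∑ t, ∑ t', lam t * lam t' * (b t s * b t' s) * (b t s' * b t' s') := fun s s' => by
    rw [sq, Finset.sum_mul_sum]
    exact Finset.sum_congr rfl fun _ _ => Finset.sum_congr rfl fun _ _ => by ring
  have h2 : ∀ t t', lam t * lam t' * (∑ s, b t s * b t' s) ^ 2 =
      ∑ s, ∑ s', lam t * lam t' * (b t s * b t' s) * (b t s' * b t' s') := fun t t' => by
    rw [sq, Finset.sum_mul_sum, Finset.mul_sum]
    refine Finset.sum_congr rfl fun _ _ => ?_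
    rw [Finset.mul_sum]
    exact Finset.sum_congr rfl fun _ _ => by ring
  simp only [h1, h2]
  calc _ = ∑ s, ∑ t, ∑ s', ∑ t', lam t * lam t' * (b t s * b t' s) * (b t s' * b t' s') :=
        Finset.sum_congr rfl fun _ _ => Finset.sum_comm
    _ = ∑ t, ∑ s, ∑ s', ∑ t', lam t * lam t' * (b t s * b t' s) * (b t s' * b t' s') :=
        Finset.sum_comm
    _ = ∑ t, ∑ s, ∑ t', ∑ s', lam t * lam t' * (b t s * b t' s) * (b t s' * b t' s') :=
        Finset.sum_congr rfl fun _ _ => Finset.sum_congr rfl fun _ _ => Finset.sum_comm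
    _ = _ := Finset.sum_congr rfl fun _ _ => Finset.sum_comm

variable [DecidableEq σ]

/-- For a square matrix, bbᵀ and bᵀb have the same trace and the same trace of the square. This
carries near-orthogonality from the columns of b, indexed by eigenvectors, to its rows, indexed by
spikes. -/
lemma sum_sq_gram_eq (b : σ → σ → ℝ) :
    ∑ t, ∑ t', ((∑ s, b t s * b t' s) - if t = t' then 1 else 0) ^ 2 =
      ∑ s, ∑ s', ((∑ t, b t s * b t s') - if s = s' then 1 else 0) ^ 2 := by
  have key : ∀ A : Matrix σ σ ℝ, ∑ i, ∑ j, A i j ^ 2 = (A * A.transpose).trace := fun A => by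
    simp [Matrix.trace, Matrix.mul_apply, sq]
  set A : Matrix σ σ ℝ := Matrix.of b with hA
  have h1 : ∀ t t', (∑ s, b t s * b t' s) - (if t = t' then (1 : ℝ) else 0) =
      (A * A.transpose - 1) t t' := fun t t' => by
    simp [Matrix.mul_apply, hA, Matrix.one_apply]
  have h2 : ∀ s s', (∑ t, b t s * b t s') - (if s = s' then (1 : ℝ) else 0) =
      (A.transpose * A - 1) s s' := fun s s' => by
    simp [Matrix.mul_apply, hA, Matrix.one_apply]
  simp only [h1, h2, key]
  simp only [Matrix.transpose_sub, Matrix.transpose_mul, Matrix.transpose_transpose,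
    Matrix.transpose_one, mul_sub, sub_mul, mul_one, one_mul, Matrix.trace_sub]
  rw [Matrix.trace_mul_comm A A.transpose, Matrix.mul_assoc, Matrix.trace_mul_comm A]
  simp only [Matrix.mul_assoc]

/-- Orthonormal vectors `u s` that satisfy the eigenvector equation, tested on `K`, of the form
`∑ t, lam t ⟪p t, ·⟫ ⟪p t, ·⟫ + δ ⟪·, ·⟫ + B` at eigenvalues well above `δ`. -/
structure SpikedEigenvectors (K : Submodule ℝ V) (B : V →ₗ[ℝ] V →ₗ[ℝ] ℝ) (p u : σ → V)
    (lam ev : σ → ℝ) (L Λ δ : ℝ) : Prop where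
  mem : ∀ s, u s ∈ K
  orthonormal : Orthonormal ℝ u
  lower : ∀ t, L ≤ lam t
  upper : ∀ t, lam t ≤ Λ
  gap : ∀ s, δ + 3 / 4 * L ≤ ev s
  eq : ∀ s, ∀ x ∈ K, ev s * ⟪u s, x⟫_ℝ =
    ∑ t, lam t * ⟪p t, u s⟫_ℝ * ⟪p t, x⟫_ℝ + δ * ⟪u s, x⟫_ℝ + B (u s) x

namespace SpikedEigenvectors

variable {u : σ → V} {lam ev : σ → ℝ} {Λ δ : ℝ}

/-- Let x be the projection of `u s` to the span of the frame. Tested on the rest r, the eigenvector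
equation loses its spiked part and reads (ev - δ)‖r‖² = B(x, r) + B(r, r). The right side is at most
2qL‖r‖ + (L/4)‖r‖² with q = card · C · h, and ev - δ ≥ 3L/4, which leaves ‖r‖ ≤ 4q. -/
lemma exists_decomposition (hF : NearFrame K B p C L h) (hS : NearFrame.Small σ C L h)
    (hU : SpikedEigenvectors K B p u lam ev L Λ δ) (s : σ) :
    ∃ c : σ → ℝ, ∃ r ∈ K, u s = ∑ t, c t • p t + r ∧ (∀ t, ⟪p t, r⟫_ℝ = 0) ∧
      ‖∑ t, c t • p t‖ ≤ 1 ∧ ‖r‖ ≤ 4 * (Fintype.card σ * C * h) := by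
  set W := Submodule.span ℝ (Set.range p) with hW
  have hfin : FiniteDimensional ℝ W := FiniteDimensional.span_of_finite ℝ (Set.finite_range p)
  obtain ⟨c, hc⟩ := (Submodule.mem_span_range_iff_exists_fun ℝ).1
    (W.starProjection_apply_mem (u s))
  set x := ∑ t, c t • p t with hx
  set r := u s - x with hr
  have hrW : r ∈ Wᗮ := by
    rw [hr, hc]; exact W.sub_starProjection_mem_orthogonal (u s)
  have hpr : ∀ t, ⟪p t, r⟫_ℝ = 0 := fun t =>
    (Submodule.mem_orthogonal W r).1 hrW _ (Submodule.subset_span ⟨t, rfl⟩)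
  have hxK : x ∈ K := Submodule.sum_mem _ fun t _ => Submodule.smul_mem _ _ (hF.mem t)
  have hrK : r ∈ K := Submodule.sub_mem _ (hU.mem s) hxK
  have hxr : ⟪x, r⟫_ℝ = 0 := by
    rw [hx, sum_inner]
    exact Finset.sum_eq_zero fun t _ => by rw [real_inner_smul_left, hpr t, mul_zero]
  have hu : u s = x + r := by rw [hr]; abel
  have hnorm : ‖x‖ ^ 2 + ‖r‖ ^ 2 = 1 := by
    have h1 := norm_add_sq_real x r
    rw [← hu, hU.orthonormal.1 s, hxr] at h1
    linarith
  have hx1 : ‖x‖ ≤ 1 := by nlinarith [norm_nonneg x, sq_nonneg ‖r‖]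
  refine ⟨c, r, hrK, hu, hpr, hx1, ?_⟩
  obtain ⟨hC, hL, hh, hh1, hm, hs⟩ := id hS
  have h1 := hU.eq s r hrK
  have h2 : ⟪u s, r⟫_ℝ = ‖r‖ ^ 2 := by
    rw [hu, inner_add_left, hxr, real_inner_self_eq_norm_sq, zero_add]
  rw [h2, Finset.sum_eq_zero fun t _ => by rw [hpr t, mul_zero], zero_add] at h1
  have h3 : B (u s) r = B x r + B r r := by rw [hu, map_add, LinearMap.add_apply]
  have h4 := (abs_le.1 (hF.abs_apply_le hS c hrK)).2
  have h5 := (abs_le.1 (hF.bound r hrK r hrK)).2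
  rw [← hx] at h4
  have h6 : 2 * Fintype.card σ * (C * L * h) * ‖x‖ * ‖r‖ ≤
      2 * Fintype.card σ * (C * L * h) * 1 * ‖r‖ := by gcongr
  have h7 := mul_le_mul_of_nonneg_right (hU.gap s) (sq_nonneg ‖r‖)
  have h8 : L / 2 * ‖r‖ ^ 2 ≤ L / 2 * (4 * (Fintype.card σ * C * h)) * ‖r‖ := by nlinarith
  rcases (norm_nonneg r).eq_or_lt with h0 | h0
  · rw [← h0]; positivity
  · have h9 : L / 2 * ‖r‖ * ‖r‖ ≤ L / 2 * (4 * (Fintype.card σ * C * h)) * ‖r‖ := by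
      linarith
    have h10 := le_of_mul_le_mul_right h9 h0
    exact le_of_mul_le_mul_left h10 (by positivity)

/-- Each of the four terms B(x, x'), B(x, r'), B(x', r), B(r, r') is of second order in q; their
constants 4, 8, 8, 4 add up to 24. -/
lemma abs_apply_le (hF : NearFrame K B p C L h) (hS : NearFrame.Small σ C L h)
    (hU : SpikedEigenvectors K B p u lam ev L Λ δ) (s s' : σ) :
    |B (u s) (u s')| ≤ 24 * (Fintype.card σ * C * h) ^ 2 * L := by
  obtain ⟨c, r, hr, hu, -, hx, hrn⟩ := hU.exists_decomposition hF hS s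
  obtain ⟨c', r', hr', hu', -, hx', hrn'⟩ := hU.exists_decomposition hF hS s'
  obtain ⟨hC, hL, hh, hh1, hm, hs⟩ := id hS
  have h1 := hF.abs_apply_apply_le hS c c'
  have h2 := hF.abs_apply_le hS c hr'
  have h3 := hF.abs_apply_le hS c' hr
  have h4 := hF.bound r hr r' hr'
  set q := Fintype.card σ * C * h with hq
  have hq0 : 0 ≤ q := by positivity
  have e1 : 4 * Fintype.card σ ^ 2 * (C * L * h ^ 2) * ‖∑ t, c t • p t‖ * ‖∑ t, c' t • p t‖ ≤
      4 * q ^ 2 * L := by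
    calc _ ≤ 4 * Fintype.card σ ^ 2 * (C * L * h ^ 2) * 1 * 1 := by gcongr
      _ = 4 * (Fintype.card σ ^ 2 * h ^ 2 * L) * C := by ring
      _ ≤ 4 * (Fintype.card σ ^ 2 * h ^ 2 * L) * C ^ 2 := by gcongr; nlinarith
      _ = _ := by rw [hq]; ring
  have e2 : 2 * Fintype.card σ * (C * L * h) * ‖∑ t, c t • p t‖ * ‖r'‖ ≤ 8 * q ^ 2 * L := by
    calc _ ≤ 2 * Fintype.card σ * (C * L * h) * 1 * (4 * q) := by gcongr
      _ = _ := by rw [hq]; ring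
  have e3 : 2 * Fintype.card σ * (C * L * h) * ‖∑ t, c' t • p t‖ * ‖r‖ ≤ 8 * q ^ 2 * L := by
    calc _ ≤ 2 * Fintype.card σ * (C * L * h) * 1 * (4 * q) := by gcongr
      _ = _ := by rw [hq]; ring
  have e4 : L / 4 * ‖r‖ * ‖r'‖ ≤ 4 * q ^ 2 * L := by
    calc _ ≤ L / 4 * (4 * q) * (4 * q) := by gcongr
      _ = _ := by ring
  rw [hu, hu']
  simp only [map_add, LinearMap.add_apply]
  rw [hF.symm r]
  refine (abs_add_le _ _).trans ?_
  have t1 := abs_add_le (B (∑ t, c t • p t) (∑ t, c' t • p t)) (B (∑ t, c' t • p t) r)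
  have t2 := abs_add_le (B (∑ t, c t • p t) r') (B r r')
  linarith

/-- The inner products see only the part in the span, where both Bessel bounds hold; the rest enters
through its squared norm alone. -/
lemma abs_sum_sq_inner_sub_le (hF : NearFrame K B p C L h) (hS : NearFrame.Small σ C L h)
    (c : σ → ℝ) {r : V} (hr : ∀ t, ⟪p t, r⟫_ℝ = 0) :
    |∑ t, ⟪p t, ∑ t, c t • p t + r⟫_ℝ ^ 2 - ‖∑ t, c t • p t + r‖ ^ 2| ≤
      Fintype.card σ * C * h * ‖∑ t, c t • p t + r‖ ^ 2 + ‖r‖ ^ 2 := by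
  obtain ⟨hC, hL, hh, hh1, hm, hs⟩ := id hS
  have h1 := sum_sq_inner_le hF.gram (∑ t, c t • p t + r)
  have h2 := le_sum_sq_inner hF.gram (by linarith) c
  have h3 : ⟪∑ t, c t • p t, r⟫_ℝ = 0 := by
    rw [sum_inner]
    exact Finset.sum_eq_zero fun t _ => by rw [real_inner_smul_left, hr t, mul_zero]
  have h4 := norm_add_sq_real (∑ t, c t • p t) r
  rw [h3] at h4
  have h5 : ∀ t, ⟪p t, ∑ t, c t • p t + r⟫_ℝ = ⟪p t, ∑ t, c t • p t⟫_ℝ := fun t => by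
    rw [inner_add_right, hr t, add_zero]
  simp only [h5] at h1 ⊢
  have h6 : 0 ≤ Fintype.card σ * C * h * ‖r‖ ^ 2 := by positivity
  rw [abs_le]
  constructor <;> nlinarith [sq_nonneg ‖r‖]

lemma abs_gram_sub_le (hF : NearFrame K B p C L h) (hS : NearFrame.Small σ C L h)
    (hU : SpikedEigenvectors K B p u lam ev L Λ δ) (s s' : σ) :
    |∑ t, ⟪p t, u s⟫_ℝ * ⟪p t, u s'⟫_ℝ - if s = s' then 1 else 0| ≤
      5 * (Fintype.card σ * C * h) := by
  obtain ⟨c, r, hr, hu, hpr, hx, hrn⟩ := hU.exists_decomposition hF hS s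
  obtain ⟨c', r', hr', hu', hpr', hx', hrn'⟩ := hU.exists_decomposition hF hS s'
  obtain ⟨hC, hL, hh, hh1, hm, hs⟩ := id hS
  set q := Fintype.card σ * C * h with hq
  have hq0 : 0 ≤ q := by positivity
  -- Polarization: the quadratic estimate is applied to u_s + u_s' and u_s - u_s'. Its error is 4q +
  -- 64q² ≤ 10q because 12q ≤ 1, and subtracting the two cases and dividing by four leaves 5q.
  have key : ∀ ε : ℝ, ‖ε‖ = 1 →
      |∑ t, ⟪p t, u s + ε • u s'⟫_ℝ ^ 2 - ‖u s + ε • u s'‖ ^ 2| ≤ 10 * q := fun ε hε' => by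
    have e1 : u s + ε • u s' = ∑ t, (c t + ε * c' t) • p t + (r + ε • r') := by
      rw [hu, hu']
      simp only [add_smul, Finset.sum_add_distrib, smul_add, Finset.smul_sum, mul_smul]
      abel
    have e2 := abs_sum_sq_inner_sub_le hF hS (fun t => c t + ε * c' t) (r := r + ε • r')
      fun t => by rw [inner_add_right, real_inner_smul_right, hpr, hpr', mul_zero, add_zero]
    rw [← e1, ← hq] at e2
    have e3 : ‖u s + ε • u s'‖ ≤ 2 := by
      refine (norm_add_le _ _).trans ?_
      rw [norm_smul, hU.orthonormal.1 s, hU.orthonormal.1 s', hε']; norm_num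
    have e4 : ‖r + ε • r'‖ ≤ 8 * q := by
      refine (norm_add_le _ _).trans ?_
      rw [norm_smul, hε']; linarith
    have e5 : ‖u s + ε • u s'‖ ^ 2 ≤ 2 ^ 2 := by gcongr
    have e6 : ‖r + ε • r'‖ ^ 2 ≤ (8 * q) ^ 2 := by gcongr
    refine e2.trans ?_
    have e7 := mul_le_mul_of_nonneg_left e5 hq0
    nlinarith
  have k1 := abs_le.1 (key 1 (by norm_num))
  have k2 := abs_le.1 (key (-1) (by norm_num))
  have h1 := norm_add_sq_real (u s) ((1 : ℝ) • u s')
  have h2 := norm_add_sq_real (u s) ((-1 : ℝ) • u s')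
  have h3 : ⟪u s, u s'⟫_ℝ = if s = s' then 1 else 0 := orthonormal_iff_ite.1 hU.orthonormal s s'
  rw [real_inner_smul_right, norm_smul, h3] at h1 h2
  have h4 : ∑ t, ⟪p t, u s + (1 : ℝ) • u s'⟫_ℝ ^ 2 - ∑ t, ⟪p t, u s + (-1 : ℝ) • u s'⟫_ℝ ^ 2 =
      4 * ∑ t, ⟪p t, u s⟫_ℝ * ⟪p t, u s'⟫_ℝ := by
    rw [← Finset.sum_sub_distrib, Finset.mul_sum]
    refine Finset.sum_congr rfl fun t _ => ?_
    rw [inner_add_right, inner_add_right, real_inner_smul_right, real_inner_smul_right]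
    ring
  simp only [norm_neg, norm_one] at h1 h2
  rw [abs_le]
  constructor <;> linarith

/-- This is the eigenvector equation of `u s` tested on `u s'`: in the basis `u` the spiked part is
diagonal up to `B`. -/
lemma sub_apply_eq (hU : SpikedEigenvectors K B p u lam ev L Λ δ) (s s' : σ) :
    ∑ t, lam t * ⟪p t, u s⟫_ℝ * ⟪p t, u s'⟫_ℝ =
      (if s = s' then ev s - δ else 0) - B (u s) (u s') := by
  have h := hU.eq s (u s') (hU.mem s')
  rw [orthonormal_iff_ite.1 hU.orthonormal s s'] at h
  split_ifs at h ⊢ <;> linarith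

lemma sum_sq_gram_sub_le (hF : NearFrame K B p C L h) (hS : NearFrame.Small σ C L h)
    (hU : SpikedEigenvectors K B p u lam ev L Λ δ) :
    ∑ t, ∑ t', ((∑ s, ⟪p t, u s⟫_ℝ * ⟪p t', u s⟫_ℝ) - if t = t' then 1 else 0) ^ 2 ≤
      (5 * Fintype.card σ * (Fintype.card σ * C * h)) ^ 2 := by
  rw [sum_sq_gram_eq fun t s => ⟪p t, u s⟫_ℝ]
  calc _ ≤ ∑ s : σ, ∑ s' : σ, (5 * (Fintype.card σ * C * h)) ^ 2 :=
        Finset.sum_le_sum fun s _ => Finset.sum_le_sum fun s' _ =>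
          sq_le_sq.2 ((hU.abs_gram_sub_le hF hS s s').trans (le_abs_self _))
    _ = _ := by simp; ring

lemma abs_gram'_sub_le (hF : NearFrame K B p C L h) (hS : NearFrame.Small σ C L h)
    (hU : SpikedEigenvectors K B p u lam ev L Λ δ) (t : σ) :
    |∑ s, ⟪p t, u s⟫_ℝ ^ 2 - 1| ≤ 5 * Fintype.card σ * (Fintype.card σ * C * h) := by
  obtain ⟨hC, hL, hh, hh1, hm, hs⟩ := id hS
  refine abs_le_of_sq_le_sq ((le_trans ?_ (hU.sum_sq_gram_sub_le hF hS))) (by positivity)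
  have h1 := Finset.single_le_sum (f := fun t => ∑ t', ((∑ s, ⟪p t, u s⟫_ℝ * ⟪p t', u s⟫_ℝ) -
    if t = t' then 1 else 0) ^ 2) (fun i _ => Finset.sum_nonneg fun _ _ => sq_nonneg _)
    (Finset.mem_univ t)
  have h2 := Finset.single_le_sum (f := fun t' => ((∑ s, ⟪p t, u s⟫_ℝ * ⟪p t', u s⟫_ℝ) -
    if t = t' then 1 else 0) ^ 2) (fun i _ => sq_nonneg _) (Finset.mem_univ t)
  refine le_trans ?_ (h2.trans h1)
  simp [sq]

/-- The sum of the spiked eigenvalues. -/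
lemma abs_sum_ev_sub_le (hF : NearFrame K B p C L h) (hS : NearFrame.Small σ C L h)
    (hU : SpikedEigenvectors K B p u lam ev L Λ δ) (hΛ : L ≤ Λ) :
    |∑ s, (ev s - δ) - ∑ t, lam t| ≤ 7 * Fintype.card σ ^ 2 * (Fintype.card σ * C * h) * Λ := by
  obtain ⟨hC, hL, hh, hh1, hm, hs⟩ := id hS
  set q := Fintype.card σ * C * h with hq
  have hq0 : 0 ≤ q := by positivity
  -- The trace of the relation `sub_apply_eq`. The two parts contribute 5 and 2 to the constant 7,
  -- the second because 24q² ≤ 2q.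
  have h1 : ∑ s, (ev s - δ) - ∑ t, lam t =
      ∑ t, lam t * (∑ s, ⟪p t, u s⟫_ℝ ^ 2 - 1) + ∑ s, B (u s) (u s) := by
    have e1 : ∀ s, ev s - δ = ∑ t, lam t * ⟪p t, u s⟫_ℝ * ⟪p t, u s⟫_ℝ + B (u s) (u s) :=
      fun s => by rw [hU.sub_apply_eq s s, if_pos rfl]; ring
    simp only [e1, Finset.sum_add_distrib, mul_sub, Finset.sum_sub_distrib, mul_one]
    rw [Finset.sum_comm]
    simp only [Finset.mul_sum, sq, mul_assoc]
    ring
  rw [h1]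
  have h2 : |∑ t, lam t * (∑ s, ⟪p t, u s⟫_ℝ ^ 2 - 1)| ≤
      ∑ t : σ, Λ * (5 * Fintype.card σ * q) := by
    refine (Finset.abs_sum_le_sum_abs _ _).trans (Finset.sum_le_sum fun t _ => ?_)
    rw [abs_mul, abs_of_nonneg (hL.le.trans (hU.lower t))]
    exact mul_le_mul (hU.upper t) (hU.abs_gram'_sub_le hF hS t) (abs_nonneg _) (by linarith)
  have h3 : |∑ s, B (u s) (u s)| ≤ ∑ s : σ, 24 * q ^ 2 * L :=
    (Finset.abs_sum_le_sum_abs _ _).trans (Finset.sum_le_sum fun s _ => hU.abs_apply_le hF hS s s)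
  rw [Finset.sum_const, Finset.card_univ, nsmul_eq_mul] at h2 h3
  refine (abs_add_le _ _).trans ?_
  have h4 : (Fintype.card σ : ℝ) * (24 * q ^ 2 * L) ≤ 2 * Fintype.card σ ^ 2 * q * Λ := by
    calc _ = (2 * Fintype.card σ * q * L) * (12 * q) := by ring
      _ ≤ (2 * Fintype.card σ * q * L) * 1 := by gcongr
      _ ≤ (2 * (Fintype.card σ * Fintype.card σ) * q * Λ) * 1 := by
          gcongr
          nlinarith
      _ = _ := by ring
  linarith

/-- The remainder of the squared Frobenius distance. -/
lemma abs_remainder_le (hF : NearFrame K B p C L h) (hS : NearFrame.Small σ C L h)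
    (hU : SpikedEigenvectors K B p u lam ev L Λ δ) (hΛ : L ≤ Λ) :
    |∑ s, (ev s - δ) ^ 2 + ∑ t, lam t ^ 2 - 2 * ∑ t, lam t ^ 2 * ∑ s, ⟪p t, u s⟫_ℝ ^ 2| ≤
      125 * Fintype.card σ ^ 4 * (Fintype.card σ * C * h) ^ 2 * Λ ^ 2 := by
  obtain ⟨hC, hL, hh, hh1, hm, hs⟩ := id hS
  set q := Fintype.card σ * C * h with hq
  have hq0 : 0 ≤ q := by positivity
  have hΛ0 : 0 < Λ := hL.trans_le hΛ
  set G : σ → σ → ℝ := fun t t' => ∑ s, ⟪p t, u s⟫_ℝ * ⟪p t', u s⟫_ℝ with hG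
  set I : σ → σ → ℝ := fun t t' => if t = t' then 1 else 0 with hI
  -- Completing the square. Expanding (G - I)² produces -2∑lam_t²G_tt + ∑lam_t² and the weighted sum
  -- of G², which by `sum_sq_weighted_gram_eq` is the squared Frobenius norm of bᵀΛb, that is, of
  -- diag(ev - δ) up to `B`. First-order errors in G thus cancel.
  have h1 : ∑ s, (ev s - δ) ^ 2 + ∑ t, lam t ^ 2 - 2 * ∑ t, lam t ^ 2 * ∑ s, ⟪p t, u s⟫_ℝ ^ 2 =
      (∑ s, (ev s - δ) ^ 2 - ∑ s, ∑ s', (∑ t, lam t * ⟪p t, u s⟫_ℝ * ⟪p t, u s'⟫_ℝ) ^ 2) +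
        ∑ t, ∑ t', lam t * lam t' * (G t t' - I t t') ^ 2 := by
    rw [sum_sq_weighted_gram_eq lam fun t s => ⟪p t, u s⟫_ℝ]
    have e1 : ∀ t, ∑ t', lam t * lam t' * (G t t' - I t t') ^ 2 =
        ∑ t', lam t * lam t' * G t t' ^ 2 + (lam t ^ 2 - 2 * (lam t ^ 2 * G t t)) := fun t => by
      have e2 : ∀ t', lam t * lam t' * (G t t' - I t t') ^ 2 = lam t * lam t' * G t t' ^ 2 +
          if t = t' then lam t * lam t' * (1 - 2 * G t t') else 0 := fun t' => by
        simp only [hI]; split_ifs <;> ring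
      simp only [e2, Finset.sum_add_distrib, Finset.sum_ite_eq, Finset.mem_univ, if_true]
      ring
    rw [Finset.sum_congr rfl fun t _ => e1 t]
    simp only [hG, Finset.sum_add_distrib, Finset.sum_sub_distrib, ← sq, ← Finset.mul_sum]
    ring
  have hlam0 : ∀ t, 0 ≤ lam t := fun t => hL.le.trans (hU.lower t)
  have h2 : |∑ t, ∑ t', lam t * lam t' * (G t t' - I t t') ^ 2| ≤
      Λ ^ 2 * (5 * Fintype.card σ * q) ^ 2 := by
    rw [abs_of_nonneg (Finset.sum_nonneg fun t _ => Finset.sum_nonneg fun t' _ =>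
      mul_nonneg (mul_nonneg (hlam0 t) (hlam0 t')) (sq_nonneg _))]
    refine le_trans ?_ (mul_le_mul_of_nonneg_left (hU.sum_sq_gram_sub_le hF hS) (sq_nonneg Λ))
    simp only [Finset.mul_sum]
    refine Finset.sum_le_sum fun t _ => Finset.sum_le_sum fun t' _ =>
      mul_le_mul_of_nonneg_right ?_ (sq_nonneg _)
    rw [sq]
    exact mul_le_mul (hU.upper t) (hU.upper t') (hlam0 t') hΛ0.le
  have hB : ∀ s s', |B (u s) (u s')| ≤ 24 * q ^ 2 * L := hU.abs_apply_le hF hS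
  have hBs : 24 * q ^ 2 * L ≤ 2 * q * L := by
    calc _ = (2 * q * L) * (12 * q) := by ring
      _ ≤ (2 * q * L) * 1 := by gcongr
      _ = _ := mul_one _
  -- By `sub_apply_eq` the difference is at most Λ(1 + 5q) + 2qL, and 12q ≤ 1.
  have hev : ∀ s, |ev s - δ| ≤ 2 * Λ := fun s => by
    have e0 := hU.gap s
    rw [abs_of_nonneg (by linarith)]
    have e1 := hU.sub_apply_eq s s
    rw [if_pos rfl] at e1
    have e2 := (abs_le.1 (hB s s)).2
    have e3 := (abs_le.1 (hU.abs_gram_sub_le hF hS s s)).2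
    rw [if_pos rfl] at e3
    have e4 : ∑ t, lam t * ⟪p t, u s⟫_ℝ * ⟪p t, u s⟫_ℝ ≤ Λ * ∑ t, ⟪p t, u s⟫_ℝ * ⟪p t, u s⟫_ℝ := by
      rw [Finset.mul_sum]
      refine Finset.sum_le_sum fun t _ => ?_
      rw [mul_assoc]
      exact mul_le_mul_of_nonneg_right (hU.upper t) (mul_self_nonneg _)
    nlinarith
  have h3 : |∑ s, (ev s - δ) ^ 2 - ∑ s, ∑ s', (∑ t, lam t * ⟪p t, u s⟫_ℝ * ⟪p t, u s'⟫_ℝ) ^ 2| ≤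
      Fintype.card σ * (4 * Λ * (24 * q ^ 2 * L)) + Fintype.card σ ^ 2 * (24 * q ^ 2 * L) ^ 2 := by
    have e1 : ∑ s, (ev s - δ) ^ 2 - ∑ s, ∑ s', (∑ t, lam t * ⟪p t, u s⟫_ℝ * ⟪p t, u s'⟫_ℝ) ^ 2 =
        ∑ s, 2 * (ev s - δ) * B (u s) (u s) - ∑ s, ∑ s', B (u s) (u s') ^ 2 := by
      rw [← Finset.sum_sub_distrib, ← Finset.sum_sub_distrib]
      refine Finset.sum_congr rfl fun s _ => ?_
      have e2 : ∀ s', (∑ t, lam t * ⟪p t, u s⟫_ℝ * ⟪p t, u s'⟫_ℝ) ^ 2 =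
          (if s = s' then (ev s - δ) ^ 2 - 2 * (ev s - δ) * B (u s) (u s') else 0) +
            B (u s) (u s') ^ 2 := fun s' => by
        rw [hU.sub_apply_eq s s']; split_ifs <;> ring
      simp only [e2, Finset.sum_add_distrib, Finset.sum_ite_eq, Finset.mem_univ, if_true]
      ring
    rw [e1]
    refine (abs_sub _ _).trans (add_le_add ?_ ?_)
    · calc _ ≤ ∑ s : σ, 4 * Λ * (24 * q ^ 2 * L) := by
            refine (Finset.abs_sum_le_sum_abs _ _).trans (Finset.sum_le_sum fun s _ => ?_)
            rw [abs_mul, abs_mul, abs_two]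
            exact mul_le_mul (by linarith [hev s]) (hB s s) (abs_nonneg _) (by positivity)
        _ = _ := by simp
    · rw [abs_of_nonneg (Finset.sum_nonneg fun t _ => Finset.sum_nonneg fun t' _ => sq_nonneg _)]
      calc _ ≤ ∑ s : σ, ∑ s' : σ, (24 * q ^ 2 * L) ^ 2 :=
            Finset.sum_le_sum fun s _ => Finset.sum_le_sum fun s' _ =>
              sq_le_sq.2 ((hB s s').trans (le_abs_self _))
        _ = _ := by simp; ring
  rw [h1]
  refine (abs_add_le _ _).trans ((add_le_add h3 h2).trans ?_)
  -- The constant 125 is 96 + 4 + 25: the part linear in `B`, the part quadratic in `B`, and the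
  -- Gram error.
  set k := (Fintype.card σ : ℝ) with hk
  have f1 : k * (4 * Λ * (24 * q ^ 2 * L)) ≤ 96 * k ^ 4 * q ^ 2 * Λ ^ 2 := by
    have : k ≤ k ^ 4 := le_self_pow₀ hm (by norm_num)
    calc _ = 96 * k * q ^ 2 * (Λ * L) := by ring
      _ ≤ 96 * k ^ 4 * q ^ 2 * (Λ * Λ) := by gcongr
      _ = _ := by ring
  have f2 : k ^ 2 * (24 * q ^ 2 * L) ^ 2 ≤ 4 * k ^ 4 * q ^ 2 * Λ ^ 2 := by
    have : k ^ 2 ≤ k ^ 4 := pow_le_pow_right₀ hm (by norm_num)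
    calc _ ≤ k ^ 2 * (2 * q * L) ^ 2 := by gcongr
      _ ≤ k ^ 4 * (2 * q * Λ) ^ 2 := by gcongr
      _ = _ := by ring
  have f3 : Λ ^ 2 * (5 * k * q) ^ 2 ≤ 25 * k ^ 4 * q ^ 2 * Λ ^ 2 := by
    have : k ^ 2 ≤ k ^ 4 := pow_le_pow_right₀ hm (by norm_num)
    calc _ = 25 * k ^ 2 * q ^ 2 * Λ ^ 2 := by ring
      _ ≤ _ := by gcongr
  linarith

end SpikedEigenvectors

end Perturbation

/-! ### Frobenius products of spectral sums. -/

section Frobenius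

open scoped InnerProductSpace

variable {d : ℕ}

lemma frobNorm_sq (A : Matrix (Fin d) (Fin d) ℝ) : frobNorm A ^ 2 = ∑ i, ∑ j, A i j * A i j := by
  have h0 : 0 ≤ ∑ i, ∑ j, A i j * A i j :=
    Finset.sum_nonneg fun _ _ => Finset.sum_nonneg fun _ _ => mul_self_nonneg _
  rw [frobNorm, Matrix.frobenius_norm_def, ← Real.sqrt_eq_rpow, Real.sq_sqrt]
  · simp [sq]
  · simpa [sq] using h0

lemma frobNorm_nonneg (A : Matrix (Fin d) (Fin d) ℝ) : 0 ≤ frobNorm A := by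
  rw [frobNorm, Matrix.frobenius_norm_def]
  positivity

lemma sum_mul_outerSelf (A : Matrix (Fin d) (Fin d) ℝ) (v : EuclideanSpace ℝ (Fin d)) :
    ∑ i, ∑ j, A i j * outerSelf v i j ≤ frobNorm A * ‖v‖ ^ 2 := by
  have h1 : ∑ i, ∑ j, outerSelf v i j ^ 2 = (‖v‖ ^ 2) ^ 2 := by
    rw [EuclideanSpace.real_norm_sq_eq, sq (∑ i, _), Finset.sum_mul_sum]
    simp [outerSelf, Matrix.vecMulVec_apply, mul_pow]
  have h2 := Finset.sum_mul_sq_le_sq_mul_sq (Finset.univ : Finset (Fin d × Fin d))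
    (fun x => A x.1 x.2) fun x => outerSelf v x.1 x.2
  simp only [Fintype.sum_prod_type] at h2
  rw [h1] at h2
  have h3 : ∑ i, ∑ j, A i j ^ 2 = frobNorm A ^ 2 := by rw [frobNorm_sq]; simp [sq]
  rw [h3, ← mul_pow] at h2
  exact (abs_le_of_sq_le_sq' h2 (mul_nonneg (frobNorm_nonneg A) (sq_nonneg _))).2

lemma sum_mul_sum_smul_outerSelf {τ : Type*} (s : Finset τ) (c : τ → ℝ)
    (w : τ → EuclideanSpace ℝ (Fin d)) (v v' : EuclideanSpace ℝ (Fin d)) :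
    ∑ i, ∑ j, (∑ a ∈ s, c a • outerSelf (w a)) i j * (v i * v' j) =
      ∑ a ∈ s, c a * (⟪w a, v⟫_ℝ * ⟪w a, v'⟫_ℝ) := by
  have h1 : ∀ i j, (∑ a ∈ s, c a • outerSelf (w a)) i j * (v i * v' j) =
      ∑ a ∈ s, c a * ((v i * w a i) * (v' j * w a j)) := fun i j => by
    rw [Matrix.sum_apply, Finset.sum_mul]
    refine Finset.sum_congr rfl fun a _ => ?_
    simp only [Matrix.smul_apply, outerSelf, Matrix.vecMulVec_apply, smul_eq_mul]
    ring
  simp only [h1]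
  rw [Finset.sum_congr rfl fun i _ => Finset.sum_comm, Finset.sum_comm]
  refine Finset.sum_congr rfl fun a _ => ?_
  simp only [PiLp.inner_apply, RCLike.inner_apply, conj_trivial]
  rw [Finset.sum_mul_sum]
  simp only [Finset.mul_sum]

/-- Bilinearity reduces this to rank one, where the Frobenius product of wwᵀ and w'w'ᵀ is ⟨w, w'⟩².
-/
lemma sum_sum_smul_outerSelf_mul {τ τ' : Type*} (s : Finset τ) (s' : Finset τ') (c : τ → ℝ)
    (e : τ' → ℝ) (w : τ → EuclideanSpace ℝ (Fin d)) (w' : τ' → EuclideanSpace ℝ (Fin d)) :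
    ∑ i, ∑ j, (∑ a ∈ s, c a • outerSelf (w a)) i j * (∑ b ∈ s', e b • outerSelf (w' b)) i j =
      ∑ a ∈ s, ∑ b ∈ s', c a * e b * ⟪w a, w' b⟫_ℝ ^ 2 := by
  have h1 : ∀ i j, (∑ a ∈ s, c a • outerSelf (w a)) i j *
      (∑ b ∈ s', e b • outerSelf (w' b)) i j =
      ∑ b ∈ s', e b * ((∑ a ∈ s, c a • outerSelf (w a)) i j * (w' b i * w' b j)) := fun i j => by
    rw [Matrix.sum_apply i j s', Finset.mul_sum]
    refine Finset.sum_congr rfl fun b _ => ?_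
    simp only [Matrix.smul_apply, outerSelf, Matrix.vecMulVec_apply, smul_eq_mul]
    ring
  simp only [h1]
  rw [Finset.sum_congr rfl fun i _ => Finset.sum_comm, Finset.sum_comm]
  simp only [← Finset.mul_sum, sum_mul_sum_smul_outerSelf]
  simp only [Finset.mul_sum]
  rw [Finset.sum_comm]
  exact Finset.sum_congr rfl fun _ _ => Finset.sum_congr rfl fun _ _ => by ring

lemma sum_sum_ite_smul_outerSelf (s : Finset (Fin d)) (c : Fin d → ℝ)
    (b : OrthonormalBasis (Fin d) ℝ (EuclideanSpace ℝ (Fin d))) :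
    ∑ i, ∑ j, (∑ a ∈ s, c a • outerSelf (b a)) i j * (∑ a ∈ s, c a • outerSelf (b a)) i j =
      ∑ a ∈ s, c a ^ 2 := by
  rw [sum_sum_smul_outerSelf_mul]
  refine Finset.sum_congr rfl fun a ha => ?_
  rw [Finset.sum_eq_single_of_mem a ha fun a' _ hne => by
    rw [b.inner_eq_zero hne.symm]; ring]
  rw [real_inner_self_eq_norm_sq, b.norm_eq_one]
  ring

/-- The squared Frobenius distance of the leading parts of two spectral decompositions. -/
lemma frobNorm_sq_sub (s : Finset (Fin d)) (ev lam : Fin d → ℝ)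
    (b h : OrthonormalBasis (Fin d) ℝ (EuclideanSpace ℝ (Fin d))) :
    frobNorm (∑ a ∈ s, ev a • outerSelf (b a) - ∑ a ∈ s, lam a • outerSelf (h a)) ^ 2 =
      ∑ a ∈ s, ev a ^ 2 + ∑ t ∈ s, lam t ^ 2 -
        2 * ∑ t ∈ s, ∑ a ∈ s, lam t * (ev a * ⟪b a, h t⟫_ℝ ^ 2) := by
  rw [frobNorm_sq, ← sum_sum_ite_smul_outerSelf s ev b, ← sum_sum_ite_smul_outerSelf s lam h]
  have h1 : ∑ t ∈ s, ∑ a ∈ s, lam t * (ev a * ⟪b a, h t⟫_ℝ ^ 2) =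
      ∑ i, ∑ j, (∑ a ∈ s, ev a • outerSelf (b a)) i j *
        (∑ a ∈ s, lam a • outerSelf (h a)) i j := by
    rw [sum_sum_smul_outerSelf_mul, Finset.sum_comm]
    exact Finset.sum_congr rfl fun _ _ => Finset.sum_congr rfl fun _ _ => by ring
  rw [h1]
  generalize ∑ a ∈ s, ev a • outerSelf (b a) = A
  generalize ∑ a ∈ s, lam a • outerSelf (h a) = A'
  simp only [Finset.mul_sum, ← Finset.sum_add_distrib, ← Finset.sum_sub_distrib]
  refine Finset.sum_congr rfl fun i _ => Finset.sum_congr rfl fun j _ => ?_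
  rw [Matrix.sub_apply]
  ring

/-- A dimension count: m coefficients against s < m linear conditions. It is the common input of
both min-max arguments. -/
lemma exists_ne_zero_forall_inner_eq_zero {V : Type*} [NormedAddCommGroup V]
    [InnerProductSpace ℝ V] {m : ℕ} (s : Fin d) (hs : s.val < m) (hmd : m ≤ d)
    (p w : Fin d → V) :
    ∃ c : {t : Fin d // t.val < m} → ℝ, c ≠ 0 ∧ ∀ s' < s, ⟪w s', ∑ t, c t • p t⟫_ℝ = 0 := by
  let f : ({t : Fin d // t.val < m} → ℝ) →ₗ[ℝ] ({s' : Fin d // s' < s} → ℝ) :=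
    LinearMap.pi fun s' => ∑ t : {t : Fin d // t.val < m}, (⟪w s', p t⟫_ℝ) •
      (LinearMap.proj t : ({t : Fin d // t.val < m} → ℝ) →ₗ[ℝ] ℝ)
  have hcard : Fintype.card {t : Fin d // t.val < m} = m := by
    rw [Fintype.card_subtype, Fin.card_filter_val_lt, min_eq_right hmd]
  have hcard' : Fintype.card {s' : Fin d // s' < s} = s.val := by
    rw [Fintype.card_subtype, ← Fin.card_Iio s]
    congr 1
    ext a
    simp
  have hker : LinearMap.ker f ≠ ⊥ := LinearMap.ker_ne_bot_of_finrank_lt (by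
    rw [Module.finrank_fintype_fun_eq_card, Module.finrank_fintype_fun_eq_card, hcard, hcard']
    exact hs)
  obtain ⟨c, hc, hc0⟩ := Submodule.exists_mem_ne_zero_of_ne_bot hker
  refine ⟨c, hc0, fun s' hs' => ?_⟩
  have h1 := congrFun (LinearMap.mem_ker.1 hc) ⟨s', hs'⟩
  simp only [f, LinearMap.pi_apply, LinearMap.coe_sum, Finset.sum_apply, LinearMap.smul_apply,
    LinearMap.proj_apply, smul_eq_mul, Pi.zero_apply] at h1
  rw [inner_sum, ← h1]
  exact Finset.sum_congr rfl fun t _ => by rw [real_inner_smul_right, mul_comm]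

/-- The last leading eigenvalue moves by at most the Frobenius distance. -/
lemma eigval_sub_le_frobNorm {m : ℕ} (hmd : m ≤ d) {ev lam : Fin d → ℝ} (hev : Antitone ev)
    (b h : OrthonormalBasis (Fin d) ℝ (EuclideanSpace ℝ (Fin d)))
    (s : Fin d) (hs : s.val + 1 = m) (hlam0 : 0 ≤ lam s) :
    ev s - lam s ≤ frobNorm (∑ a : Fin d with a.val < m, ev a • outerSelf (b a) -
      ∑ a : Fin d with a.val < m, lam a • outerSelf (h a)) := by
  -- The test vector lies in the span of the m leading `b` and is orthogonal to the first m - 1 of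
  -- the `h`. On it the first form is at least `ev s`, the second at most `lam s`.
  obtain ⟨c, hc0, hc⟩ := exists_ne_zero_forall_inner_eq_zero s (by omega) hmd b h
  set v := ∑ t, c t • b t with hv
  have hvb : ∀ a : Fin d, ¬ a.val < m → ⟪b a, v⟫_ℝ = 0 := fun a ha => by
    rw [hv, inner_sum]
    refine Finset.sum_eq_zero fun t _ => ?_
    rw [real_inner_smul_right, b.inner_eq_zero (fun e => ha (by rw [e]; exact t.2)), mul_zero]
  have hvne : v ≠ 0 := fun h0 => hc0 <| by
    have hli := b.orthonormal.linearIndependent.comp (Subtype.val : {t : Fin d // t.val < m} → Fin d)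
      Subtype.val_injective
    funext t
    exact Fintype.linearIndependent_iff.1 hli c h0 t
  have hvpos : 0 < ‖v‖ ^ 2 := by positivity
  have hsum : ∑ a : Fin d with a.val < m, ⟪b a, v⟫_ℝ ^ 2 = ‖v‖ ^ 2 := by
    rw [← b.sum_sq_inner_right v]
    refine Finset.sum_subset (Finset.subset_univ _) fun a _ ha => ?_
    rw [hvb a (by simpa using ha)]; ring
  set A := ∑ a : Fin d with a.val < m, ev a • outerSelf (b a) -
      ∑ a : Fin d with a.val < m, lam a • outerSelf (h a) with hA
  have h1 := sum_mul_outerSelf A v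
  have h2 : ∑ i, ∑ j, A i j * outerSelf v i j =
      ∑ a : Fin d with a.val < m, ev a * (⟪b a, v⟫_ℝ * ⟪b a, v⟫_ℝ) -
        ∑ a : Fin d with a.val < m, lam a * (⟪h a, v⟫_ℝ * ⟪h a, v⟫_ℝ) := by
    rw [← sum_mul_sum_smul_outerSelf, ← sum_mul_sum_smul_outerSelf]
    simp only [← Finset.sum_sub_distrib]
    refine Finset.sum_congr rfl fun i _ => Finset.sum_congr rfl fun j _ => ?_
    rw [hA, Matrix.sub_apply, outerSelf, Matrix.vecMulVec_apply]
    ring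
  have h3 : ev s * ‖v‖ ^ 2 ≤
      ∑ a : Fin d with a.val < m, ev a * (⟪b a, v⟫_ℝ * ⟪b a, v⟫_ℝ) := by
    rw [← hsum, Finset.mul_sum]
    refine Finset.sum_le_sum fun a ha => ?_
    rw [sq]
    refine mul_le_mul_of_nonneg_right (hev ?_) (mul_self_nonneg _)
    rw [Fin.le_def]
    have := (Finset.mem_filter.1 ha).2
    omega
  have h4 : ∑ a : Fin d with a.val < m, lam a * (⟪h a, v⟫_ℝ * ⟪h a, v⟫_ℝ) ≤
      lam s * ‖v‖ ^ 2 := by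
    rw [Finset.sum_eq_single_of_mem s (by simp; omega) fun a ha hne => by
      have := (Finset.mem_filter.1 ha).2
      rw [hc a (lt_of_le_of_ne (Fin.le_def.2 (by omega)) hne)]; ring]
    refine mul_le_mul_of_nonneg_left ?_ hlam0
    rw [← h.sum_sq_inner_right v, ← sq]
    exact Finset.single_le_sum (f := fun a => ⟪h a, v⟫_ℝ ^ 2) (fun _ _ => sq_nonneg _)
      (Finset.mem_univ s)
  rw [h2] at h1
  refine le_of_mul_le_mul_right ?_ hvpos
  linarith

end Frobenius

/-! ### The Gram operator of a map and its dual. -/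

section Spectral

open scoped InnerProductSpace

variable {d : ℕ} {V : Type*} [NormedAddCommGroup V] [InnerProductSpace ℝ V]

/-- The Gram operator of `T` has eigenvalues `ev` in decreasing order, with eigenvectors `b`. -/
structure IsSingularDecomposition (T : EuclideanSpace ℝ (Fin d) →ₗ[ℝ] V) (ev : Fin d → ℝ)
    (b : OrthonormalBasis (Fin d) ℝ (EuclideanSpace ℝ (Fin d))) : Prop where
  antitone : Antitone ev
  inner_eq : ∀ v w, ⟪T v, T w⟫_ℝ = ∑ s, ev s * (⟪b s, v⟫_ℝ * ⟪b s, w⟫_ℝ)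

namespace IsSingularDecomposition

variable {T : EuclideanSpace ℝ (Fin d) →ₗ[ℝ] V} {ev : Fin d → ℝ}
  {b : OrthonormalBasis (Fin d) ℝ (EuclideanSpace ℝ (Fin d))}

lemma inner_apply (hT : IsSingularDecomposition T ev b) (s : Fin d)
    (w : EuclideanSpace ℝ (Fin d)) : ⟪T (b s), T w⟫_ℝ = ev s * ⟪b s, w⟫_ℝ := by
  rw [hT.inner_eq, Finset.sum_eq_single_of_mem s (Finset.mem_univ s) fun a _ hne => by
    rw [b.inner_eq_zero hne]; ring]
  rw [real_inner_self_eq_norm_sq, b.norm_eq_one]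
  ring

lemma ev_nonneg (hT : IsSingularDecomposition T ev b) (s : Fin d) : 0 ≤ ev s := by
  have h1 := hT.inner_apply s (b s)
  rw [real_inner_self_eq_norm_sq, real_inner_self_eq_norm_sq, b.norm_eq_one] at h1
  nlinarith [sq_nonneg ‖T (b s)‖]

/-- A lower bound of the leading eigenvalues by the minimum over a subspace. -/
lemma le_ev (hT : IsSingularDecomposition T ev b)
    (h : OrthonormalBasis (Fin d) ℝ (EuclideanSpace ℝ (Fin d))) {m : ℕ} (hmd : m ≤ d)
    {p : Fin d → V} {κ : ℝ}
    (hp : ∀ c : {t : Fin d // t.val < m} → ℝ, c ≠ 0 → ∑ t, c t • p t ≠ 0)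
    (hκ : ∀ c : {t : Fin d // t.val < m} → ℝ,
      κ * ‖∑ t, c t • p t‖ ^ 2 ≤ ∑ a, ⟪T (h a), ∑ t, c t • p t⟫_ℝ ^ 2)
    (s : Fin d) (hs : s.val < m) : κ ≤ ev s := by
  -- Courant–Fischer on the dual side: x is taken in the span of `p`, orthogonal to T b_a for all a
  -- < s.
  obtain ⟨c, hc0, hc⟩ := exists_ne_zero_forall_inner_eq_zero s hs hmd p fun a => T (b a)
  have hx := hκ c
  have hxne := hp c hc0
  set x := ∑ t, c t • p t
  have hxpos : 0 < ‖x‖ ^ 2 := by positivity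
  -- This is the adjoint of `T` applied to x. It is orthogonal to b_a for a < s, so ‖Tv‖² ≤
  -- ev_s‖v‖², while ‖v‖² = ⟨x, Tv⟩ ≤ ‖x‖‖Tv‖.
  set v := ∑ a, ⟪T (h a), x⟫_ℝ • h a with hv
  have hinner : ∀ w, ⟪v, w⟫_ℝ = ⟪x, T w⟫_ℝ := fun w => by
    have e1 : T w = ∑ a, ⟪h a, w⟫_ℝ • T (h a) := by
      conv_lhs => rw [← h.sum_repr' w]
      simp [map_sum]
    rw [e1, hv, sum_inner, inner_sum]
    refine Finset.sum_congr rfl fun a _ => ?_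
    rw [real_inner_smul_left, real_inner_smul_right, real_inner_comm x]
    ring
  have hvsq : ‖v‖ ^ 2 = ∑ a, ⟪T (h a), x⟫_ℝ ^ 2 := by
    rw [← h.sum_sq_inner_right v]
    refine Finset.sum_congr rfl fun a _ => ?_
    rw [real_inner_comm, hinner, real_inner_comm]
  rw [← hvsq] at hx
  have h1 : ‖T v‖ ^ 2 ≤ ev s * ‖v‖ ^ 2 := by
    rw [← real_inner_self_eq_norm_sq, hT.inner_eq, ← b.sum_sq_inner_right v, Finset.mul_sum]
    refine Finset.sum_le_sum fun a _ => ?_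
    rw [← sq]
    by_cases ha : a < s
    · have : ⟪b a, v⟫_ℝ = 0 := by rw [real_inner_comm, hinner, real_inner_comm]; exact hc a ha
      rw [this]; simp
    · exact mul_le_mul_of_nonneg_right (hT.antitone (not_lt.1 ha)) (sq_nonneg _)
  have h2 : (‖v‖ ^ 2) ^ 2 ≤ ‖x‖ ^ 2 * ‖T v‖ ^ 2 := by
    rw [← mul_pow, ← real_inner_self_eq_norm_sq v, hinner]
    exact sq_le_sq.2 ((abs_real_inner_le_norm _ _).trans (le_abs_self _))
  rcases (sq_nonneg ‖v‖).eq_or_lt with h0 | h0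
  · rw [← h0] at hx
    exact le_trans (by by_contra! hneg; nlinarith) (hT.ev_nonneg s)
  · have h3 : ‖v‖ ^ 2 * ‖v‖ ^ 2 ≤ (ev s * ‖x‖ ^ 2) * ‖v‖ ^ 2 := by
      calc _ = (‖v‖ ^ 2) ^ 2 := by ring
        _ ≤ _ := h2
        _ ≤ ‖x‖ ^ 2 * (ev s * ‖v‖ ^ 2) := by gcongr
        _ = _ := by ring
    have h4 := le_of_mul_le_mul_right h3 h0
    exact le_of_mul_le_mul_right (hx.trans h4) hxpos

lemma orthonormal (hT : IsSingularDecomposition T ev b) {m : ℕ}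
    (hpos : ∀ s : {s : Fin d // s.val < m}, 0 < ev s) :
    Orthonormal ℝ fun s : {s : Fin d // s.val < m} => (Real.sqrt (ev s))⁻¹ • T (b s) := by
  rw [orthonormal_iff_ite]
  intro s s'
  rw [real_inner_smul_left, real_inner_smul_right, hT.inner_apply]
  split_ifs with hss
  · subst hss
    rw [real_inner_self_eq_norm_sq, b.norm_eq_one]
    have h1 := Real.mul_self_sqrt (hpos s).le
    have h2 := (Real.sqrt_pos.2 (hpos s)).ne'
    field_simp
    rw [sq, h1]
  · rw [b.inner_eq_zero fun e => hss (Subtype.ext e)]; ring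

/-- The left side is the form of TT* expanded in the basis `h`, and T b_s is an eigenvector of TT*
with the eigenvalue `ev s`. -/
lemma sum_inner_mul_inner (hT : IsSingularDecomposition T ev b)
    (h : OrthonormalBasis (Fin d) ℝ (EuclideanSpace ℝ (Fin d))) (s : Fin d) (x : V) (k : ℝ) :
    ∑ a, ⟪T (h a), k • T (b s)⟫_ℝ * ⟪T (h a), x⟫_ℝ = ev s * ⟪k • T (b s), x⟫_ℝ := by
  have e1 : T (b s) = ∑ a, ⟪h a, b s⟫_ℝ • T (h a) := by
    conv_lhs => rw [← h.sum_repr' (b s)]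
    simp [map_sum]
  have e2 : ∀ a, ⟪T (h a), k • T (b s)⟫_ℝ = k * ev s * ⟪h a, b s⟫_ℝ := fun a => by
    rw [real_inner_smul_right, real_inner_comm, hT.inner_apply, real_inner_comm]; ring
  simp only [e2]
  rw [real_inner_smul_left, e1, sum_inner, Finset.mul_sum, Finset.mul_sum]
  refine Finset.sum_congr rfl fun a _ => ?_
  rw [real_inner_smul_left]
  ring

/-- The adjoint sends the normalized image of b_s to √ev_s b_s. This moves overlaps of eigenvectors
from ℝ^d to the dual space, where the perturbation estimates live. -/
lemma inner_sq (hT : IsSingularDecomposition T ev b) (s : Fin d) (hpos : 0 < ev s)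
    (w : EuclideanSpace ℝ (Fin d)) :
    ⟪T w, (Real.sqrt (ev s))⁻¹ • T (b s)⟫_ℝ ^ 2 = ev s * ⟪b s, w⟫_ℝ ^ 2 := by
  rw [real_inner_smul_right, real_inner_comm, hT.inner_apply]
  have h1 := Real.sq_sqrt hpos.le
  have h2 := (Real.sqrt_pos.2 hpos).ne'
  rw [mul_pow, inv_pow, h1]
  field_simp

end IsSingularDecomposition

end Spectral

/-! ### Typical samples and their near frames. -/

section Sample

open scoped InnerProductSpace

variable {n : ℕ}

/-- The bilinear form of a matrix. -/
def matrixForm (A : Matrix (Fin n) (Fin n) ℝ) :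
    EuclideanSpace ℝ (Fin n) →ₗ[ℝ] EuclideanSpace ℝ (Fin n) →ₗ[ℝ] ℝ :=
  LinearMap.mk₂ ℝ (fun x y => ∑ i, ∑ j, x i * A i j * y j)
    (fun x x' y => by simp [add_mul, Finset.sum_add_distrib])
    (fun c x y => by simp [Finset.mul_sum, mul_assoc])
    (fun x y y' => by simp [mul_add, Finset.sum_add_distrib])
    (fun c x y => by simp [Finset.mul_sum, mul_left_comm])

lemma matrixForm_apply (A : Matrix (Fin n) (Fin n) ℝ) (x y : EuclideanSpace ℝ (Fin n)) :
    matrixForm A x y = ∑ i, ∑ j, x i * A i j * y j := rfl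

lemma matrixForm_symm {A : Matrix (Fin n) (Fin n) ℝ} (hA : A.IsSymm)
    (x y : EuclideanSpace ℝ (Fin n)) : matrixForm A x y = matrixForm A y x := by
  rw [matrixForm_apply, matrixForm_apply, Finset.sum_comm]
  refine Finset.sum_congr rfl fun i _ => Finset.sum_congr rfl fun j _ => ?_
  rw [hA.apply i j]
  ring

lemma matrixForm_add_diagonal (A : Matrix (Fin n) (Fin n) ℝ) (D : Fin n → ℝ)
    (x y : EuclideanSpace ℝ (Fin n)) :
    matrixForm (A + Matrix.diagonal D) x y =
      matrixForm A x y + ∑ i, x i * y i * D i := by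
  simp only [matrixForm_apply, Matrix.add_apply, mul_add, add_mul, Finset.sum_add_distrib,
    add_right_inj]
  refine Finset.sum_congr rfl fun i _ => ?_
  rw [Finset.sum_eq_single_of_mem i (Finset.mem_univ i) fun j _ hne => by
    rw [Matrix.diagonal_apply_ne _ hne.symm]; ring, Matrix.diagonal_apply_eq]
  ring

lemma abs_sum_mul_le_of_sq {ι : Type*} [Fintype ι] {f g : ι → ℝ} {a b : ℝ} (ha : 0 ≤ a)
    (hb : 0 ≤ b) (hf : ∑ i, f i ^ 2 ≤ a ^ 2) (hg : ∑ i, g i ^ 2 ≤ b ^ 2) :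
    |∑ i, f i * g i| ≤ a * b := by
  refine abs_le_of_sq_le_sq ?_ (by positivity)
  refine (Finset.sum_mul_sq_le_sq_mul_sq _ f g).trans ?_
  rw [mul_pow]
  exact mul_le_mul hf hg (Finset.sum_nonneg fun _ _ => sq_nonneg _) (sq_nonneg a)

lemma abs_matrixForm_le {A : Matrix (Fin n) (Fin n) ℝ} {x y : EuclideanSpace ℝ (Fin n)} {a : ℝ}
    (ha : 0 ≤ a) (hx : ∑ i, (∑ j, A i j * y j) ^ 2 ≤ a ^ 2) :
    |matrixForm A x y| ≤ a * ‖x‖ := by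
  have h1 : matrixForm A x y = ∑ i, (∑ j, A i j * y j) * x i := by
    rw [matrixForm_apply]
    refine Finset.sum_congr rfl fun i _ => ?_
    rw [Finset.sum_mul]
    exact Finset.sum_congr rfl fun j _ => by ring
  rw [h1]
  exact abs_sum_mul_le_of_sq ha (norm_nonneg x) hx (EuclideanSpace.real_norm_sq_eq x).ge

/-- ‖Ay‖² is the Frobenius product of A² and yyᵀ, so the fourth power of the operator norm is at
most ‖A²‖_F² = tr A⁴. The Frobenius norm of A itself would be too crude: for the noise it is only
bounded by a multiple of L, not by a small one. -/
lemma abs_matrixForm_le_of_cycle {A : Matrix (Fin n) (Fin n) ℝ} (hA : A.IsSymm) {a : ℝ}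
    (ha : 0 ≤ a) (hcyc : ∑ i, ∑ j, (∑ k, A i k * A k j) ^ 2 ≤ a ^ 4)
    (x y : EuclideanSpace ℝ (Fin n)) : |matrixForm A x y| ≤ a * ‖x‖ * ‖y‖ := by
  have h1 : ∑ i, (∑ j, A i j * y j) ^ 2 = ∑ x : Fin n × Fin n,
      (∑ k, A x.1 k * A k x.2) * (y x.1 * y x.2) := by
    rw [Fintype.sum_prod_type]
    have e1 : ∀ i, (∑ j, A i j * y j) ^ 2 = ∑ j, ∑ k, A j i * A i k * (y j * y k) := fun i => by
      rw [sq, Finset.sum_mul_sum]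
      refine Finset.sum_congr rfl fun j _ => Finset.sum_congr rfl fun k _ => ?_
      rw [hA.apply i j]
      ring
    simp only [e1, Finset.sum_mul]
    rw [Finset.sum_comm]
    exact Finset.sum_congr rfl fun _ _ => Finset.sum_comm
  have h2 : ∑ i, (∑ j, A i j * y j) ^ 2 ≤ a ^ 2 * ‖y‖ ^ 2 := by
    rw [h1]
    refine (le_abs_self _).trans (abs_sum_mul_le_of_sq (sq_nonneg a) (sq_nonneg _) ?_ ?_)
    · rw [Fintype.sum_prod_type]
      exact hcyc.trans_eq (by ring)
    · rw [Fintype.sum_prod_type, EuclideanSpace.real_norm_sq_eq, sq (∑ i, _),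
        Finset.sum_mul_sum]
      simp [mul_pow]
  have h3 := abs_matrixForm_le (x := x) (by positivity : 0 ≤ a * ‖y‖) (by rwa [mul_pow])
  linarith

/-- The vectors whose entries sum to zero. -/
def centeredSubspace (n : ℕ) : Submodule ℝ (EuclideanSpace ℝ (Fin n)) where
  carrier := {x | ∑ i, x i = 0}
  add_mem' := fun {x y} hx hy => by
    simp only [Set.mem_ofPred_eq] at hx hy ⊢
    simp [Finset.sum_add_distrib, hx, hy]
  zero_mem' := by simp
  smul_mem' := fun c x hx => by
    simp only [Set.mem_ofPred_eq] at hx ⊢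
    simp [← Finset.mul_sum, hx]

lemma mem_centeredSubspace {x : EuclideanSpace ℝ (Fin n)} :
    x ∈ centeredSubspace n ↔ ∑ i, x i = 0 := Iff.rfl

/-- The vector `x` centered at its mean and divided by `√(n - 1)`. -/
def standardize (x : EuclideanSpace ℝ (Fin n)) : EuclideanSpace ℝ (Fin n) :=
  (Real.sqrt ((n : ℝ) - 1))⁻¹ • (x - ((∑ i, x i) / n) • WithLp.toLp 2 fun _ => 1)

lemma standardize_apply (x : EuclideanSpace ℝ (Fin n)) (i : Fin n) :
    standardize x i = (Real.sqrt ((n : ℝ) - 1))⁻¹ * (x i - (∑ i, x i) / n) := by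
  simp [standardize]

lemma standardize_mem (hn : n ≠ 0) (x : EuclideanSpace ℝ (Fin n)) :
    standardize x ∈ centeredSubspace n := by
  rw [mem_centeredSubspace]
  simp only [standardize_apply, ← Finset.mul_sum, Finset.sum_sub_distrib]
  have : (n : ℝ) ≠ 0 := by exact_mod_cast hn
  simp [mul_div_cancel₀ _ this]

/-- Against a vector of zero sum the centring is invisible. -/
lemma inner_standardize (x : EuclideanSpace ℝ (Fin n)) {y : EuclideanSpace ℝ (Fin n)}
    (hy : y ∈ centeredSubspace n) :
    ⟪standardize x, y⟫_ℝ = (Real.sqrt ((n : ℝ) - 1))⁻¹ * ∑ i, x i * y i := by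
  rw [standardize, real_inner_smul_left, inner_sub_left, real_inner_smul_left]
  simp only [PiLp.inner_apply, RCLike.inner_apply, conj_trivial]
  rw [mem_centeredSubspace] at hy
  simp only [mul_one, hy, mul_zero, sub_zero]
  simp only [mul_comm]

lemma inner_standardize_standardize (hn : 2 ≤ n) (x y : EuclideanSpace ℝ (Fin n)) :
    ⟪standardize x, standardize y⟫_ℝ =
      ((n : ℝ) - 1)⁻¹ * (∑ i, x i * y i - (∑ i, x i) * (∑ i, y i) / n) := by
  rw [inner_standardize x (standardize_mem (by omega) y)]
  simp only [standardize_apply]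
  have hN : (0 : ℝ) ≤ (n : ℝ) - 1 := by
    have : (2 : ℝ) ≤ n := by exact_mod_cast hn
    linarith
  have h1 : (Real.sqrt ((n : ℝ) - 1))⁻¹ * (Real.sqrt ((n : ℝ) - 1))⁻¹ = ((n : ℝ) - 1)⁻¹ := by
    rw [← mul_inv, Real.mul_self_sqrt hN]
  rw [← h1, mul_assoc]
  congr 1
  have h2 : ∀ i, x i * ((Real.sqrt ((n : ℝ) - 1))⁻¹ * (y i - (∑ i, y i) / n)) =
      (Real.sqrt ((n : ℝ) - 1))⁻¹ * (x i * y i - x i * ((∑ i, y i) / n)) := fun i => by ring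
  simp only [h2, ← Finset.mul_sum, Finset.sum_sub_distrib, ← Finset.sum_mul]
  ring

variable {σ : Type*} [DecidableEq σ]

/-- A sample that is typical up to the constant `C`: `O` and `D` are the off-diagonal and diagonal
parts of the centered dual noise covariance, the vectors `v (some t)` hold the spiked coordinates of
the sample, and `v none` is the constant vector. -/
structure TypicalSample (O : Matrix (Fin n) (Fin n) ℝ) (D : Fin n → ℝ)
    (v : Option σ → EuclideanSpace ℝ (Fin n)) (C L : ℝ) : Prop where
  mean : ∀ t, |∑ i, v (some t) i| ≤ C * Real.sqrt n
  gram : ∀ s t, |∑ i, (v (some s) i * v (some t) i - if s = t then 1 else 0)| ≤ C * Real.sqrt n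
  off : ∀ a, ∑ i, (∑ j, O i j * v a j) ^ 2 ≤ (C * L) ^ 2
  off_off : ∀ a b, |∑ i, ∑ j, v a i * O i j * v b j| ≤ C * L
  diag : n * ∑ i, D i ^ 2 ≤ (C * L) ^ 2
  quartic : ∀ a b, ∑ i, v a i ^ 2 * v b i ^ 2 ≤ C ^ 2 * n
  cycle : ∑ i, ∑ j, (∑ k, O i k * O k j) ^ 2 ≤ (L / 8) ^ 4

namespace TypicalSample

variable {O : Matrix (Fin n) (Fin n) ℝ} {D : Fin n → ℝ} {v : Option σ → EuclideanSpace ℝ (Fin n)}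
  {C L : ℝ}

/-- The operator norm of the diagonal is max |D_i|, and even the sum of all D_i² is at most C²L²/n.
-/
lemma abs_sum_diag_le (hv : TypicalSample O D v C L) (hC : 1 ≤ C) (hL : 0 < L) (hn : 2 ≤ n)
    (x y : EuclideanSpace ℝ (Fin n)) :
    |∑ i, x i * y i * D i| ≤ C * L * (Real.sqrt n)⁻¹ * ‖x‖ * ‖y‖ := by
  have hn0 : (0 : ℝ) < n := by positivity
  have hs := Real.sq_sqrt hn0.le
  have hD : ∑ i, D i ^ 2 ≤ (C * L * (Real.sqrt n)⁻¹) ^ 2 := by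
    rw [mul_pow, inv_pow, hs, ← div_eq_mul_inv, le_div_iff₀ hn0, mul_comm]
    exact hv.diag
  have hDi : ∀ i, D i ^ 2 ≤ (C * L * (Real.sqrt n)⁻¹) ^ 2 := fun i =>
    (Finset.single_le_sum (f := fun i => D i ^ 2) (fun _ _ => sq_nonneg _)
      (Finset.mem_univ i)).trans hD
  have h1 : ∑ i, (x i * D i) ^ 2 ≤ (C * L * (Real.sqrt n)⁻¹ * ‖x‖) ^ 2 := by
    rw [mul_pow _ ‖x‖, EuclideanSpace.real_norm_sq_eq, Finset.mul_sum]
    refine Finset.sum_le_sum fun i _ => ?_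
    rw [mul_pow, mul_comm]
    exact mul_le_mul_of_nonneg_right (hDi i) (sq_nonneg _)
  have h2 := abs_sum_mul_le_of_sq (by positivity) (norm_nonneg y) h1
    (EuclideanSpace.real_norm_sq_eq y).ge
  refine le_trans (le_of_eq ?_) h2
  congr 1
  exact Finset.sum_congr rfl fun i _ => by ring

lemma abs_form_le (hv : TypicalSample O D v C L) (hC : 1 ≤ C) (hL : 0 < L) (hn : 2 ≤ n)
    (h1 : ∀ i, v none i = 1) (hO : O.IsSymm) (a : Option σ) (x : EuclideanSpace ℝ (Fin n)) :
    |matrixForm (O + Matrix.diagonal D) (v a) x| ≤ 2 * C ^ 2 * L * ‖x‖ := by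
  have hn0 : (0 : ℝ) < n := by positivity
  have hs := Real.sq_sqrt hn0.le
  have hs0 := Real.sqrt_pos.2 hn0
  rw [matrixForm_add_diagonal, matrixForm_symm hO]
  have e1 := abs_matrixForm_le (x := x) (by positivity : 0 ≤ C * L) (hv.off a)
  have e2 := hv.abs_sum_diag_le hC hL hn (v a) x
  -- Paired with the constant vector, the quartic bound is a bound on the squared norm.
  have e3 : ‖v a‖ ≤ C * Real.sqrt n := by
    refine abs_le_of_sq_le_sq' ?_ (by positivity) |>.2
    rw [EuclideanSpace.real_norm_sq_eq, mul_pow, hs]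
    simpa [h1] using hv.quartic a none
  have e4 : C * L * (Real.sqrt n)⁻¹ * ‖v a‖ * ‖x‖ ≤ C ^ 2 * L * ‖x‖ := by
    calc _ ≤ C * L * (Real.sqrt n)⁻¹ * (C * Real.sqrt n) * ‖x‖ := by gcongr
      _ = C ^ 2 * L * ‖x‖ := by field_simp
  have e5 : C * L * ‖x‖ ≤ C ^ 2 * L * ‖x‖ := by
    gcongr
    nlinarith
  refine (abs_add_le _ _).trans ?_
  linarith

lemma abs_form_form_le (hv : TypicalSample O D v C L) (hC : 1 ≤ C) (hL : 0 < L) (hn : 2 ≤ n)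
    (a b : Option σ) :
    |matrixForm (O + Matrix.diagonal D) (v a) (v b)| ≤ 2 * C ^ 2 * L := by
  have hn0 : (0 : ℝ) < n := by positivity
  have hs := Real.sq_sqrt hn0.le
  have hs0 := Real.sqrt_pos.2 hn0
  rw [matrixForm_add_diagonal, matrixForm_apply]
  have e1 := hv.off_off a b
  -- Cauchy–Schwarz between the products v_a v_b, with the quartic bound, and D: the factors √n
  -- cancel.
  have e2 : |∑ i, v a i * v b i * D i| ≤ (C * Real.sqrt n) * (C * L * (Real.sqrt n)⁻¹) := by
    refine abs_sum_mul_le_of_sq (by positivity) (by positivity) ?_ ?_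
    · simp only [mul_pow, hs]; exact hv.quartic a b
    · rw [mul_pow, inv_pow, hs, ← div_eq_mul_inv, le_div_iff₀ hn0, mul_comm]
      exact hv.diag
  have e3 : (C * Real.sqrt n) * (C * L * (Real.sqrt n)⁻¹) = C ^ 2 * L := by field_simp
  have e5 : C * L ≤ C ^ 2 * L := by
    gcongr
    nlinarith
  refine (abs_add_le _ _).trans ?_
  linarith

/-- The standardized spiked coordinates of a typical sample. -/
lemma nearFrame (hv : TypicalSample O D v C L) (hC : 1 ≤ C) (hL : 0 < L) (hn : 2 ≤ n)
    (h1 : v none = WithLp.toLp 2 fun _ => 1) (hO : O.IsSymm) (hCn : 8 * C ≤ Real.sqrt n) :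
    NearFrame (centeredSubspace n) (matrixForm (O + Matrix.diagonal D))
      (fun t => standardize (v (some t))) (16 * C ^ 2) L (Real.sqrt n)⁻¹ := by
  have hn2 : (2 : ℝ) ≤ n := by exact_mod_cast hn
  have hn0 : (0 : ℝ) < n := by positivity
  have hs := Real.sq_sqrt hn0.le
  have hs0 := Real.sqrt_pos.2 hn0
  have h1' : ∀ i, v none i = 1 := fun i => by rw [h1]
  have hN : (n : ℝ) / 2 ≤ n - 1 := by linarith
  have hN0 : (0 : ℝ) < n - 1 := by linarith
  have hNinv : ((n : ℝ) - 1)⁻¹ ≤ 2 * ((Real.sqrt n)⁻¹) ^ 2 := by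
    rw [inv_pow, hs, ← div_eq_mul_inv, inv_le_comm₀ hN0 (by positivity), inv_div]
    exact hN
  set A := O + Matrix.diagonal D with hA
  set r := (Real.sqrt ((n : ℝ) - 1))⁻¹ with hr
  have hr0 : 0 ≤ r := by positivity
  have hrsq : r ^ 2 = ((n : ℝ) - 1)⁻¹ := by rw [hr, inv_pow, Real.sq_sqrt hN0.le]
  set k := (Real.sqrt n)⁻¹ with hk
  have hk0 : 0 < k := by positivity
  have hrk : r ≤ 2 * k := by
    refine abs_le_of_sq_le_sq' ?_ (by positivity) |>.2
    rw [hrsq, mul_pow]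
    nlinarith [sq_nonneg k]
  have hCk : C * k ≤ 1 / 8 := by
    rw [hk, ← div_eq_mul_inv, div_le_iff₀ hs0]; linarith
  set μ : σ → ℝ := fun t => (∑ i, v (some t) i) / n with hμ
  have hμ1 : ∀ t, |μ t| ≤ 1 := fun t => by
    rw [hμ]
    simp only
    rw [abs_div, abs_of_pos hn0, div_le_one hn0]
    refine (hv.mean t).trans ?_
    nlinarith
  -- Centring subtracts a multiple, at most 1 in modulus, of the constant vector; hence the bounds
  -- on `B` are required for `v none` as well.
  have hstd : ∀ t, standardize (v (some t)) = r • (v (some t) - μ t • v none) := fun t => by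
    rw [standardize, h1]
  refine ⟨fun t => standardize_mem (by omega) _, matrixForm_symm ?_, fun s t => ?_, fun s t => ?_,
    fun t x _ => ?_, fun x _ y _ => ?_⟩
  · rw [hA, Matrix.IsSymm, Matrix.transpose_add, Matrix.diagonal_transpose, hO.eq]
  · rw [inner_standardize_standardize hn]
    have e1 : ((n : ℝ) - 1)⁻¹ * (∑ i, v (some s) i * v (some t) i -
        (∑ i, v (some s) i) * (∑ i, v (some t) i) / n) - (if s = t then 1 else 0) =
        ((n : ℝ) - 1)⁻¹ * (∑ i, (v (some s) i * v (some t) i - if s = t then 1 else 0) +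
          (if s = t then 1 else 0) - (∑ i, v (some s) i) * (∑ i, v (some t) i) / n) := by
      rw [Finset.sum_sub_distrib, Finset.sum_const, Finset.card_univ, Fintype.card_fin,
        nsmul_eq_mul]
      field_simp
      ring
    rw [e1, abs_mul, abs_of_pos (inv_pos.2 hN0)]
    have e2 : |(∑ i, v (some s) i) * (∑ i, v (some t) i) / n| ≤ C ^ 2 := by
      rw [abs_div, abs_mul, abs_of_pos hn0, div_le_iff₀ hn0]
      calc _ ≤ (C * Real.sqrt n) * (C * Real.sqrt n) :=
            mul_le_mul (hv.mean s) (hv.mean t) (abs_nonneg _) (by positivity)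
        _ = C ^ 2 * Real.sqrt n ^ 2 := by ring
        _ = _ := by rw [hs]
    have e3 : |(if s = t then (1 : ℝ) else 0)| ≤ 1 := by split_ifs <;> simp
    -- The terms C√n, 1 and C² come from the Gram sum, from dividing by n - 1 instead of n, and from
    -- the sample means. With 1/(n-1) ≤ 2/n they give the constant 16C².
    have e4 : |∑ i, (v (some s) i * v (some t) i - if s = t then 1 else 0) +
          (if s = t then 1 else 0) - (∑ i, v (some s) i) * (∑ i, v (some t) i) / n| ≤
          8 * C ^ 2 * Real.sqrt n := by
      refine (abs_sub _ _).trans ((add_le_add ((abs_add_le _ _).trans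
        (add_le_add (hv.gram s t) e3)) e2).trans ?_)
      have f1 : (1 : ℝ) ≤ Real.sqrt n := by linarith
      have f2 : 1 ≤ C ^ 2 := one_le_pow₀ hC
      have f3 : C ≤ C ^ 2 := le_self_pow₀ hC (by norm_num)
      have f4 : C * Real.sqrt n ≤ C ^ 2 * Real.sqrt n := by gcongr
      nlinarith
    calc _ ≤ (2 * k ^ 2) * (8 * C ^ 2 * Real.sqrt n) :=
          mul_le_mul hNinv e4 (abs_nonneg _) (by positivity)
      _ = 16 * C ^ 2 * k * (k * Real.sqrt n) := by ring
      _ = _ := by rw [hk, inv_mul_cancel₀ hs0.ne', mul_one]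
  · rw [hstd, hstd]
    have e1 : matrixForm A (r • (v (some s) - μ s • v none)) (r • (v (some t) - μ t • v none)) =
        r ^ 2 * (matrixForm A (v (some s)) (v (some t)) - μ t * matrixForm A (v (some s)) (v none)
          - μ s * matrixForm A (v none) (v (some t))
          + μ s * μ t * matrixForm A (v none) (v none)) := by
      simp only [map_smul, map_sub, LinearMap.smul_apply, LinearMap.sub_apply, smul_eq_mul]
      ring
    have hb := hv.abs_form_form_le hC hL hn
    rw [← hA] at hb
    have b1 : |μ t * matrixForm A (v (some s)) (v none)| ≤ 1 * (2 * C ^ 2 * L) := by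
      rw [abs_mul]; exact mul_le_mul (hμ1 t) (hb _ _) (abs_nonneg _) zero_le_one
    have b2 : |μ s * matrixForm A (v none) (v (some t))| ≤ 1 * (2 * C ^ 2 * L) := by
      rw [abs_mul]; exact mul_le_mul (hμ1 s) (hb _ _) (abs_nonneg _) zero_le_one
    have b3 : |μ s * μ t * matrixForm A (v none) (v none)| ≤ 1 * 1 * (2 * C ^ 2 * L) := by
      rw [abs_mul, abs_mul]
      exact mul_le_mul (mul_le_mul (hμ1 s) (hμ1 t) (abs_nonneg _) zero_le_one) (hb _ _)
        (abs_nonneg _) (by norm_num)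
    have b4 := hb (some s) (some t)
    rw [e1, abs_mul, abs_of_nonneg (sq_nonneg r), hrsq]
    have b5 : |matrixForm A (v (some s)) (v (some t)) - μ t * matrixForm A (v (some s)) (v none)
          - μ s * matrixForm A (v none) (v (some t))
          + μ s * μ t * matrixForm A (v none) (v none)| ≤ 8 * C ^ 2 * L := by
      rw [abs_le] at *
      constructor <;> linarith [b1.1, b1.2, b2.1, b2.2, b3.1, b3.2, b4.1, b4.2]
    calc _ ≤ (2 * k ^ 2) * (8 * C ^ 2 * L) :=
          mul_le_mul hNinv b5 (abs_nonneg _) (by positivity)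
      _ = _ := by ring
  · rw [hstd]
    have e1 : matrixForm A (r • (v (some t) - μ t • v none)) x =
        r * (matrixForm A (v (some t)) x - μ t * matrixForm A (v none) x) := by
      simp only [map_smul, map_sub, LinearMap.smul_apply, LinearMap.sub_apply, smul_eq_mul]
    have hb := fun a => hv.abs_form_le hC hL hn h1' hO a x
    rw [← hA] at hb
    have b1 : |μ t * matrixForm A (v none) x| ≤ 1 * (2 * C ^ 2 * L * ‖x‖) := by
      rw [abs_mul]; exact mul_le_mul (hμ1 t) (hb _) (abs_nonneg _) zero_le_one
    rw [e1, abs_mul, abs_of_nonneg hr0]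
    calc _ ≤ (2 * k) * (4 * C ^ 2 * L * ‖x‖) := by
          refine mul_le_mul hrk ((abs_sub _ _).trans ?_) (abs_nonneg _) (by positivity)
          linarith [hb (some t)]
      _ = 8 * (C ^ 2 * L * k * ‖x‖) := by ring
      _ ≤ 16 * (C ^ 2 * L * k * ‖x‖) := by
          have : 0 ≤ C ^ 2 * L * k * ‖x‖ := by positivity
          linarith
      _ = _ := by ring
  -- L/4 is split into L/8 for the off-diagonal part, by the cycle bound, and L/8 for the diagonal,
  -- by 8C ≤ √n.
  · rw [hA, matrixForm_add_diagonal]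
    have e1 := abs_matrixForm_le_of_cycle hO (by positivity) hv.cycle x y
    have e2 := hv.abs_sum_diag_le hC hL hn x y
    have e3 : C * L * k * ‖x‖ * ‖y‖ ≤ L / 8 * ‖x‖ * ‖y‖ := by
      gcongr
      calc C * L * k = L * (C * k) := by ring
        _ ≤ L * (1 / 8) := by gcongr
        _ = _ := by ring
    refine (abs_add_le _ _).trans ?_
    linarith

end TypicalSample

end Sample

/-! ### The dual decomposition of the sample covariance matrix. -/

namespace Population

open scoped InnerProductSpace

variable {d n : ℕ} (M : Population d) (m : ℕ) (z : Fin n → Fin d → ℝ)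

/-- The inner product of two noise parts. -/
def noiseKernel (x y : Fin d → ℝ) : ℝ := ∑ s : Fin d with m ≤ s.val, M.eigval s * (x s * y s)

/-- The off-diagonal part of the dual noise covariance matrix. -/
def noiseOff : Matrix (Fin n) (Fin n) ℝ :=
  Matrix.of fun i j => if i = j then 0 else ((n : ℝ) - 1)⁻¹ * M.noiseKernel m (z i) (z j)

/-- The diagonal part of the dual noise covariance matrix, centered. -/
def noiseDiag (i : Fin n) : ℝ :=
  ((n : ℝ) - 1)⁻¹ * (M.noiseKernel m (z i) (z i) - ∑ s : Fin d with m ≤ s.val, M.eigval s)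

/-- The coordinate `a` of all observations. -/
def coordVec (a : Fin d) : EuclideanSpace ℝ (Fin n) := WithLp.toLp 2 fun i => z i a

/-- The constant vector and the spiked coordinates. -/
def spikeVec : Option {t : Fin d // t.val < m} → EuclideanSpace ℝ (Fin n)
  | none => WithLp.toLp 2 fun _ => 1
  | some t => coordVec z t

/-- The transposed centered data matrix. -/
def dataMap : EuclideanSpace ℝ (Fin d) →ₗ[ℝ] EuclideanSpace ℝ (Fin n) :=
  ∑ a, (innerₛₗ ℝ (M.eigvec a)).smulRight (Real.sqrt (M.eigval a) • standardize (coordVec z a))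

lemma dataMap_apply (v : EuclideanSpace ℝ (Fin d)) :
    M.dataMap z v = ∑ a, ⟪M.eigvec a, v⟫_ℝ • Real.sqrt (M.eigval a) • standardize (coordVec z a) := by
  simp [dataMap]

lemma dataMap_eigvec (a : Fin d) :
    M.dataMap z (M.eigvec a) = Real.sqrt (M.eigval a) • standardize (coordVec z a) := by
  rw [dataMap_apply, Finset.sum_eq_single_of_mem a (Finset.mem_univ a) fun b _ hne => by
    rw [M.eigvec.inner_eq_zero hne, zero_smul], real_inner_self_eq_norm_sq, M.eigvec.norm_eq_one]
  simp

lemma dataMap_mem (hn : n ≠ 0) (v : EuclideanSpace ℝ (Fin d)) :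
    M.dataMap z v ∈ centeredSubspace n := by
  rw [dataMap_apply]
  exact Submodule.sum_mem _ fun a _ => Submodule.smul_mem _ _ (Submodule.smul_mem _ _
    (standardize_mem hn _))

lemma observation_sub_mean (hn : n ≠ 0) (i : Fin n) :
    M.observation (z i) - (n : ℝ)⁻¹ • ∑ i', M.observation (z i') =
      ∑ a, (Real.sqrt (M.eigval a) * (z i a - (∑ i', z i' a) / n)) • M.eigvec a := by
  have hn' : (n : ℝ) ≠ 0 := by exact_mod_cast hn
  have h1 : (n : ℝ)⁻¹ • ∑ i', M.observation (z i') = M.mean +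
      ∑ a, (Real.sqrt (M.eigval a) * ((∑ i', z i' a) / n)) • M.eigvec a := by
    simp only [observation, Finset.sum_add_distrib, smul_add, Finset.sum_const, Finset.card_univ,
      Fintype.card_fin]
    congr 1
    · rw [← Nat.cast_smul_eq_nsmul ℝ, smul_smul, inv_mul_cancel₀ hn', one_smul]
    · rw [Finset.sum_comm, Finset.smul_sum]
      refine Finset.sum_congr rfl fun a _ => ?_
      rw [← Finset.sum_smul, smul_smul, ← Finset.mul_sum]
      congr 1
      field_simp
  rw [h1, observation, add_sub_add_left_eq_sub, ← Finset.sum_sub_distrib]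
  refine Finset.sum_congr rfl fun a _ => ?_
  rw [← sub_smul]
  congr 1
  ring

lemma dataMap_apply_apply (hn : n ≠ 0) (v : EuclideanSpace ℝ (Fin d)) (i : Fin n) :
    M.dataMap z v i = (Real.sqrt ((n : ℝ) - 1))⁻¹ *
      ⟪M.observation (z i) - (n : ℝ)⁻¹ • ∑ i', M.observation (z i'), v⟫_ℝ := by
  rw [observation_sub_mean M z hn, dataMap_apply, sum_inner, Finset.mul_sum]
  simp only [WithLp.ofLp_sum, WithLp.ofLp_smul, Finset.sum_apply, Pi.smul_apply, smul_eq_mul,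
    standardize_apply, real_inner_smul_left]
  refine Finset.sum_congr rfl fun a _ => ?_
  simp only [coordVec]
  ring

/-- The sample covariance matrix is the Gram operator of `dataMap`: both are sums over the centred
observations with weight 1/(n-1). -/
lemma isSingularDecomposition (hn : 2 ≤ n) {ev : Fin d → ℝ}
    {b : OrthonormalBasis (Fin d) ℝ (EuclideanSpace ℝ (Fin d))}
    (hdec : IsEigenDecomposition (sampleCov fun i => M.observation (z i)) ev b) :
    IsSingularDecomposition (M.dataMap z) ev b := by
  refine ⟨hdec.antitone, fun v w => ?_⟩
  have hN0 : (0 : ℝ) ≤ (n : ℝ) - 1 := by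
    have : (2 : ℝ) ≤ n := by exact_mod_cast hn
    linarith
  rw [← sum_mul_sum_smul_outerSelf, ← hdec.eq_sum, sampleCov, Finset.smul_sum,
    sum_mul_sum_smul_outerSelf, PiLp.inner_apply]
  refine Finset.sum_congr rfl fun i _ => ?_
  rw [dataMap_apply_apply M z (by omega), dataMap_apply_apply M z (by omega)]
  simp only [RCLike.inner_apply, conj_trivial]
  have h1 : (Real.sqrt ((n : ℝ) - 1))⁻¹ * (Real.sqrt ((n : ℝ) - 1))⁻¹ = ((n : ℝ) - 1)⁻¹ := by
    rw [← mul_inv, Real.mul_self_sqrt hN0]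
  rw [← h1]
  ring

lemma delta_eq : M.delta m n = ((n : ℝ) - 1)⁻¹ * ∑ s : Fin d with m ≤ s.val, M.eigval s := by
  rw [delta, div_eq_inv_mul]
  congr 1
  have h1 : ∑ s : Fin d with m ≤ s.val, M.eigval s =
      ∑ j ∈ Finset.range d with m ≤ j, M.lam (j + 1) := by
    rw [Finset.sum_filter, Finset.sum_filter, ← Fin.sum_univ_eq_sum_range
      (fun j => if m ≤ j then M.lam (j + 1) else 0) d]
    refine Finset.sum_congr rfl fun s _ => ?_
    split_ifs
    · rw [lam, dif_pos ⟨by omega, s.2⟩]; rfl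
    · rfl
  rw [h1]
  refine Finset.sum_nbij' (fun j => j - 1) (fun j => j + 1) ?_ ?_ ?_ ?_ ?_ <;>
    simp only [Finset.mem_Icc, Finset.mem_filter, Finset.mem_range] <;> intro j hj
  · omega
  · omega
  · omega
  · omega
  · rw [Nat.sub_add_cancel (by omega)]

lemma delta_nonneg (hn : 2 ≤ n) : 0 ≤ M.delta m n := by
  rw [delta_eq]
  have : (2 : ℝ) ≤ n := by exact_mod_cast hn
  exact mul_nonneg (inv_nonneg.2 (by linarith)) (Finset.sum_nonneg fun s _ => M.eigval_nonneg s)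

lemma noiseKernel_comm (x y : Fin d → ℝ) : M.noiseKernel m x y = M.noiseKernel m y x := by
  simp only [noiseKernel, mul_comm (x _)]

lemma noiseOff_isSymm : (M.noiseOff m z).IsSymm := by
  ext i j
  simp only [noiseOff, Matrix.transpose_apply, Matrix.of_apply, eq_comm (a := j),
    M.noiseKernel_comm m (z j)]

/-- Centring drops out on vectors of zero sum, and what remains is the uncentred dual noise matrix.
Its diagonal entries have mean δ, which splits off as a multiple of the identity. -/
lemma sum_noise_eq (hn : 2 ≤ n) {x y : EuclideanSpace ℝ (Fin n)} (hx : x ∈ centeredSubspace n)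
    (hy : y ∈ centeredSubspace n) :
    ∑ a : Fin d with m ≤ a.val, M.eigval a * (⟪standardize (coordVec z a), x⟫_ℝ *
      ⟪standardize (coordVec z a), y⟫_ℝ) = M.delta m n * ⟪x, y⟫_ℝ +
        matrixForm (M.noiseOff m z + Matrix.diagonal (M.noiseDiag m z)) x y := by
  have hN0 : (0 : ℝ) ≤ (n : ℝ) - 1 := by
    have : (2 : ℝ) ≤ n := by exact_mod_cast hn
    linarith
  have h1 : (Real.sqrt ((n : ℝ) - 1))⁻¹ * (Real.sqrt ((n : ℝ) - 1))⁻¹ = ((n : ℝ) - 1)⁻¹ := by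
    rw [← mul_inv, Real.mul_self_sqrt hN0]
  have h2 : ∀ i j, x i * (M.noiseOff m z + Matrix.diagonal (M.noiseDiag m z)) i j * y j =
      ((n : ℝ) - 1)⁻¹ * (x i * y j * M.noiseKernel m (z i) (z j)) -
        if i = j then M.delta m n * (x i * y j) else 0 := fun i j => by
    rw [Matrix.add_apply, noiseOff, Matrix.of_apply]
    split_ifs with hij
    · subst hij
      rw [Matrix.diagonal_apply_eq, noiseDiag, delta_eq]; ring
    · rw [Matrix.diagonal_apply_ne _ hij]; ring
  have h3 : ⟪x, y⟫_ℝ = ∑ i, x i * y i := by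
    simp only [PiLp.inner_apply, RCLike.inner_apply, conj_trivial, mul_comm]
  rw [matrixForm_apply]
  simp only [h2, Finset.sum_sub_distrib, Finset.sum_ite_eq, Finset.mem_univ, if_true,
    ← Finset.mul_sum]
  rw [h3, add_sub_cancel]
  have h4 : ∀ a, M.eigval a * (⟪standardize (coordVec z a), x⟫_ℝ *
      ⟪standardize (coordVec z a), y⟫_ℝ) = ((n : ℝ) - 1)⁻¹ *
        ∑ i, ∑ j, x i * y j * (M.eigval a * (z i a * z j a)) := fun a => by
    rw [inner_standardize _ hx, inner_standardize _ hy, ← h1]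
    have e1 : ∑ i, ∑ j, x i * y j * (M.eigval a * (z i a * z j a)) =
        M.eigval a * ((∑ i, coordVec z a i * x i) * ∑ j, coordVec z a j * y j) := by
      rw [Finset.sum_mul_sum, Finset.mul_sum]
      refine Finset.sum_congr rfl fun i _ => ?_
      rw [Finset.mul_sum]
      exact Finset.sum_congr rfl fun j _ => by simp only [coordVec]; ring
    rw [e1]
    ring
  simp only [h4, ← Finset.mul_sum]
  congr 1
  rw [Finset.sum_comm]
  refine Finset.sum_congr rfl fun i _ => ?_
  rw [Finset.sum_comm]
  refine Finset.sum_congr rfl fun j _ => ?_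
  rw [noiseKernel, Finset.mul_sum]

lemma sum_inner_dataMap_eq (hn : 2 ≤ n) {x y : EuclideanSpace ℝ (Fin n)}
    (hx : x ∈ centeredSubspace n) (hy : y ∈ centeredSubspace n) :
    ∑ a, ⟪M.dataMap z (M.eigvec a), x⟫_ℝ * ⟪M.dataMap z (M.eigvec a), y⟫_ℝ =
      ∑ t : {t : Fin d // t.val < m}, M.eigval t * ⟪standardize (coordVec z t), x⟫_ℝ *
        ⟪standardize (coordVec z t), y⟫_ℝ + M.delta m n * ⟪x, y⟫_ℝ +
        matrixForm (M.noiseOff m z + Matrix.diagonal (M.noiseDiag m z)) x y := by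
  rw [add_assoc, ← sum_noise_eq M m z hn hx hy]
  have h1 : ∀ a, ⟪M.dataMap z (M.eigvec a), x⟫_ℝ * ⟪M.dataMap z (M.eigvec a), y⟫_ℝ =
      M.eigval a * (⟪standardize (coordVec z a), x⟫_ℝ * ⟪standardize (coordVec z a), y⟫_ℝ) :=
    fun a => by
      rw [dataMap_eigvec, real_inner_smul_left, real_inner_smul_left]
      have := Real.mul_self_sqrt (M.eigval_nonneg a)
      linear_combination (⟪standardize (coordVec z a), x⟫_ℝ * ⟪standardize (coordVec z a), y⟫_ℝ) *
        this
  simp only [h1]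
  rw [← Finset.sum_filter_add_sum_filter_not Finset.univ fun a : Fin d => a.val < m]
  simp only [not_lt]
  congr 1
  rw [← Finset.sum_subtype_eq_sum_filter]
  simp [mul_assoc]

end Population

/-! ### The expansion for a typical sample. -/

namespace Population

open scoped InnerProductSpace

variable {d n : ℕ} (M : Population d) {m : ℕ} {z : Fin n → Fin d → ℝ} {C : ℝ}

lemma card_spike (hmd : m ≤ d) : Fintype.card {t : Fin d // t.val < m} = m := by
  rw [Fintype.card_subtype, Fin.card_filter_val_lt, min_eq_right hmd]

lemma lam_eq {j : ℕ} (h : 0 < j) (hd : j ≤ d) : M.lam j = M.eigval ⟨j - 1, by omega⟩ :=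
  dif_pos ⟨h, hd⟩

lemma sum_lam_eq (hmd : m ≤ d) :
    ∑ s ∈ Finset.Icc 1 m, M.lam s = ∑ s : Fin d with s.val < m, M.eigval s := by
  refine Finset.sum_bij' (fun j hj => (⟨j - 1, by have := Finset.mem_Icc.1 hj; omega⟩ : Fin d))
    (fun s _ => s.val + 1) ?_ ?_ ?_ ?_ ?_
  · intro j hj
    have := Finset.mem_Icc.1 hj
    simp only [Finset.mem_filter, Finset.mem_univ, true_and]
    omega
  · intro s hs
    have := (Finset.mem_filter.1 hs).2
    simp only [Finset.mem_Icc]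
    omega
  · intro j hj
    have := Finset.mem_Icc.1 hj
    simp only
    omega
  · intro s hs
    simp
  · intro j hj
    have := Finset.mem_Icc.1 hj
    exact M.lam_eq (by omega) (by omega)

/-- The leading sample eigenvalues and the distance of the leading parts for a typical sample. -/
theorem of_typicalSample (hn : 2 ≤ n) (hm : 0 < m) (hmd : m ≤ d)
    (hL : 0 < M.lam m)
    (hv : TypicalSample (M.noiseOff m z) (M.noiseDiag m z) (spikeVec m z) C
      (M.lam m)) (hC : 1 ≤ C)
    (hCn : 12 * (m * (16 * C ^ 2)) ≤ Real.sqrt n) {ev : Fin d → ℝ}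
    {b : OrthonormalBasis (Fin d) ℝ (EuclideanSpace ℝ (Fin d))}
    (hdec : IsEigenDecomposition (sampleCov fun i => M.observation (z i)) ev b) :
    M.delta m n + M.lam m * (1 - 3 * (m * (16 * C ^ 2) * (Real.sqrt n)⁻¹)) ≤
        ev ⟨m - 1, by omega⟩ ∧
      |∑ s : Fin d with s.val < m, ev s - m * M.delta m n -
          ∑ s : Fin d with s.val < m, M.eigval s| ≤
        7 * m ^ 2 * (m * (16 * C ^ 2) * (Real.sqrt n)⁻¹) * M.lam 1 ∧
      |frobNorm (sigma1Hat m ev b - M.sigma1 m) ^ 2 - (m * M.delta m n ^ 2 +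
          2 * M.delta m n * (∑ s : Fin d with s.val < m, ev s - m * M.delta m n))| ≤
        125 * m ^ 4 * (m * (16 * C ^ 2) * (Real.sqrt n)⁻¹) ^ 2 * M.lam 1 ^ 2 := by
  rw [M.lam_eq hm hmd] at hL hv ⊢
  rw [M.lam_eq zero_lt_one (by omega)]
  set L := M.eigval ⟨m - 1, by omega⟩ with hLdef
  set Λ := M.eigval ⟨1 - 1, by omega⟩ with hΛdef
  set δ := M.delta m n with hδ
  set h := (Real.sqrt n)⁻¹ with hh
  have hn0 : (0 : ℝ) < n := by positivity
  have hs0 := Real.sqrt_pos.2 hn0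
  have hm1 : (1 : ℝ) ≤ m := by exact_mod_cast hm
  have hCC : C ≤ C ^ 2 := le_self_pow₀ hC (by norm_num)
  have hC8 : 8 * C ≤ Real.sqrt n := by nlinarith
  set q := m * (16 * C ^ 2) * h with hq
  have hq0 : 0 ≤ q := by positivity
  have hq1 : 12 * q ≤ 1 := by
    rw [hq, hh, ← div_eq_mul_inv, ← mul_div_assoc, div_le_one hs0]
    exact hCn
  have hcard : (Fintype.card {t : Fin d // t.val < m} : ℝ) = m := by rw [card_spike hmd]
  set p : Fin d → EuclideanSpace ℝ (Fin n) := fun t => standardize (coordVec z t) with hp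
  set A := M.noiseOff m z + Matrix.diagonal (M.noiseDiag m z) with hA
  have hF : NearFrame (centeredSubspace n) (matrixForm A)
      (fun t : {t : Fin d // t.val < m} => p t) (16 * C ^ 2) L h :=
    hv.nearFrame hC hL hn rfl (M.noiseOff_isSymm m z) hC8
  have hh1 : h ≤ 1 := inv_le_one_of_one_le₀ (by nlinarith)
  have hS : NearFrame.Small {t : Fin d // t.val < m} (16 * C ^ 2) L h := by
    refine ⟨by nlinarith, hL, by positivity, hh1, by rw [hcard]; exact hm1, ?_⟩
    rw [hcard]
    exact hq1
  have hT := M.isSingularDecomposition z hn hdec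
  have hpK : ∀ c : {t : Fin d // t.val < m} → ℝ, ∑ t, c t • p t ∈ centeredSubspace n := fun c =>
    Submodule.sum_mem _ fun t _ => Submodule.smul_mem _ _ (hF.mem t)
  have hlow : ∀ t : {t : Fin d // t.val < m}, L ≤ M.eigval t := fun t =>
    M.eigval_antitone (Fin.le_def.2 (by have := t.2; simp only; omega))
  have hup : ∀ t : Fin d, M.eigval t ≤ Λ := fun t =>
    M.eigval_antitone (Fin.le_def.2 (by simp))
  -- Min-max on the span of the spiked vectors: there the dual form is at least δ + L(1 - q) - 2qL,
  -- with the losses from the Gram error and from `B`.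
  have hκ : ∀ s : Fin d, s.val < m → δ + L * (1 - 3 * q) ≤ ev s := by
    refine fun s hs => hT.le_ev M.eigvec hmd (p := p) (fun c hc0 h0 => ?_) (fun c => ?_) s hs
    · have e1 := hF.sum_abs_sq_le hS c
      rw [h0, norm_zero, zero_pow two_ne_zero, mul_zero] at e1
      have e2 : ∑ t, |c t| = 0 := pow_eq_zero_iff two_ne_zero |>.1 (le_antisymm e1 (sq_nonneg _))
      refine hc0 (funext fun t => abs_eq_zero.1 ?_)
      exact (Finset.sum_eq_zero_iff_of_nonneg fun _ _ => abs_nonneg _).1 e2 t (Finset.mem_univ t)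
    · have e1 := M.sum_inner_dataMap_eq m z hn (hpK c) (hpK c)
      have e2 := le_sum_sq_inner hF.gram (by rw [hcard]; linarith) c
      have e3 := (abs_le.1 (hF.abs_apply_self_le hS c)).1
      rw [hcard] at e2 e3
      simp only [← sq] at e1
      rw [e1, real_inner_self_eq_norm_sq]
      set x := ∑ t, c t • p t
      have e4 : L * ∑ t : {t : Fin d // t.val < m}, ⟪p t, x⟫_ℝ ^ 2 ≤
          ∑ t : {t : Fin d // t.val < m}, M.eigval t * ⟪p t, x⟫_ℝ * ⟪p t, x⟫_ℝ := by
        rw [Finset.mul_sum]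
        refine Finset.sum_le_sum fun t _ => ?_
        rw [sq, ← mul_assoc]
        have := mul_le_mul_of_nonneg_right (hlow t) (mul_self_nonneg ⟪p t, x⟫_ℝ)
        linarith
      have e5 := mul_le_mul_of_nonneg_left e2 hL.le
      have e6 : 2 * (m : ℝ) * (16 * C ^ 2 * L * h ^ 2) * ‖x‖ ^ 2 ≤ 2 * q * L * ‖x‖ ^ 2 := by
        refine mul_le_mul_of_nonneg_right ?_ (sq_nonneg _)
        calc _ = 2 * q * L * h := by rw [hq]; ring
          _ ≤ 2 * q * L * 1 := by gcongr
          _ = _ := mul_one _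
      have e7 : ((1 : ℝ) - m * (16 * C ^ 2 * h)) = 1 - q := by rw [hq]; ring
      rw [e7] at e5
      linarith
  -- From 12q ≤ 1 follows 1 - 3q ≥ 3/4.
  have hgap : ∀ s : {t : Fin d // t.val < m}, δ + 3 / 4 * L ≤ ev s := fun s => by
    have := hκ s s.2
    nlinarith
  have hδ0 : 0 ≤ δ := M.delta_nonneg m hn
  have hevpos : ∀ s : {t : Fin d // t.val < m}, 0 < ev s := fun s => by
    have := hgap s
    linarith
  set u : {t : Fin d // t.val < m} → EuclideanSpace ℝ (Fin n) :=
    fun s => (Real.sqrt (ev s))⁻¹ • M.dataMap z (b s) with hu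
  have hU : SpikedEigenvectors (centeredSubspace n) (matrixForm A)
      (fun t : {t : Fin d // t.val < m} => p t) u (fun t => M.eigval t) (fun t => ev t) L Λ δ := by
    have huK : ∀ s, u s ∈ centeredSubspace n := fun s =>
      Submodule.smul_mem _ _ (M.dataMap_mem z (by omega) _)
    refine ⟨huK, hT.orthonormal hevpos, hlow, fun t => hup t, hgap, fun s x hx => ?_⟩
    rw [← M.sum_inner_dataMap_eq m z hn (huK s) hx]
    exact (hT.sum_inner_mul_inner M.eigvec s x _).symm
  have hΛ : L ≤ Λ := hup _
  have r1 := hU.abs_sum_ev_sub_le hF hS hΛ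
  have r2 := hU.abs_remainder_le hF hS hΛ
  rw [hcard, ← hq] at r1 r2
  have sub : ∀ f : Fin d → ℝ, ∑ t : {t : Fin d // t.val < m}, f t =
      ∑ s : Fin d with s.val < m, f s := fun f => by
    rw [← Finset.sum_subtype_eq_sum_filter]
    simp
  have hδsum : ∑ s : {t : Fin d // t.val < m}, (ev s - δ) =
      ∑ s : Fin d with s.val < m, ev s - m * δ := by
    rw [Finset.sum_sub_distrib, sub ev, Finset.sum_const, Finset.card_univ, nsmul_eq_mul, hcard]
  refine ⟨hκ _ (by simp only; omega), ?_, ?_⟩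
  · rw [← hδsum, ← sub M.eigval]
    exact r1
  · rw [sigma1Hat, sigma1, frobNorm_sq_sub]
    refine le_trans (le_of_eq ?_) r2
    congr 1
    -- The cross term of the squared distance in dual coordinates: ev_a⟨b_a, h_t⟩² = ⟨T h_t, u_a⟩² =
    -- λ_t⟨p_t, u_a⟩².
    have e1 : ∑ t : Fin d with t.val < m, ∑ a : Fin d with a.val < m,
        M.eigval t * (ev a * ⟪b a, M.eigvec t⟫_ℝ ^ 2) =
        ∑ t : {t : Fin d // t.val < m}, M.eigval t ^ 2 * ∑ s, ⟪p t, u s⟫_ℝ ^ 2 := by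
      rw [← sub fun t => ∑ a : Fin d with a.val < m,
        M.eigval t * (ev a * ⟪b a, M.eigvec t⟫_ℝ ^ 2)]
      refine Finset.sum_congr rfl fun t _ => ?_
      rw [← sub fun a => M.eigval t * (ev a * ⟪b a, M.eigvec t⟫_ℝ ^ 2), Finset.mul_sum]
      refine Finset.sum_congr rfl fun s _ => ?_
      rw [← hT.inner_sq s (hevpos s), dataMap_eigvec, real_inner_smul_left, mul_pow,
        Real.sq_sqrt (M.eigval_nonneg t)]
      ring
    have e2 : ∑ s : {t : Fin d // t.val < m}, (ev s - δ) ^ 2 =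
        ∑ s : Fin d with s.val < m, ev s ^ 2 - 2 * δ * ∑ s : Fin d with s.val < m, ev s +
          m * δ ^ 2 := by
      rw [sub fun s => (ev s - δ) ^ 2]
      have e3 : ∀ s, (ev s - δ) ^ 2 = ev s ^ 2 - 2 * δ * ev s + δ ^ 2 := fun s => by ring
      simp only [e3, Finset.sum_add_distrib, Finset.sum_sub_distrib, ← Finset.mul_sum]
      rw [Finset.sum_const, Fin.card_filter_val_lt, min_eq_right hmd, nsmul_eq_mul]
    rw [e1, e2, sub fun t => M.eigval t ^ 2]
    ring

/-- If the estimation error is small, then so is the noise level. -/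
theorem delta_le_of_typicalSample (hn : 2 ≤ n) (hm : 0 < m) (hmd : m ≤ d)
    (hL : 0 < M.lam m)
    (hv : TypicalSample (M.noiseOff m z) (M.noiseDiag m z) (spikeVec m z) C
      (M.lam m)) (hC : 1 ≤ C)
    (hCn : 12 * (m * (16 * C ^ 2)) ≤ Real.sqrt n) {ev : Fin d → ℝ}
    {b : OrthonormalBasis (Fin d) ℝ (EuclideanSpace ℝ (Fin d))}
    (hdec : IsEigenDecomposition (sampleCov fun i => M.observation (z i)) ev b) :
    M.delta m n ≤ frobNorm (sigma1Hat m ev b - M.sigma1 m) +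
      M.lam m * (3 * (m * (16 * C ^ 2) * (Real.sqrt n)⁻¹)) := by
  have h1 := (M.of_typicalSample hn hm hmd hL hv hC hCn hdec).1
  have h2 := eigval_sub_le_frobNorm hmd hdec.antitone b M.eigvec ⟨m - 1, by omega⟩
    (by simp only; omega) (M.eigval_nonneg _)
  rw [M.lam_eq hm hmd] at h1 ⊢
  rw [sigma1Hat, sigma1]
  linarith

end Population

/-! ### Integration over independent samples. -/

section Resampling

variable {ι X : Type*} [Fintype ι] [MeasurableSpace X] {ρ : Measure X}
  [IsProbabilityMeasure ρ]

lemma integral_pi_eval {f : X → ℝ} (hf : AEStronglyMeasurable f ρ) (i : ι) :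
    ∫ z, f (z i) ∂(Measure.pi fun _ : ι => ρ) = ∫ x, f x ∂ρ := by
  have h := measurePreserving_eval (fun _ : ι => ρ) i
  conv_rhs => rw [← h.map_eq]
  rw [integral_map h.measurable.aemeasurable (by rwa [h.map_eq])]

lemma memLp_pi_eval {f : X → ℝ} {p : ℝ≥0∞} (hf : MemLp f p ρ) (i : ι) :
    MemLp (fun z : ι → X => f (z i)) p (Measure.pi fun _ : ι => ρ) :=
  hf.comp_measurePreserving (measurePreserving_eval (fun _ : ι => ρ) i)

/-- Independence keeps the exponent `p`, where Hölder's inequality would halve it; fourth moments of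
the coordinates thus suffice for fourth moments of the kernel. -/
lemma memLp_pi_mul {f g : X → ℝ} {p : ℝ≥0∞} (hp0 : p ≠ 0) (hp : p ≠ ∞) (hf : MemLp f p ρ)
    (hg : MemLp g p ρ) {i j : ι} (hij : i ≠ j) :
    MemLp (fun z : ι → X => f (z i) * g (z j)) p (Measure.pi fun _ : ι => ρ) := by
  have h1 := memLp_pi_eval hf i
  have h2 := memLp_pi_eval hg j
  have hm : AEStronglyMeasurable (fun z : ι → X => f (z i) * g (z j))
      (Measure.pi fun _ : ι => ρ) := h1.1.mul h2.1
  rw [← integrable_norm_rpow_iff hm hp0 hp]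
  have hind : IndepFun (fun z : ι → X => ‖f (z i)‖ ^ p.toReal) (fun z => ‖g (z j)‖ ^ p.toReal)
      (Measure.pi fun _ : ι => ρ) := by
    have h3 : iIndepFun (fun (i : ι) (z : ι → X) => z i) (Measure.pi fun _ : ι => ρ) :=
      iIndepFun_pi (X := fun _ x => x) fun _ => aemeasurable_id
    have h4 := h3.indepFun hij
    refine IndepFun.comp₀ (φ := fun x => ‖f x‖ ^ p.toReal) (ψ := fun x => ‖g x‖ ^ p.toReal) h4
      (measurable_pi_apply i).aemeasurable (measurable_pi_apply j).aemeasurable ?_ ?_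
    · rw [(measurePreserving_eval (fun _ : ι => ρ) i).map_eq]
      exact hf.1.aemeasurable.norm.pow_const _
    · rw [(measurePreserving_eval (fun _ : ι => ρ) j).map_eq]
      exact hg.1.aemeasurable.norm.pow_const _
  have h5 := hind.integrable_mul (h1.integrable_norm_rpow hp0 hp) (h2.integrable_norm_rpow hp0 hp)
  refine h5.congr (Eventually.of_forall fun z => ?_)
  simp only [Pi.mul_apply]
  rw [norm_mul, Real.mul_rpow (norm_nonneg _) (norm_nonneg _)]

instance holderTriple_four_four_two : ENNReal.HolderTriple 4 4 2 where
  inv_add_inv_eq_inv := by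
    rw [← ENNReal.toReal_eq_toReal_iff' (by simp) (by simp), ENNReal.toReal_add (by simp) (by simp)]
    norm_num

variable [DecidableEq ι]

/-- Replacing one coordinate by an independent copy preserves a product measure. -/
lemma measurePreserving_update (l : ι) :
    MeasurePreserving (fun q : (ι → X) × X => Function.update q.1 l q.2)
      ((Measure.pi fun _ : ι => ρ).prod ρ) (Measure.pi fun _ : ι => ρ) := by
  have hmeas : Measurable fun q : (ι → X) × X => Function.update q.1 l q.2 := by
    refine measurable_pi_lambda _ fun i => ?_
    by_cases h : i = l
    · subst h; simpa using measurable_snd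
    · simp only [Function.update_of_ne h]; fun_prop
  refine ⟨hmeas, (Measure.pi_eq fun s hs => ?_).symm⟩
  rw [Measure.map_apply hmeas (MeasurableSet.univ_pi hs)]
  have h1 : (fun q : (ι → X) × X => Function.update q.1 l q.2) ⁻¹' Set.univ.pi s =
      (Set.univ.pi fun i => if i = l then Set.univ else s i) ×ˢ s l := by
    ext q
    simp only [Set.mem_preimage, Set.mem_pi, Set.mem_univ, true_implies, Set.mem_prod]
    constructor
    · refine fun h => ⟨fun i => ?_, by simpa using h l⟩
      split_ifs with hi
      · trivial
      · simpa [hi] using h i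
    · rintro ⟨h1, h2⟩ i
      by_cases hi : i = l
      · subst hi; simpa using h2
      · simpa [hi] using h1 i
  rw [h1, Measure.prod_prod, Measure.pi_pi]
  rw [← Finset.prod_erase_mul _ _ (Finset.mem_univ l), if_pos rfl, measure_univ, mul_one,
    ← Finset.prod_erase_mul Finset.univ (fun i => ρ (s i)) (Finset.mem_univ l)]
  congr 1
  exact Finset.prod_congr rfl fun i hi => by rw [if_neg (Finset.ne_of_mem_erase hi)]

/-- Fubini in the form of conditioning on all observations but one: the observation `l` is replaced
by a fresh copy and integrated out first. -/
lemma integral_pi_eq_integral_update {F : (ι → X) → ℝ}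
    (hF : Integrable F (Measure.pi fun _ : ι => ρ)) (l : ι) :
    ∫ z, F z ∂(Measure.pi fun _ : ι => ρ) =
      ∫ z, ∫ y, F (Function.update z l y) ∂ρ ∂(Measure.pi fun _ : ι => ρ) := by
  have h := measurePreserving_update (ρ := ρ) l
  have h1 : Integrable (fun q : (ι → X) × X => F (Function.update q.1 l q.2))
      ((Measure.pi fun _ : ι => ρ).prod ρ) := h.integrable_comp_of_integrable hF
  rw [← integral_prod _ h1]
  conv_lhs => rw [← h.map_eq]
  rw [integral_map h.measurable.aemeasurable (by rw [h.map_eq]; exact hF.1)]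

lemma integral_pi_le_of_update {F G : (ι → X) → ℝ}
    (hF : Integrable F (Measure.pi fun _ : ι => ρ)) (hG : Integrable G (Measure.pi fun _ : ι => ρ))
    (l : ι) (h : ∀ z, ∫ y, F (Function.update z l y) ∂ρ ≤ G z) :
    ∫ z, F z ∂(Measure.pi fun _ : ι => ρ) ≤ ∫ z, G z ∂(Measure.pi fun _ : ι => ρ) := by
  rw [integral_pi_eq_integral_update hF l]
  exact integral_mono ((measurePreserving_update (ρ := ρ) l).integrable_comp_of_integrable
    hF).integral_prod_left hG h

/-- No integrability is required, as a non-integrable function has integral zero by convention. -/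
lemma integral_pi_eq_zero {F : (ι → X) → ℝ} (l : ι)
    (h : ∀ z, ∫ y, F (Function.update z l y) ∂ρ = 0) :
    ∫ z, F z ∂(Measure.pi fun _ : ι => ρ) = 0 := by
  by_cases hF : Integrable F (Measure.pi fun _ : ι => ρ)
  · rw [integral_pi_eq_integral_update hF l]; simp [h]
  · exact integral_undef hF

/-- The second moment of a sum of independent centered random variables. -/
lemma integral_sq_sum_pi {f : X → ℝ} (hf : MemLp f 2 ρ) (h0 : ∫ x, f x ∂ρ = 0) :
    Integrable (fun z : ι → X => (∑ i, f (z i)) ^ 2) (Measure.pi fun _ : ι => ρ) ∧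
    ∫ z, (∑ i, f (z i)) ^ 2 ∂(Measure.pi fun _ : ι => ρ) =
      Fintype.card ι * ∫ x, f x ^ 2 ∂ρ := by
  have hint : ∀ i j : ι, Integrable (fun z : ι → X => f (z i) * f (z j))
      (Measure.pi fun _ : ι => ρ) := fun i j =>
    (memLp_pi_eval hf i).integrable_mul (memLp_pi_eval hf j)
  have h1 : ∀ z : ι → X, (∑ i, f (z i)) ^ 2 = ∑ i, ∑ j, f (z i) * f (z j) := fun z => by
    rw [sq, Finset.sum_mul_sum]
  have hint' : ∀ i : ι, Integrable (fun z : ι → X => ∑ j, f (z i) * f (z j))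
      (Measure.pi fun _ : ι => ρ) := fun i => integrable_finsetSum _ fun j _ => hint i j
  simp only [h1]
  refine ⟨integrable_finsetSum _ fun i _ => hint' i, ?_⟩
  rw [integral_finsetSum _ fun i _ => hint' i]
  have h2 : ∀ i : ι, ∫ z : ι → X, ∑ j, f (z i) * f (z j) ∂(Measure.pi fun _ : ι => ρ) =
      ∫ x, f x ^ 2 ∂ρ := fun i => by
    rw [integral_finsetSum _ fun j _ => hint i j,
      Finset.sum_eq_single_of_mem i (Finset.mem_univ i) fun j _ hne => ?_]
    · simp only [← sq]
      exact integral_pi_eval (hf.1.pow 2) i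
    · refine integral_pi_eq_zero j fun z => ?_
      simp only [Function.update_self, Function.update_of_ne hne.symm]
      rw [integral_const_mul, h0, mul_zero]
  simp [h2]

end Resampling

/-! ### Moments of the noise kernel. -/

section KernelMoments

variable {d : ℕ} {ρ : Measure (Fin d → ℝ)} {K : ℝ}

/-- The moment conditions on a sphered vector, with fourth moments bounded by `K`. -/
structure SpheredMoments (ρ : Measure (Fin d → ℝ)) (K : ℝ) : Prop where
  memLp : ∀ j, MemLp (fun z : Fin d → ℝ => z j) 4 ρ
  mean : ∀ j, ∫ z, z j ∂ρ = 0
  cov : ∀ j j', ∫ z, z j * z j' ∂ρ = if j = j' then 1 else 0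
  sq_sq : ∀ j₁ j₂, j₁ ≠ j₂ → ∫ z, z j₁ ^ 2 * z j₂ ^ 2 ∂ρ = 1
  four : ∀ j₁ j₂ j₃ j₄, j₁ ≠ j₂ → j₁ ≠ j₃ → j₁ ≠ j₄ → ∫ z, z j₁ * z j₂ * z j₃ * z j₄ ∂ρ = 0
  fourth : ∀ j, ∫ z, z j ^ 4 ∂ρ ≤ K
  one_le : 1 ≤ K

/-- The diagonal kernel with weights `a s` on the coordinates in `S`. -/
def diagKernel (S : Finset (Fin d)) (a : Fin d → ℝ) (x y : Fin d → ℝ) : ℝ :=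
  ∑ s ∈ S, a s * (x s * y s)

lemma diagKernel_comm (S : Finset (Fin d)) (a : Fin d → ℝ) (x y : Fin d → ℝ) :
    diagKernel S a x y = diagKernel S a y x := by
  simp only [diagKernel, mul_comm (x _)]

/-- A function of the sphered vector that is uncorrelated with the coordinates in `S`, also in the
second order. -/
structure UncorrelatedWith (ρ : Measure (Fin d → ℝ)) (K : ℝ) (S : Finset (Fin d))
    (ψ : (Fin d → ℝ) → ℝ) : Prop where
  memLp : MemLp ψ 4 ρ
  fourth : ∫ z, ψ z ^ 4 ∂ρ ≤ K
  mean : ∀ s ∈ S, ∫ z, ψ z * z s ∂ρ = 0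
  cov : ∀ s ∈ S, ∀ s' ∈ S, ∫ z, ψ z ^ 2 * (z s * z s') ∂ρ = if s = s' then 1 else 0

lemma integrable_four {Ω : Type*} [MeasurableSpace Ω] {μ : Measure Ω} {f₁ f₂ f₃ f₄ : Ω → ℝ}
    (h₁ : MemLp f₁ 4 μ) (h₂ : MemLp f₂ 4 μ) (h₃ : MemLp f₃ 4 μ) (h₄ : MemLp f₄ 4 μ) :
    Integrable (fun z => f₁ z * f₂ z * (f₃ z * f₄ z)) μ :=
  MemLp.integrable_mul (MemLp.mul h₂ h₁ : MemLp (fun z => f₁ z * f₂ z) 2 μ)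
    (MemLp.mul h₄ h₃ : MemLp (fun z => f₃ z * f₄ z) 2 μ)

namespace SpheredMoments

lemma uncorrelatedWith_one [IsProbabilityMeasure ρ] (hρ : SpheredMoments ρ K) (S : Finset (Fin d)) :
    UncorrelatedWith ρ K S fun _ => 1 where
  memLp := memLp_const _
  fourth := by simpa using hρ.one_le
  mean s _ := by simpa using hρ.mean s
  cov s _ s' _ := by simpa using hρ.cov s s'

lemma uncorrelatedWith_coord (hρ : SpheredMoments ρ K) {S : Finset (Fin d)} {t : Fin d}
    (ht : t ∉ S) : UncorrelatedWith ρ K S fun z => z t where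
  memLp := hρ.memLp t
  fourth := hρ.fourth t
  mean s hs := by
    have h : t ≠ s := fun h => ht (h ▸ hs)
    rw [hρ.cov, if_neg h]
  cov s hs s' hs' := by
    split_ifs with h
    · subst h
      rw [← hρ.sq_sq t s fun h => ht (h ▸ hs)]
      simp only [sq]
    · rw [← hρ.four s t t s' (fun h => ht (h ▸ hs)) (fun h => ht (h ▸ hs)) h]
      refine integral_congr_ae (Eventually.of_forall fun z => ?_)
      simp only
      ring

lemma integral_sq_sq_le (hρ : SpheredMoments ρ K) (s t : Fin d) :
    ∫ z, z s ^ 2 * z t ^ 2 ∂ρ ≤ K := by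
  by_cases h : s = t
  · subst h
    refine le_trans (le_of_eq ?_) (hρ.fourth s)
    exact integral_congr_ae (Eventually.of_forall fun z => by simp only; ring)
  · rw [hρ.sq_sq s t h]; exact hρ.one_le

lemma integrable_coord_four (hρ : SpheredMoments ρ K) (s t u v : Fin d) :
    Integrable (fun z : Fin d → ℝ => z s * z t * (z u * z v)) ρ :=
  integrable_four (hρ.memLp s) (hρ.memLp t) (hρ.memLp u) (hρ.memLp v)

/-- Unless {u, v} = {s, t}, one of the four indices differs from the three others and the mixed
moment vanishes. The two indicators record the two matchings. -/
lemma integral_coord_four_le (hρ : SpheredMoments ρ K) (c : Fin d → ℝ) {s t u v : Fin d}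
    (hst : s ≠ t) (huv : u ≠ v) :
    c s * c t * (c u * c v) * ∫ z, z s * z t * (z u * z v) ∂ρ ≤
      (if u = s then if v = t then c s ^ 2 * c t ^ 2 else 0 else 0) +
        if u = t then if v = s then c s ^ 2 * c t ^ 2 else 0 else 0 := by
  have hnn : ∀ (p q : Prop) [Decidable p] [Decidable q],
      0 ≤ if p then if q then c s ^ 2 * c t ^ 2 else 0 else 0 := fun p q _ _ => by
    split_ifs <;> positivity
  have hzero : (∫ z, z s * z t * (z u * z v) ∂ρ = 0) →
      c s * c t * (c u * c v) * ∫ z, z s * z t * (z u * z v) ∂ρ ≤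
      (if u = s then if v = t then c s ^ 2 * c t ^ 2 else 0 else 0) +
        if u = t then if v = s then c s ^ 2 * c t ^ 2 else 0 else 0 := fun h => by
    rw [h, mul_zero]; exact add_nonneg (hnn _ _) (hnn _ _)
  have hone : ∀ w : Fin d → ℝ, w s * w t * (w s * w t) = w s ^ 2 * w t ^ 2 := fun w => by ring
  have hone' : ∀ w : Fin d → ℝ, w s * w t * (w t * w s) = w s ^ 2 * w t ^ 2 := fun w => by ring
  by_cases hvs : v = s
  · subst hvs
    by_cases hut : u = t
    · subst hut
      simp only [hone', hρ.sq_sq v u hst, if_neg huv, if_true, mul_one, zero_add]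
      exact le_rfl
    · refine hzero ?_
      rw [← hρ.four u v t v huv hut huv]
      exact integral_congr_ae (Eventually.of_forall fun z => by simp only; ring)
  · by_cases hvt : v = t
    · subst hvt
      by_cases hus : u = s
      · subst hus
        simp only [hone, hρ.sq_sq u v huv, if_neg huv, if_true, mul_one, add_zero]
        exact le_rfl
      · refine hzero ?_
        rw [← hρ.four u s v v hus huv huv]
        exact integral_congr_ae (Eventually.of_forall fun z => by simp only; ring)
    · refine hzero ?_
      rw [← hρ.four v s t u hvs hvt huv.symm]
      exact integral_congr_ae (Eventually.of_forall fun z => by simp only; ring)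

/-- The fourth moment of a linear form. -/
lemma integral_linear_pow_four_le (hρ : SpheredMoments ρ K) (S : Finset (Fin d))
    (c : Fin d → ℝ) :
    ∫ z, (∑ s ∈ S, c s * z s) ^ 4 ∂ρ ≤ (2 * K + 4) * (∑ s ∈ S, c s ^ 2) ^ 2 := by
  -- The square of the linear form is split into its diagonal A and the rest B. With σ² = ∑c_s², E
  -- A² ≤ Kσ⁴ and E B² ≤ 2σ⁴, so (A + B)² ≤ 2A² + 2B² gives 2K + 4.
  set A : (Fin d → ℝ) → ℝ := fun z => ∑ s ∈ S, c s ^ 2 * z s ^ 2 with hA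
  set B : (Fin d → ℝ) → ℝ := fun z => ∑ s ∈ S, ∑ t ∈ S, if s = t then 0 else
    c s * c t * (z s * z t) with hB
  have hsum : ∀ z, (∑ s ∈ S, c s * z s) ^ 2 = A z + B z := fun z => by
    rw [sq, Finset.sum_mul_sum, hA, hB]
    simp only
    rw [← Finset.sum_add_distrib]
    refine Finset.sum_congr rfl fun s hs => ?_
    have h1 : ∀ t, c s * z s * (c t * z t) = (if s = t then c s ^ 2 * z s ^ 2 else 0) +
        if s = t then 0 else c s * c t * (z s * z t) := fun t => by
      split_ifs with h
      · subst h; ring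
      · ring
    simp only [h1, Finset.sum_add_distrib]
    rw [Finset.sum_ite_eq, if_pos hs]
  have hA2 : ∀ z, A z ^ 2 = ∑ s ∈ S, ∑ t ∈ S, c s ^ 2 * c t ^ 2 * (z s * z s * (z t * z t)) :=
    fun z => by
      rw [sq, hA]
      simp only
      rw [Finset.sum_mul_sum]
      exact Finset.sum_congr rfl fun _ _ => Finset.sum_congr rfl fun _ _ => by ring
  have hB2 : ∀ z, B z ^ 2 = ∑ s ∈ S, ∑ t ∈ S, ∑ u ∈ S, ∑ v ∈ S,
      if s = t ∨ u = v then 0 else c s * c t * (c u * c v) * (z s * z t * (z u * z v)) :=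
    fun z => by
      rw [sq, hB]
      simp only [Finset.sum_mul]
      refine Finset.sum_congr rfl fun s _ => Finset.sum_congr rfl fun t _ => ?_
      rw [Finset.mul_sum]
      refine Finset.sum_congr rfl fun u _ => ?_
      rw [Finset.mul_sum]
      refine Finset.sum_congr rfl fun v _ => ?_
      by_cases h1 : s = t <;> by_cases h2 : u = v <;> simp [h1, h2]
      ring
  have iA : ∀ s t, Integrable (fun z : Fin d → ℝ => c s ^ 2 * c t ^ 2 * (z s * z s * (z t * z t)))
      ρ := fun s t => (hρ.integrable_coord_four s s t t).const_mul _
  have iB : ∀ s t u v, Integrable (fun z : Fin d → ℝ => if s = t ∨ u = v then 0 else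
      c s * c t * (c u * c v) * (z s * z t * (z u * z v))) ρ := fun s t u v => by
    split_ifs
    · exact integrable_zero _ _ _
    · exact (hρ.integrable_coord_four s t u v).const_mul _
  have iA2 : Integrable (fun z => A z ^ 2) ρ := by
    simp only [hA2]
    exact integrable_finsetSum _ fun s _ => integrable_finsetSum _ fun t _ => iA s t
  have iB2 : Integrable (fun z => B z ^ 2) ρ := by
    simp only [hB2]
    exact integrable_finsetSum _ fun s _ => integrable_finsetSum _ fun t _ =>
      integrable_finsetSum _ fun u _ => integrable_finsetSum _ fun v _ => iB s t u v
  have eA : ∫ z, A z ^ 2 ∂ρ ≤ K * (∑ s ∈ S, c s ^ 2) ^ 2 := by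
    simp only [hA2]
    rw [integral_finsetSum _ fun s _ => integrable_finsetSum _ fun t _ => iA s t, sq,
      Finset.sum_mul_sum, Finset.mul_sum]
    refine Finset.sum_le_sum fun s _ => ?_
    rw [integral_finsetSum _ fun t _ => iA s t, Finset.mul_sum]
    refine Finset.sum_le_sum fun t _ => ?_
    rw [integral_const_mul, mul_comm K]
    refine mul_le_mul_of_nonneg_left ?_ (by positivity)
    simpa only [sq] using hρ.integral_sq_sq_le s t
  have eB : ∫ z, B z ^ 2 ∂ρ ≤ 2 * (∑ s ∈ S, c s ^ 2) ^ 2 := by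
    simp only [hB2]
    rw [integral_finsetSum _ fun s _ => integrable_finsetSum _ fun t _ =>
      integrable_finsetSum _ fun u _ => integrable_finsetSum _ fun v _ => iB s t u v, sq,
      Finset.sum_mul_sum, Finset.mul_sum]
    refine Finset.sum_le_sum fun s hs => ?_
    rw [integral_finsetSum _ fun t _ =>
      integrable_finsetSum _ fun u _ => integrable_finsetSum _ fun v _ => iB s t u v,
      Finset.mul_sum]
    refine Finset.sum_le_sum fun t ht => ?_
    rw [integral_finsetSum _ fun u _ => integrable_finsetSum _ fun v _ => iB s t u v]
    have h1 : ∀ u ∈ S, ∫ z, ∑ v ∈ S, (if s = t ∨ u = v then 0 else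
        c s * c t * (c u * c v) * (z s * z t * (z u * z v))) ∂ρ ≤
        ∑ v ∈ S, ((if u = s then if v = t then c s ^ 2 * c t ^ 2 else 0 else 0) +
          if u = t then if v = s then c s ^ 2 * c t ^ 2 else 0 else 0) := fun u _ => by
      rw [integral_finsetSum _ fun v _ => iB s t u v]
      refine Finset.sum_le_sum fun v _ => ?_
      by_cases h : s = t ∨ u = v
      · simp only [if_pos h, integral_zero]
        refine add_nonneg ?_ ?_ <;> split_ifs <;> positivity
      · simp only [if_neg h]
        rw [integral_const_mul]
        push Not at h
        exact hρ.integral_coord_four_le c h.1 h.2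
    refine (Finset.sum_le_sum h1).trans (le_of_eq ?_)
    simp only [Finset.sum_add_distrib]
    have h2 : ∀ x y : Fin d, x ∈ S → y ∈ S → ∀ r : ℝ,
        ∑ u ∈ S, ∑ v ∈ S, (if u = x then if v = y then r else 0 else 0) = r :=
      fun x y hx hy r => by
        rw [Finset.sum_eq_single_of_mem x hx fun u _ hne => by simp [hne]]
        simp [hy]
    rw [h2 s t hs ht, h2 t s ht hs]
    ring
  have i4 : Integrable (fun z => 2 * A z ^ 2 + 2 * B z ^ 2) ρ :=
    (iA2.const_mul 2).add (iB2.const_mul 2)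
  have hle : ∀ z, (∑ s ∈ S, c s * z s) ^ 4 ≤ 2 * A z ^ 2 + 2 * B z ^ 2 := fun z => by
    have : (∑ s ∈ S, c s * z s) ^ 4 = (A z + B z) ^ 2 := by rw [← hsum]; ring
    rw [this]
    nlinarith [sq_nonneg (A z - B z)]
  calc _ ≤ ∫ z, (2 * A z ^ 2 + 2 * B z ^ 2) ∂ρ :=
        integral_mono_of_nonneg (Eventually.of_forall fun z => by positivity) i4
          (Eventually.of_forall hle)
    _ = 2 * ∫ z, A z ^ 2 ∂ρ + 2 * ∫ z, B z ^ 2 ∂ρ := by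
        rw [integral_add (iA2.const_mul 2) (iB2.const_mul 2), integral_const_mul,
          integral_const_mul]
    _ ≤ _ := by linarith

lemma integral_diagKernel_pow_four_le (hρ : SpheredMoments ρ K) (S : Finset (Fin d))
    (a : Fin d → ℝ) (x : Fin d → ℝ) :
    ∫ y, diagKernel S a x y ^ 4 ∂ρ ≤
      (2 * K + 4) * diagKernel S (fun s => a s ^ 2) x x ^ 2 := by
  have h := hρ.integral_linear_pow_four_le S fun s => a s * x s
  have e1 : ∑ s ∈ S, (a s * x s) ^ 2 = diagKernel S (fun s => a s ^ 2) x x :=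
    Finset.sum_congr rfl fun _ _ => by ring
  rw [e1] at h
  simpa only [diagKernel, mul_assoc] using h

lemma memLp_diagKernel_self (hρ : SpheredMoments ρ K) (S : Finset (Fin d)) (a : Fin d → ℝ) :
    MemLp (fun x => diagKernel S a x x) 2 ρ :=
  memLp_finsetSum _ fun s _ =>
    (MemLp.mul (hρ.memLp s) (hρ.memLp s) : MemLp (fun x : Fin d → ℝ => x s * x s) 2 ρ).const_mul
      (a s)

lemma integral_diagKernel_self_sq_le (hρ : SpheredMoments ρ K) (S : Finset (Fin d))
    {a : Fin d → ℝ} (ha : ∀ s, 0 ≤ a s) :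
    ∫ x, diagKernel S a x x ^ 2 ∂ρ ≤ K * (∑ s ∈ S, a s) ^ 2 := by
  have h1 : ∀ x, diagKernel S a x x ^ 2 =
      ∑ s ∈ S, ∑ t ∈ S, a s * a t * (x s * x s * (x t * x t)) := fun x => by
    rw [sq, diagKernel, Finset.sum_mul_sum]
    exact Finset.sum_congr rfl fun _ _ => Finset.sum_congr rfl fun _ _ => by ring
  have iA : ∀ s t, Integrable (fun z : Fin d → ℝ => a s * a t * (z s * z s * (z t * z t)))
      ρ := fun s t => (hρ.integrable_coord_four s s t t).const_mul _
  simp only [h1]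
  rw [integral_finsetSum _ fun s _ => integrable_finsetSum _ fun t _ => iA s t, sq,
    Finset.sum_mul_sum, Finset.mul_sum]
  refine Finset.sum_le_sum fun s _ => ?_
  rw [integral_finsetSum _ fun t _ => iA s t, Finset.mul_sum]
  refine Finset.sum_le_sum fun t _ => ?_
  rw [integral_const_mul, mul_comm K]
  refine mul_le_mul_of_nonneg_left ?_ (mul_nonneg (ha s) (ha t))
  simpa only [sq] using hρ.integral_sq_sq_le s t

/-- The variance of the squared norm of the noise part. -/
lemma integral_diagKernel_self_sub_sq_le [IsProbabilityMeasure ρ] (hρ : SpheredMoments ρ K) (S : Finset (Fin d))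
    (a : Fin d → ℝ) :
    ∫ x, (diagKernel S a x x - ∑ s ∈ S, a s) ^ 2 ∂ρ ≤ K * ∑ s ∈ S, a s ^ 2 := by
  have h1 : ∀ x : Fin d → ℝ, (diagKernel S a x x - ∑ s ∈ S, a s) ^ 2 =
      ∑ s ∈ S, ∑ t ∈ S, a s * a t * ((x s * x s - 1) * (x t * x t - 1)) := fun x => by
    rw [diagKernel, ← Finset.sum_sub_distrib, sq, Finset.sum_mul_sum]
    exact Finset.sum_congr rfl fun _ _ => Finset.sum_congr rfl fun _ _ => by ring
  have iS : ∀ s, MemLp (fun z : Fin d → ℝ => z s * z s - 1) 2 ρ := fun s =>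
    (MemLp.mul (hρ.memLp s) (hρ.memLp s) : MemLp (fun x : Fin d → ℝ => x s * x s) 2 ρ).sub
      (memLp_const 1)
  have iA : ∀ s t, Integrable (fun x : Fin d → ℝ => a s * a t * ((x s * x s - 1) *
      (x t * x t - 1))) ρ := fun s t => ((iS s).integrable_mul (iS t)).const_mul _
  have i2 : ∀ s, Integrable (fun x : Fin d → ℝ => x s * x s) ρ := fun s =>
    (MemLp.mul (hρ.memLp s) (hρ.memLp s) : MemLp (fun x : Fin d → ℝ => x s * x s) 2 ρ).integrable
      one_le_two
  -- The covariance of two squared coordinates; it vanishes for s ≠ t by `sq_sq`, so only the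
  -- diagonal survives.
  have hval : ∀ s t, ∫ x, (x s * x s - 1) * (x t * x t - 1) ∂ρ =
      ∫ x, x s * x s * (x t * x t) ∂ρ - 1 := fun s t => by
    have e1 : ∀ x : Fin d → ℝ, (x s * x s - 1) * (x t * x t - 1) =
        x s * x s * (x t * x t) - x s * x s - x t * x t + 1 := fun x => by ring
    simp only [e1]
    have i4 := hρ.integrable_coord_four s s t t
    have i5 : Integrable (fun x : Fin d → ℝ => x s * x s * (x t * x t) - x s * x s) ρ :=
      i4.sub (i2 s)
    have i6 : Integrable (fun x : Fin d → ℝ => x s * x s * (x t * x t) - x s * x s - x t * x t) ρ :=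
      i5.sub (i2 t)
    rw [integral_add i6 (integrable_const _), integral_sub i5 (i2 t), integral_sub i4 (i2 s),
      hρ.cov, hρ.cov]
    simp
  simp only [h1]
  rw [integral_finsetSum _ fun s _ => integrable_finsetSum _ fun t _ => iA s t, Finset.mul_sum]
  refine Finset.sum_le_sum fun s hs => ?_
  rw [integral_finsetSum _ fun t _ => iA s t,
    Finset.sum_eq_single_of_mem s hs fun t _ hne => ?_]
  · rw [integral_const_mul, hval, mul_comm K, ← sq]
    refine mul_le_mul_of_nonneg_left ?_ (sq_nonneg _)
    have := hρ.integral_sq_sq_le s s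
    simp only [sq] at this
    linarith
  · rw [integral_const_mul, hval]
    have := hρ.sq_sq s t hne.symm
    simp only [sq] at this
    rw [this]
    ring

end SpheredMoments

namespace UncorrelatedWith

variable {S : Finset (Fin d)} {ψ φ : (Fin d → ℝ) → ℝ}

lemma memLp_mul_coord (hρ : SpheredMoments ρ K) (hψ : UncorrelatedWith ρ K S ψ) (s : Fin d) :
    MemLp (fun z => ψ z * z s) 2 ρ := MemLp.mul (hρ.memLp s) hψ.memLp

lemma integral_mul_diagKernel [IsProbabilityMeasure ρ] (hρ : SpheredMoments ρ K) (hψ : UncorrelatedWith ρ K S ψ)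
    (a x : Fin d → ℝ) : ∫ y, ψ y * diagKernel S a x y ∂ρ = 0 := by
  have h1 : ∀ y, ψ y * diagKernel S a x y = ∑ s ∈ S, a s * x s * (ψ y * y s) := fun y => by
    rw [diagKernel, Finset.mul_sum]
    exact Finset.sum_congr rfl fun _ _ => by ring
  simp only [h1]
  rw [integral_finsetSum _ fun s _ => (((hψ.memLp_mul_coord hρ s).integrable
    one_le_two).const_mul _)]
  refine Finset.sum_eq_zero fun s hs => ?_
  rw [integral_const_mul, hψ.mean s hs, mul_zero]

/-- Integrating out a shared variable composes two kernels, and diagonal kernels compose by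
multiplying weights. A factor ψ² changes nothing, by the second-order condition in
`UncorrelatedWith`. -/
lemma integral_sq_mul_diagKernel_mul_diagKernel (hρ : SpheredMoments ρ K)
    (hψ : UncorrelatedWith ρ K S ψ) (a b x x' : Fin d → ℝ) :
    ∫ y, ψ y ^ 2 * (diagKernel S a x y * diagKernel S b x' y) ∂ρ =
      diagKernel S (fun s => a s * b s) x x' := by
  have h1 : ∀ y, ψ y ^ 2 * (diagKernel S a x y * diagKernel S b x' y) =
      ∑ s ∈ S, ∑ t ∈ S, a s * x s * (b t * x' t) * (ψ y ^ 2 * (y s * y t)) := fun y => by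
    rw [diagKernel, diagKernel, Finset.sum_mul_sum, Finset.mul_sum]
    refine Finset.sum_congr rfl fun s _ => ?_
    rw [Finset.mul_sum]
    exact Finset.sum_congr rfl fun _ _ => by ring
  have iA : ∀ s t, Integrable (fun y => a s * x s * (b t * x' t) * (ψ y ^ 2 * (y s * y t))) ρ :=
    fun s t => by
      refine Integrable.const_mul ?_ _
      simpa only [sq] using integrable_four hψ.memLp hψ.memLp (hρ.memLp s) (hρ.memLp t)
  simp only [h1]
  rw [integral_finsetSum _ fun s _ => integrable_finsetSum _ fun t _ => iA s t, diagKernel]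
  refine Finset.sum_congr rfl fun s hs => ?_
  rw [integral_finsetSum _ fun t _ => iA s t,
    Finset.sum_eq_single_of_mem s hs fun t ht hne => ?_]
  · rw [integral_const_mul, hψ.cov s hs s hs, if_pos rfl]; ring
  · rw [integral_const_mul, hψ.cov s hs t ht, if_neg hne.symm, mul_zero]

lemma integral_sq_mul_diagKernel_self (hρ : SpheredMoments ρ K)
    (hψ : UncorrelatedWith ρ K S ψ) (a : Fin d → ℝ) :
    ∫ y, ψ y ^ 2 * diagKernel S a y y ∂ρ = ∑ s ∈ S, a s := by
  have h1 : ∀ y, ψ y ^ 2 * diagKernel S a y y = ∑ s ∈ S, a s * (ψ y ^ 2 * (y s * y s)) :=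
    fun y => by
      rw [diagKernel, Finset.mul_sum]
      exact Finset.sum_congr rfl fun _ _ => by ring
  have iA : ∀ s, Integrable (fun y => a s * (ψ y ^ 2 * (y s * y s))) ρ :=
    fun s => by
      refine Integrable.const_mul ?_ _
      simpa only [sq] using integrable_four hψ.memLp hψ.memLp (hρ.memLp s) (hρ.memLp s)
  simp only [h1]
  rw [integral_finsetSum _ fun s _ => iA s]
  refine Finset.sum_congr rfl fun s hs => ?_
  rw [integral_const_mul, hψ.cov s hs s hs, if_pos rfl, mul_one]

lemma integral_sq_mul_sq_le (hψ : UncorrelatedWith ρ K S ψ) (hφ : UncorrelatedWith ρ K S φ) :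
    Integrable (fun z => ψ z ^ 2 * φ z ^ 2) ρ ∧ ∫ z, ψ z ^ 2 * φ z ^ 2 ∂ρ ≤ K := by
  have i1 : Integrable (fun z => ψ z ^ 2 * φ z ^ 2) ρ := by
    simpa only [sq] using integrable_four hψ.memLp hψ.memLp hφ.memLp hφ.memLp
  have i2 : Integrable (fun z => ψ z ^ 4) ρ := by
    have := integrable_four hψ.memLp hψ.memLp hψ.memLp hψ.memLp
    refine this.congr (Eventually.of_forall fun z => by simp only; ring)
  have i3 : Integrable (fun z => φ z ^ 4) ρ := by
    have := integrable_four hφ.memLp hφ.memLp hφ.memLp hφ.memLp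
    refine this.congr (Eventually.of_forall fun z => by simp only; ring)
  refine ⟨i1, ?_⟩
  calc _ ≤ ∫ z, (1 / 2 * ψ z ^ 4 + 1 / 2 * φ z ^ 4) ∂ρ := by
        refine integral_mono i1 ((i2.const_mul _).add (i3.const_mul _)) fun z => ?_
        simp only
        nlinarith [sq_nonneg (ψ z ^ 2 - φ z ^ 2)]
    _ = 1 / 2 * ∫ z, ψ z ^ 4 ∂ρ + 1 / 2 * ∫ z, φ z ^ 4 ∂ρ := by
        rw [integral_add (i2.const_mul _) (i3.const_mul _), integral_const_mul,
          integral_const_mul]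
    _ ≤ K := by linarith [hψ.fourth, hφ.fourth]

end UncorrelatedWith

end KernelMoments

/-! ### Moments of the off-diagonal kernel matrix. -/

section SampleMoments

variable {d n : ℕ} {ρ : Measure (Fin d → ℝ)} [IsProbabilityMeasure ρ] {K : ℝ}

/-- The off-diagonal kernel matrix of a sample. -/
def offKernel (S : Finset (Fin d)) (a : Fin d → ℝ) (z : Fin n → Fin d → ℝ) (i j : Fin n) : ℝ :=
  if i = j then 0 else diagKernel S a (z i) (z j)

lemma offKernel_comm (S : Finset (Fin d)) (a : Fin d → ℝ) (z : Fin n → Fin d → ℝ) (i j : Fin n) :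
    offKernel S a z i j = offKernel S a z j i := by
  simp only [offKernel, eq_comm (a := i), diagKernel_comm S a (z i)]

variable {S : Finset (Fin d)} {a : Fin d → ℝ} {ψ φ : (Fin d → ℝ) → ℝ}

lemma memLp_mul_offKernel_mul (hρ : SpheredMoments ρ K) (hψ : UncorrelatedWith ρ K S ψ)
    (hφ : UncorrelatedWith ρ K S φ) (i j : Fin n) :
    MemLp (fun z : Fin n → Fin d → ℝ => ψ (z i) * offKernel S a z i j * φ (z j)) 2
      (Measure.pi fun _ => ρ) := by
  by_cases hij : i = j
  · simp only [offKernel, if_pos hij, mul_zero, zero_mul]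
    exact memLp_const 0
  have h1 : ∀ z : Fin n → Fin d → ℝ, ψ (z i) * offKernel S a z i j * φ (z j) =
      ∑ s ∈ S, a s * ((ψ (z i) * z i s) * (φ (z j) * z j s)) := fun z => by
    rw [offKernel, if_neg hij, diagKernel, Finset.mul_sum, Finset.sum_mul]
    exact Finset.sum_congr rfl fun _ _ => by ring
  simp only [h1]
  exact memLp_finsetSum _ fun s _ => (memLp_pi_mul (by simp) (by simp)
    (hψ.memLp_mul_coord hρ s) (hφ.memLp_mul_coord hρ s) hij).const_mul (a s)

lemma memLp_offKernel (hρ : SpheredMoments ρ K) (i j : Fin n) :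
    MemLp (fun z : Fin n → Fin d → ℝ => offKernel S a z i j) 4 (Measure.pi fun _ => ρ) := by
  by_cases hij : i = j
  · simp only [offKernel, if_pos hij]
    exact memLp_const 0
  simp only [offKernel, if_neg hij, diagKernel]
  exact memLp_finsetSum _ fun s _ => (memLp_pi_mul (by simp) (by simp)
    (hρ.memLp s) (hρ.memLp s) hij).const_mul (a s)

lemma integral_sq_mul_offKernel_mul_le (hρ : SpheredMoments ρ K) (hψ : UncorrelatedWith ρ K S ψ)
    (hφ : UncorrelatedWith ρ K S φ) (i j : Fin n) :
    ∫ z : Fin n → Fin d → ℝ, (ψ (z i) * offKernel S a z i j * φ (z j)) ^ 2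
      ∂(Measure.pi fun _ => ρ) ≤ ∑ s ∈ S, a s ^ 2 := by
  have hint : Integrable (fun z : Fin n → Fin d → ℝ =>
      (ψ (z i) * offKernel S a z i j * φ (z j)) ^ 2) (Measure.pi fun _ => ρ) :=
    (memLp_mul_offKernel_mul hρ hψ hφ i j).integrable_sq
  by_cases hij : i = j
  · simp only [offKernel, if_pos hij]
    simpa using Finset.sum_nonneg fun s (_ : s ∈ S) => sq_nonneg (a s)
  rw [integral_pi_eq_integral_update hint j]
  have h1 : ∀ z : Fin n → Fin d → ℝ, ∫ y, (ψ (Function.update z j y i) *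
      offKernel S a (Function.update z j y) i j * φ (Function.update z j y j)) ^ 2 ∂ρ =
      ψ (z i) ^ 2 * diagKernel S (fun s => a s * a s) (z i) (z i) := fun z => by
    rw [← hφ.integral_sq_mul_diagKernel_mul_diagKernel hρ, ← integral_const_mul]
    refine integral_congr_ae (Eventually.of_forall fun y => ?_)
    simp only [offKernel, if_neg hij, Function.update_self, Function.update_of_ne hij]
    ring
  simp only [h1]
  have hm : AEStronglyMeasurable
      (fun x => ψ x ^ 2 * diagKernel S (fun s => a s * a s) x x) ρ :=
    (hψ.memLp.1.pow 2).mul (hρ.memLp_diagKernel_self S _).1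
  rw [integral_pi_eval hm i, hψ.integral_sq_mul_diagKernel_self hρ]
  simp only [sq, le_refl]

/-- An observation that occurs in one kernel only integrates to zero. The other factors are constant
in it, so `f` is arbitrary. -/
lemma integral_mul_offKernel_cross_eq_zero (hρ : SpheredMoments ρ K)
    (hφ : UncorrelatedWith ρ K S φ) {i j k l : Fin n} (hli : l ≠ i) (hlj : l ≠ j) (hlk : l ≠ k)
    (f : (Fin d → ℝ) → (Fin d → ℝ) → (Fin d → ℝ) → ℝ) :
    ∫ z : Fin n → Fin d → ℝ, f (z i) (z j) (z k) * (offKernel S a z k l * φ (z l))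
      ∂(Measure.pi fun _ => ρ) = 0 := by
  refine integral_pi_eq_zero l fun z => ?_
  simp only [offKernel, if_neg hlk.symm, Function.update_self, Function.update_of_ne hli.symm,
    Function.update_of_ne hlj.symm, Function.update_of_ne hlk.symm]
  rw [integral_const_mul]
  have := hφ.integral_mul_diagKernel hρ a (z k)
  simp only [mul_comm (φ _)] at this
  rw [this, mul_zero]

/-- The second moment of the off-diagonal form. -/
lemma integral_sq_sum_sum_offKernel_le (hρ : SpheredMoments ρ K)
    (hψ : UncorrelatedWith ρ K S ψ) (hφ : UncorrelatedWith ρ K S φ) :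
    Integrable (fun z : Fin n → Fin d → ℝ =>
      (∑ i, ∑ j, ψ (z i) * offKernel S a z i j * φ (z j)) ^ 2) (Measure.pi fun _ => ρ) ∧
    ∫ z : Fin n → Fin d → ℝ, (∑ i, ∑ j, ψ (z i) * offKernel S a z i j * φ (z j)) ^ 2
      ∂(Measure.pi fun _ => ρ) ≤ 2 * n ^ 2 * ∑ s ∈ S, a s ^ 2 := by
  set ξ : Fin n → Fin n → (Fin n → Fin d → ℝ) → ℝ :=
    fun i j z => ψ (z i) * offKernel S a z i j * φ (z j) with hξ
  set τ := ∑ s ∈ S, a s ^ 2 with hτ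
  have hτ0 : 0 ≤ τ := Finset.sum_nonneg fun _ _ => sq_nonneg _
  have hL2 : ∀ i j, MemLp (ξ i j) 2 (Measure.pi fun _ => ρ) := fun i j =>
    memLp_mul_offKernel_mul hρ hψ hφ i j
  have hsum : ∀ z, (∑ i, ∑ j, ξ i j z) ^ 2 = ∑ i, ∑ j, ∑ k, ∑ l, ξ i j z * ξ k l z := fun z => by
    rw [sq, Finset.sum_mul]
    refine Finset.sum_congr rfl fun i _ => ?_
    rw [Finset.sum_mul]
    refine Finset.sum_congr rfl fun j _ => ?_
    simp only [Finset.mul_sum]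
  have hint : ∀ i j k l, Integrable (fun z => ξ i j z * ξ k l z) (Measure.pi fun _ => ρ) :=
    fun i j k l => (hL2 i j).integrable_mul (hL2 k l)
  -- Two entries are correlated only if they involve the same pair of observations, in either order;
  -- this leaves two of the n² choices of (k, l).
  have hterm : ∀ i j k l, ∫ z, ξ i j z * ξ k l z ∂(Measure.pi fun _ => ρ) ≤
      (if k = i then if l = j then τ else 0 else 0) +
        if k = j then if l = i then τ else 0 else 0 := fun i j k l => by
    have hnn : ∀ (p q : Prop) [Decidable p] [Decidable q],
        0 ≤ if p then if q then τ else 0 else 0 := fun p q _ _ => by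
      split_ifs <;> first | exact hτ0 | exact le_rfl
    have hle : ∫ z, ξ i j z * ξ k l z ∂(Measure.pi fun _ => ρ) ≤ τ := by
      calc _ ≤ ∫ z, (1 / 2 * ξ i j z ^ 2 + 1 / 2 * ξ k l z ^ 2) ∂(Measure.pi fun _ => ρ) := by
            refine integral_mono (hint i j k l) (((hL2 i j).integrable_sq.const_mul _).add
              ((hL2 k l).integrable_sq.const_mul _)) fun z => ?_
            simp only
            nlinarith [sq_nonneg (ξ i j z - ξ k l z)]
        _ = 1 / 2 * ∫ z, ξ i j z ^ 2 ∂(Measure.pi fun _ => ρ) +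
            1 / 2 * ∫ z, ξ k l z ^ 2 ∂(Measure.pi fun _ => ρ) := by
            rw [integral_add ((hL2 i j).integrable_sq.const_mul _)
              ((hL2 k l).integrable_sq.const_mul _), integral_const_mul, integral_const_mul]
        _ ≤ τ := by
            have h1 := integral_sq_mul_offKernel_mul_le (a := a) hρ hψ hφ i j
            have h2 := integral_sq_mul_offKernel_mul_le (a := a) hρ hψ hφ k l
            linarith
    have hzero : (∫ z, ξ i j z * ξ k l z ∂(Measure.pi fun _ => ρ) = 0) →
        ∫ z, ξ i j z * ξ k l z ∂(Measure.pi fun _ => ρ) ≤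
        (if k = i then if l = j then τ else 0 else 0) +
        if k = j then if l = i then τ else 0 else 0 := fun h => by
      rw [h]; exact add_nonneg (hnn _ _) (hnn _ _)
    by_cases hij : i = j
    · refine hzero ?_
      simp [hξ, offKernel, hij]
    by_cases hkl : k = l
    · refine hzero ?_
      simp [hξ, offKernel, hkl]
    by_cases h1 : k = i ∧ l = j
    · rw [if_pos h1.1, if_pos h1.2]
      exact hle.trans (le_add_of_nonneg_right (hnn _ _))
    by_cases h2 : k = j ∧ l = i
    · rw [if_pos h2.1, if_pos h2.2]
      exact hle.trans (le_add_of_nonneg_left (hnn _ _))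
    refine hzero ?_
    -- The isolated observation is k if l is one of i, j, and l otherwise.
    by_cases hl : l = i ∨ l = j
    · have hki : k ≠ i := fun h => by
        rcases hl with hl | hl
        · exact hkl (h.trans hl.symm)
        · exact h1 ⟨h, hl⟩
      have hkj : k ≠ j := fun h => by
        rcases hl with hl | hl
        · exact h2 ⟨h, hl⟩
        · exact hkl (h.trans hl.symm)
      rw [← integral_mul_offKernel_cross_eq_zero (a := a) hρ hψ hki hkj hkl
        fun x y w => ψ x * (if i = j then 0 else diagKernel S a x y) * φ y * φ w]
      refine integral_congr_ae (Eventually.of_forall fun z => ?_)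
      simp only [hξ]
      rw [offKernel_comm S a z k l]
      simp only [offKernel]
      ring
    · push Not at hl
      rw [← integral_mul_offKernel_cross_eq_zero (a := a) hρ hφ hl.1 hl.2 (Ne.symm hkl)
        fun x y w => ψ x * (if i = j then 0 else diagKernel S a x y) * φ y * ψ w]
      refine integral_congr_ae (Eventually.of_forall fun z => ?_)
      simp only [hξ, offKernel]
      ring
  have i1 := fun i j k => integrable_finsetSum Finset.univ fun l _ => hint i j k l
  have i2 := fun i j => integrable_finsetSum Finset.univ fun k _ => i1 i j k
  have i3 := fun i => integrable_finsetSum Finset.univ fun j _ => i2 i j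
  change Integrable (fun z => (∑ i, ∑ j, ξ i j z) ^ 2) _ ∧ ∫ z, (∑ i, ∑ j, ξ i j z) ^ 2 ∂_ ≤ _
  simp only [hsum]
  refine ⟨integrable_finsetSum _ fun i _ => i3 i, ?_⟩
  rw [integral_finsetSum _ fun i _ => i3 i]
  have hrow : ∀ i j, ∫ z, ∑ k, ∑ l, ξ i j z * ξ k l z ∂(Measure.pi fun _ => ρ) ≤ 2 * τ :=
    fun i j => by
      rw [integral_finsetSum _ fun k _ => i1 i j k]
      calc _ ≤ ∑ k, ∑ l, ((if k = i then if l = j then τ else 0 else 0) +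
            if k = j then if l = i then τ else 0 else 0) := by
            refine Finset.sum_le_sum fun k _ => ?_
            rw [integral_finsetSum _ fun l _ => hint i j k l]
            exact Finset.sum_le_sum fun l _ => hterm i j k l
        _ = 2 * τ := by
            have h2 : ∀ x y : Fin n, ∑ u, ∑ v, (if u = x then if v = y then τ else 0 else 0) = τ :=
              fun x y => by
                rw [Finset.sum_eq_single_of_mem x (Finset.mem_univ _) fun u _ hne => by simp [hne]]
                simp
            simp only [Finset.sum_add_distrib]
            rw [h2 i j, h2 j i]
            ring
  calc _ ≤ ∑ i : Fin n, ∑ j : Fin n, 2 * τ := by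
        refine Finset.sum_le_sum fun i _ => ?_
        rw [integral_finsetSum _ fun j _ => i2 i j]
        exact Finset.sum_le_sum fun j _ => hrow i j
    _ = _ := by simp; ring

/-- The mean squared norm of the image under the off-diagonal kernel matrix. -/
lemma integral_sum_sq_sum_offKernel_le (hρ : SpheredMoments ρ K)
    (hφ : UncorrelatedWith ρ K S φ) :
    Integrable (fun z : Fin n → Fin d → ℝ =>
      ∑ i, (∑ j, offKernel S a z i j * φ (z j)) ^ 2) (Measure.pi fun _ => ρ) ∧
    ∫ z : Fin n → Fin d → ℝ, ∑ i, (∑ j, offKernel S a z i j * φ (z j)) ^ 2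
      ∂(Measure.pi fun _ => ρ) ≤ n ^ 2 * ∑ s ∈ S, a s ^ 2 := by
  set ξ : Fin n → Fin n → (Fin n → Fin d → ℝ) → ℝ :=
    fun i j z => offKernel S a z i j * φ (z j) with hξ
  set τ := ∑ s ∈ S, a s ^ 2 with hτ
  have hL2 : ∀ i j, MemLp (ξ i j) 2 (Measure.pi fun _ => ρ) := fun i j => by
    simpa using memLp_mul_offKernel_mul (a := a) hρ (hρ.uncorrelatedWith_one S) hφ i j
  have hsum : ∀ i z, (∑ j, ξ i j z) ^ 2 = ∑ j, ∑ l, ξ i j z * ξ i l z := fun i z => by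
    rw [sq, Finset.sum_mul_sum]
  have hint : ∀ i j l, Integrable (fun z => ξ i j z * ξ i l z) (Measure.pi fun _ => ρ) :=
    fun i j l => (hL2 i j).integrable_mul (hL2 i l)
  have hterm : ∀ i j l, ∫ z, ξ i j z * ξ i l z ∂(Measure.pi fun _ => ρ) ≤
      if j = l then τ else 0 := fun i j l => by
    split_ifs with h
    · subst h
      have := integral_sq_mul_offKernel_mul_le (a := a) hρ (hρ.uncorrelatedWith_one S) hφ i j
      simpa only [one_mul, sq, hξ, hτ] using this
    · refine le_of_eq ?_
      by_cases hil : i = l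
      · simp [hξ, offKernel, hil]
      rw [← integral_mul_offKernel_cross_eq_zero (a := a) hρ hφ (Ne.symm hil) (Ne.symm h)
        (Ne.symm hil) fun x y w => (if i = j then 0 else diagKernel S a x y) * φ y]
      refine integral_congr_ae (Eventually.of_forall fun z => ?_)
      simp only [hξ, offKernel]
  have i1 := fun i j => integrable_finsetSum Finset.univ fun l _ => hint i j l
  have i2 := fun i => integrable_finsetSum Finset.univ fun j _ => i1 i j
  change Integrable (fun z => ∑ i, (∑ j, ξ i j z) ^ 2) _ ∧ ∫ z, ∑ i, (∑ j, ξ i j z) ^ 2 ∂_ ≤ _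
  simp only [hsum]
  refine ⟨integrable_finsetSum _ fun i _ => i2 i, ?_⟩
  rw [integral_finsetSum _ fun i _ => i2 i]
  calc _ ≤ ∑ i : Fin n, ∑ j : Fin n, ∑ l, if j = l then τ else 0 := by
        refine Finset.sum_le_sum fun i _ => ?_
        rw [integral_finsetSum _ fun j _ => i1 i j]
        refine Finset.sum_le_sum fun j _ => ?_
        rw [integral_finsetSum _ fun l _ => hint i j l]
        exact Finset.sum_le_sum fun l _ => hterm i j l
    _ = _ := by simp; ring

/-- Given z_i the kernel is a linear form in z_j, with fourth moment at most (2K + 4) times the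
square of a quadratic form in z_i; averaging that square costs a further factor K. -/
lemma integral_offKernel_pow_four_le (hρ : SpheredMoments ρ K) (i j : Fin n) :
    ∫ z : Fin n → Fin d → ℝ, offKernel S a z i j ^ 4 ∂(Measure.pi fun _ => ρ) ≤
      (2 * K + 4) * K * (∑ s ∈ S, a s ^ 2) ^ 2 := by
  have hK : 0 ≤ K := zero_le_one.trans hρ.one_le
  by_cases hij : i = j
  · simp only [offKernel, if_pos hij]
    simp only [ne_eq, OfNat.ofNat_ne_zero, not_false_eq_true, zero_pow, integral_zero]
    positivity
  have hint : Integrable (fun z : Fin n → Fin d → ℝ => offKernel S a z i j ^ 4)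
      (Measure.pi fun _ => ρ) := by
    have h := memLp_offKernel (S := S) (a := a) hρ i j
    exact (integrable_four h h h h).congr (Eventually.of_forall fun z => by simp only; ring)
  have hsq := (hρ.memLp_diagKernel_self S fun s => a s ^ 2).integrable_sq
  refine (integral_pi_le_of_update (G := fun z => (2 * K + 4) *
    diagKernel S (fun s => a s ^ 2) (z i) (z i) ^ 2) hint
    ((memLp_pi_eval (hρ.memLp_diagKernel_self S fun s => a s ^ 2) i).integrable_sq.const_mul _) j
    fun z => ?_).trans ?_
  · simp only [offKernel, if_neg hij, Function.update_self, Function.update_of_ne hij]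
    exact hρ.integral_diagKernel_pow_four_le S a (z i)
  · rw [integral_const_mul, integral_pi_eval hsq.1, mul_assoc]
    exact mul_le_mul_of_nonneg_left (hρ.integral_diagKernel_self_sq_le S fun s => sq_nonneg _)
      (by positivity)

lemma integral_diagKernel_mul_diagKernel (hρ : SpheredMoments ρ K) (S : Finset (Fin d))
    (a b x x' : Fin d → ℝ) :
    ∫ y, diagKernel S a x y * diagKernel S b x' y ∂ρ = diagKernel S (fun s => a s * b s) x x' := by
  have := (hρ.uncorrelatedWith_one S).integral_sq_mul_diagKernel_mul_diagKernel hρ a b x x'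
  simpa using this

/-- Around a cycle of four distinct observations the vertices are integrated out one at a time. Each
integration composes two edges, so the weights multiply up to a⁴. -/
lemma integral_offKernel_cycle (hρ : SpheredMoments ρ K) {i j k l : Fin n} (hij : i ≠ j)
    (hik : i ≠ k) (hil : i ≠ l) (hjk : j ≠ k) (hjl : j ≠ l) (hkl : k ≠ l) :
    ∫ z : Fin n → Fin d → ℝ, offKernel S a z i k * offKernel S a z k j *
      (offKernel S a z i l * offKernel S a z l j) ∂(Measure.pi fun _ => ρ) =
      ∑ s ∈ S, a s ^ 4 := by
  have m : ∀ (b : Fin d → ℝ) (p q : Fin n), MemLp (fun z : Fin n → Fin d → ℝ =>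
      offKernel S b z p q) 4 (Measure.pi fun _ => ρ) := fun b p q => memLp_offKernel hρ p q
  rw [integral_pi_eq_integral_update (integrable_four (m a i k) (m a k j) (m a i l) (m a l j)) k]
  -- The factors 1 fill the free slots of `integrable_four`.
  have h1 : ∀ z : Fin n → Fin d → ℝ, ∫ y, offKernel S a (Function.update z k y) i k *
      offKernel S a (Function.update z k y) k j * (offKernel S a (Function.update z k y) i l *
      offKernel S a (Function.update z k y) l j) ∂ρ =
      offKernel S (fun s => a s * a s) z i j * 1 * (offKernel S a z i l * offKernel S a z l j) :=
    fun z => by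
      simp only [offKernel, if_neg hik, if_neg hjk.symm, if_neg hil, if_neg hjl.symm, if_neg hij,
        Function.update_self, Function.update_of_ne hik, Function.update_of_ne hjk,
        Function.update_of_ne hkl.symm]
      rw [integral_mul_const, mul_one, ← integral_diagKernel_mul_diagKernel hρ]
      simp only [diagKernel_comm S a (z j)]
  simp only [h1]
  rw [integral_pi_eq_integral_update (integrable_four (m _ i j) (memLp_const 1) (m a i l)
    (m a l j)) l]
  have h2 : ∀ z : Fin n → Fin d → ℝ, ∫ y, offKernel S (fun s => a s * a s)
      (Function.update z l y) i j * 1 * (offKernel S a (Function.update z l y) i l *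
      offKernel S a (Function.update z l y) l j) ∂ρ =
      offKernel S (fun s => a s * a s) z i j * 1 *
        (offKernel S (fun s => a s * a s) z i j * 1) :=
    fun z => by
      simp only [offKernel, if_neg hil, if_neg hjl.symm, if_neg hij,
        Function.update_self, Function.update_of_ne hil, Function.update_of_ne hjl]
      rw [integral_const_mul, mul_one]
      congr 1
      rw [← integral_diagKernel_mul_diagKernel hρ]
      simp only [diagKernel_comm S a (z j)]
  simp only [h2]
  rw [integral_pi_eq_integral_update (integrable_four (m _ i j) (memLp_const 1) (m _ i j)
    (memLp_const 1)) j]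
  have h3 : ∀ z : Fin n → Fin d → ℝ, ∫ y, offKernel S (fun s => a s * a s)
      (Function.update z j y) i j * 1 * (offKernel S (fun s => a s * a s)
        (Function.update z j y) i j * 1) ∂ρ =
      diagKernel S (fun s => a s * a s * (a s * a s)) (z i) (z i) :=
    fun z => by
      simp only [offKernel, if_neg hij, Function.update_self, Function.update_of_ne hij, mul_one]
      rw [← integral_diagKernel_mul_diagKernel hρ]
  simp only [h3]
  rw [integral_pi_eval (f := fun x => diagKernel S (fun s => a s * a s * (a s * a s)) x x)
    (hρ.memLp_diagKernel_self S _).1 i]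
  have h4 := (hρ.uncorrelatedWith_one S).integral_sq_mul_diagKernel_self hρ
    fun s => a s * a s * (a s * a s)
  simp only [one_pow, one_mul] at h4
  rw [h4]
  exact Finset.sum_congr rfl fun s _ => by ring

/-- The mean squared Frobenius norm of the square of the off-diagonal kernel matrix. -/
lemma integral_sum_sum_sq_offKernel_le (hρ : SpheredMoments ρ K) :
    Integrable (fun z : Fin n → Fin d → ℝ =>
      ∑ i, ∑ j, (∑ k, offKernel S a z i k * offKernel S a z k j) ^ 2) (Measure.pi fun _ => ρ) ∧
    ∫ z : Fin n → Fin d → ℝ, ∑ i, ∑ j, (∑ k, offKernel S a z i k * offKernel S a z k j) ^ 2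
      ∂(Measure.pi fun _ => ρ) ≤
      n ^ 4 * ∑ s ∈ S, a s ^ 4 + 2 * n ^ 3 * ((2 * K + 4) * K * (∑ s ∈ S, a s ^ 2) ^ 2) := by
  set O : Fin n → Fin n → (Fin n → Fin d → ℝ) → ℝ := fun i j z => offKernel S a z i j with hO
  set Q := ∑ s ∈ S, a s ^ 4 with hQ
  set R := (2 * K + 4) * K * (∑ s ∈ S, a s ^ 2) ^ 2 with hR
  have hK : 0 ≤ K := zero_le_one.trans hρ.one_le
  have hQ0 : 0 ≤ Q := Finset.sum_nonneg fun _ _ => by positivity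
  have hR0 : 0 ≤ R := by positivity
  have hL4 : ∀ i j, MemLp (O i j) 4 (Measure.pi fun _ => ρ) := fun i j => memLp_offKernel hρ i j
  have hsum : ∀ i j z, (∑ k, O i k z * O k j z) ^ 2 =
      ∑ k, ∑ l, O i k z * O k j z * (O i l z * O l j z) := fun i j z => by
    rw [sq, Finset.sum_mul_sum]
  have hint : ∀ i j k l, Integrable (fun z => O i k z * O k j z * (O i l z * O l j z))
      (Measure.pi fun _ => ρ) := fun i j k l =>
    integrable_four (hL4 i k) (hL4 k j) (hL4 i l) (hL4 l j)
  have hcomm : ∀ i j z, O i j z = O j i z := fun i j z => offKernel_comm S a z i j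
  have hsame : ∀ i, ∀ z, O i i z = 0 := fun i z => if_pos rfl
  have hpair : ∀ p q p' q' : Fin n, ∫ z, O p q z ^ 2 * O p' q' z ^ 2 ∂(Measure.pi fun _ => ρ) ≤ R :=
    fun p q p' q' => by
      have j4 : ∀ p q, Integrable (fun z => O p q z ^ 4) (Measure.pi fun _ => ρ) := fun p q =>
        (integrable_four (hL4 p q) (hL4 p q) (hL4 p q) (hL4 p q)).congr
          (Eventually.of_forall fun z => by simp only; ring)
      have j2 : Integrable (fun z => O p q z ^ 2 * O p' q' z ^ 2) (Measure.pi fun _ => ρ) :=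
        (integrable_four (hL4 p q) (hL4 p q) (hL4 p' q') (hL4 p' q')).congr
          (Eventually.of_forall fun z => by simp only; ring)
      calc _ ≤ ∫ z, (1 / 2 * O p q z ^ 4 + 1 / 2 * O p' q' z ^ 4) ∂(Measure.pi fun _ => ρ) := by
            refine integral_mono j2 (((j4 p q).const_mul _).add ((j4 p' q').const_mul _))
              fun z => ?_
            simp only
            nlinarith [sq_nonneg (O p q z ^ 2 - O p' q' z ^ 2)]
        _ = 1 / 2 * ∫ z, O p q z ^ 4 ∂(Measure.pi fun _ => ρ) +
            1 / 2 * ∫ z, O p' q' z ^ 4 ∂(Measure.pi fun _ => ρ) := by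
            rw [integral_add ((j4 p q).const_mul _) ((j4 p' q').const_mul _), integral_const_mul,
              integral_const_mul]
        _ ≤ R := by
            have h1 := integral_offKernel_pow_four_le (S := S) (a := a) hρ p q
            have h2 := integral_offKernel_pow_four_le (S := S) (a := a) hρ p' q'
            linarith
  -- Generic cycles give Q. If two opposite vertices coincide, only the cruder R is available, but
  -- this happens for 2n³ index choices at most. Coinciding neighbours contribute nothing, as the
  -- diagonal of O is zero.
  have hterm : ∀ i j k l, ∫ z, O i k z * O k j z * (O i l z * O l j z) ∂(Measure.pi fun _ => ρ) ≤
      Q + ((if i = j then R else 0) + if k = l then R else 0) := fun i j k l => by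
    have hnn : ∀ (p : Prop) [Decidable p], 0 ≤ if p then R else 0 := fun p _ => by
      split_ifs <;> first | exact hR0 | exact le_rfl
    by_cases h0 : i = k ∨ k = j ∨ i = l ∨ l = j
    · have : ∀ z, O i k z * O k j z * (O i l z * O l j z) = 0 := fun z => by
        rcases h0 with h | h | h | h <;> · subst h; simp [hsame]
      simp only [this, integral_zero]
      exact add_nonneg hQ0 (add_nonneg (hnn _) (hnn _))
    push Not at h0
    by_cases hij : i = j
    · subst hij
      have : ∀ z, O i k z * O k i z * (O i l z * O l i z) = O i k z ^ 2 * O i l z ^ 2 := fun z => by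
        rw [hcomm k i, hcomm l i]; ring
      simp only [this, if_true]
      have h1 := hpair i k i l
      have h2 := hnn (k = l)
      linarith
    by_cases hkl : k = l
    · subst hkl
      have : ∀ z, O i k z * O k j z * (O i k z * O k j z) = O i k z ^ 2 * O k j z ^ 2 := fun z => by
        ring
      simp only [this, if_true, if_neg hij]
      have h1 := hpair i k k j
      linarith
    rw [if_neg hij, if_neg hkl, add_zero, add_zero]
    exact (integral_offKernel_cycle hρ hij h0.1 h0.2.2.1 (Ne.symm h0.2.1) (Ne.symm h0.2.2.2)
      hkl).le
  have i1 := fun i j k => integrable_finsetSum Finset.univ fun l _ => hint i j k l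
  have i2 := fun i j => integrable_finsetSum Finset.univ fun k _ => i1 i j k
  have i3 := fun i => integrable_finsetSum Finset.univ fun j _ => i2 i j
  change Integrable (fun z => ∑ i, ∑ j, (∑ k, O i k z * O k j z) ^ 2) _ ∧
    ∫ z, ∑ i, ∑ j, (∑ k, O i k z * O k j z) ^ 2 ∂_ ≤ _
  simp only [hsum]
  refine ⟨integrable_finsetSum _ fun i _ => i3 i, ?_⟩
  rw [integral_finsetSum _ fun i _ => i3 i]
  calc _ ≤ ∑ i : Fin n, ∑ j : Fin n, ∑ k : Fin n, ∑ l : Fin n,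
          (Q + ((if i = j then R else 0) + if k = l then R else 0)) := by
        refine Finset.sum_le_sum fun i _ => ?_
        rw [integral_finsetSum _ fun j _ => i2 i j]
        refine Finset.sum_le_sum fun j _ => ?_
        rw [integral_finsetSum _ fun k _ => i1 i j k]
        refine Finset.sum_le_sum fun k _ => ?_
        rw [integral_finsetSum _ fun l _ => hint i j k l]
        exact Finset.sum_le_sum fun l _ => hterm i j k l
    _ = _ := by
        simp only [Finset.sum_add_distrib, Finset.sum_const, Finset.card_univ, Fintype.card_fin,
          nsmul_eq_mul, Finset.sum_ite_eq, Finset.mem_univ, if_true, ← Finset.mul_sum]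
        ring

end SampleMoments

/-! ### Typical samples have high probability. -/

lemma measure_lt_le_ofReal {Ω : Type*} [MeasurableSpace Ω] {μ : Measure Ω} [IsFiniteMeasure μ]
    {f : Ω → ℝ} (hf : Integrable f μ) (h0 : ∀ ω, 0 ≤ f ω) {b t r : ℝ} (ht : 0 < t)
    (hb : ∫ ω, f ω ∂μ ≤ b) (hr : b ≤ r * t) : μ {ω | t < f ω} ≤ ENNReal.ofReal r := by
  have h1 := mul_meas_ge_le_integral_of_nonneg (Eventually.of_forall h0) hf t
  have h2 : μ.real {ω | t ≤ f ω} ≤ r := by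
    refine le_of_mul_le_mul_left ?_ ht
    linarith
  have h3 : μ {ω | t < f ω} ≤ μ {ω | t ≤ f ω} := measure_mono fun ω (hω : t < f ω) => hω.le
  refine h3.trans ?_
  rw [← ofReal_measureReal]
  exact ENNReal.ofReal_le_ofReal h2

namespace Population

variable {d n : ℕ} (M : Population d) {m : ℕ} {K : ℝ}

instance : IsProbabilityMeasure M.law := M.law_prob

/-- The constant function and the spiked coordinates. -/
def spikeFun (d m : ℕ) : Option {t : Fin d // t.val < m} → (Fin d → ℝ) → ℝ
  | none => fun _ => 1
  | some t => fun z => z t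

lemma spikeVec_apply (z : Fin n → Fin d → ℝ) (a : Option {t : Fin d // t.val < m}) (i : Fin n) :
    spikeVec m z a i = spikeFun d m a (z i) := by
  cases a <;> rfl

/-- The indices of the noise coordinates. -/
abbrev noiseSet (d m : ℕ) : Finset (Fin d) := Finset.univ.filter fun s => m ≤ s.val

lemma uncorrelatedWith_spikeFun (hρ : SpheredMoments M.law K)
    (a : Option {t : Fin d // t.val < m}) :
    UncorrelatedWith M.law K (noiseSet d m) (spikeFun d m a) := by
  cases a with
  | none => exact hρ.uncorrelatedWith_one _
  | some t => exact hρ.uncorrelatedWith_coord (by simp [t.2])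

lemma integral_spikeFun_mul (hρ : SpheredMoments M.law K)
    (a b : Option {t : Fin d // t.val < m}) :
    ∫ z, spikeFun d m a z * spikeFun d m b z ∂M.law = if a = b then 1 else 0 := by
  cases a with
  | none => cases b with
    | none => simp [spikeFun]
    | some t => simpa [spikeFun] using hρ.mean t
  | some s => cases b with
    | none => simpa [spikeFun] using hρ.mean s
    | some t => simp [spikeFun, hρ.cov, Subtype.ext_iff]

lemma noiseOff_apply (z : Fin n → Fin d → ℝ) (i j : Fin n) :
    M.noiseOff m z i j = ((n : ℝ) - 1)⁻¹ * offKernel (noiseSet d m) M.eigval z i j := by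
  simp only [noiseOff, offKernel, Matrix.of_apply]
  split_ifs
  · rw [mul_zero]
  · rfl

section Events

variable {c : ℝ} {L C : ℝ}

lemma integral_sq_spikeFun_mul_sub_le (hρ : SpheredMoments M.law K)
    (a b : Option {t : Fin d // t.val < m}) :
    MemLp (fun z => spikeFun d m a z * spikeFun d m b z - if a = b then 1 else 0) 2 M.law ∧
      ∫ z, (spikeFun d m a z * spikeFun d m b z - if a = b then 1 else 0) ∂M.law = 0 ∧
      ∫ z, (spikeFun d m a z * spikeFun d m b z - if a = b then 1 else 0) ^ 2 ∂M.law ≤ K := by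
  have ha := M.uncorrelatedWith_spikeFun hρ a
  have hb := M.uncorrelatedWith_spikeFun hρ b
  have h1 : MemLp (fun z => spikeFun d m a z * spikeFun d m b z) 2 M.law := MemLp.mul hb.memLp ha.memLp
  have h2 := h1.integrable one_le_two
  refine ⟨h1.sub (memLp_const _), ?_, ?_⟩
  · rw [integral_sub h2 (integrable_const _), M.integral_spikeFun_mul hρ]
    simp
  · set ε : ℝ := if a = b then 1 else 0 with hε
    have e1 : ∀ z, (spikeFun d m a z * spikeFun d m b z - ε) ^ 2 =
        spikeFun d m a z ^ 2 * spikeFun d m b z ^ 2 -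
          2 * ε * (spikeFun d m a z * spikeFun d m b z) + ε ^ 2 := fun z => by ring
    obtain ⟨i1, i2⟩ := ha.integral_sq_mul_sq_le hb
    have i3 : Integrable (fun z => spikeFun d m a z ^ 2 * spikeFun d m b z ^ 2 -
        2 * ε * (spikeFun d m a z * spikeFun d m b z)) M.law := i1.sub (h2.const_mul _)
    simp only [e1]
    rw [integral_add i3 (integrable_const _), integral_sub i1 (h2.const_mul _),
      integral_const_mul, M.integral_spikeFun_mul hρ, ← hε]
    simp only [integral_const, probReal_univ, smul_eq_mul, one_mul]
    nlinarith [sq_nonneg ε]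

lemma sq_div_le_four (hn : 2 ≤ n) : ((n : ℝ) - 1)⁻¹ ^ 2 * n ^ 2 ≤ 4 := by
  have hn2 : (2 : ℝ) ≤ n := by exact_mod_cast hn
  have h0 : (0 : ℝ) < (n : ℝ) - 1 := by linarith
  rw [inv_pow, inv_mul_le_iff₀ (by positivity)]
  nlinarith

/-- The second moment is at most nK. The looser bound 8Kc/C² is shared by all events with threshold
C, so that the union bound only has to count them. -/
lemma measure_gram_le (hρ : SpheredMoments M.law K) (hc : 1 ≤ c) (hn : 2 ≤ n)
    (hC : 1 ≤ C) (a b : Option {t : Fin d // t.val < m}) :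
    Measure.pi (fun _ : Fin n => M.law) {z | C ^ 2 * n < (∑ i, (spikeFun d m a (z i) *
      spikeFun d m b (z i) - if a = b then 1 else 0)) ^ 2} ≤
      ENNReal.ofReal (8 * K * c / C ^ 2) := by
  obtain ⟨h1, h2, h3⟩ := M.integral_sq_spikeFun_mul_sub_le hρ a b
  obtain ⟨i1, i2⟩ := integral_sq_sum_pi (ι := Fin n) h1 h2
  have hn0 : (0 : ℝ) < n := by positivity
  have hK := hρ.one_le
  refine measure_lt_le_ofReal i1 (fun z => sq_nonneg _) (by positivity) i2.le ?_
  rw [Fintype.card_fin]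
  have : 8 * K * c / C ^ 2 * (C ^ 2 * n) = n * (8 * K * c) := by field_simp
  rw [this]
  exact mul_le_mul_of_nonneg_left (by nlinarith) hn0.le

lemma measure_off_le (hρ : SpheredMoments M.law K) (hc : 1 ≤ c) (hn : 2 ≤ n)
    (hC : 1 ≤ C) (hL : 0 < L) (hτ : ∑ s ∈ noiseSet d m, M.eigval s ^ 2 ≤ c * L ^ 2)
    (a : Option {t : Fin d // t.val < m}) :
    Measure.pi (fun _ : Fin n => M.law) {z | (C * L) ^ 2 <
      ∑ i, (∑ j, M.noiseOff m z i j * spikeFun d m a (z j)) ^ 2} ≤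
      ENNReal.ofReal (8 * K * c / C ^ 2) := by
  obtain ⟨i1, i2⟩ := integral_sum_sq_sum_offKernel_le (n := n) (a := M.eigval) hρ
    (M.uncorrelatedWith_spikeFun hρ a)
  have hK := hρ.one_le
  have e1 : ∀ z : Fin n → Fin d → ℝ, ∑ i, (∑ j, M.noiseOff m z i j * spikeFun d m a (z j)) ^ 2 =
      ((n : ℝ) - 1)⁻¹ ^ 2 *
        ∑ i, (∑ j, offKernel (noiseSet d m) M.eigval z i j * spikeFun d m a (z j)) ^ 2 := fun z => by
    simp only [noiseOff_apply, mul_assoc, ← Finset.mul_sum, mul_pow]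
  simp only [e1]
  refine measure_lt_le_ofReal (i1.const_mul _) (fun z => by positivity) (by positivity)
    (b := ((n : ℝ) - 1)⁻¹ ^ 2 * (n ^ 2 * ∑ s ∈ noiseSet d m, M.eigval s ^ 2))
    (by rw [integral_const_mul]; exact mul_le_mul_of_nonneg_left i2 (sq_nonneg _)) ?_
  have e2 : 8 * K * c / C ^ 2 * (C * L) ^ 2 = 8 * K * (c * L ^ 2) := by field_simp
  rw [e2, ← mul_assoc]
  have hτ0 : 0 ≤ ∑ s ∈ noiseSet d m, M.eigval s ^ 2 := Finset.sum_nonneg fun _ _ => sq_nonneg _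
  calc _ ≤ 4 * (c * L ^ 2) := mul_le_mul (sq_div_le_four hn) hτ hτ0 (by norm_num)
    _ ≤ _ := mul_le_mul_of_nonneg_right (by linarith) (by positivity)

lemma measure_off_off_le (hρ : SpheredMoments M.law K) (hc : 1 ≤ c) (hn : 2 ≤ n)
    (hC : 1 ≤ C) (hL : 0 < L) (hτ : ∑ s ∈ noiseSet d m, M.eigval s ^ 2 ≤ c * L ^ 2)
    (a b : Option {t : Fin d // t.val < m}) :
    Measure.pi (fun _ : Fin n => M.law) {z | (C * L) ^ 2 <
      (∑ i, ∑ j, spikeFun d m a (z i) * M.noiseOff m z i j * spikeFun d m b (z j)) ^ 2} ≤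
      ENNReal.ofReal (8 * K * c / C ^ 2) := by
  obtain ⟨i1, i2⟩ := integral_sq_sum_sum_offKernel_le (n := n) (a := M.eigval) hρ
    (M.uncorrelatedWith_spikeFun hρ a) (M.uncorrelatedWith_spikeFun hρ b)
  have hK := hρ.one_le
  have e1 : ∀ z : Fin n → Fin d → ℝ,
      (∑ i, ∑ j, spikeFun d m a (z i) * M.noiseOff m z i j * spikeFun d m b (z j)) ^ 2 =
      ((n : ℝ) - 1)⁻¹ ^ 2 * (∑ i, ∑ j, spikeFun d m a (z i) *
        offKernel (noiseSet d m) M.eigval z i j * spikeFun d m b (z j)) ^ 2 := fun z => by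
    rw [← mul_pow, Finset.mul_sum]
    congr 1
    refine Finset.sum_congr rfl fun i _ => ?_
    rw [Finset.mul_sum]
    refine Finset.sum_congr rfl fun j _ => ?_
    rw [noiseOff_apply]
    ring
  simp only [e1]
  refine measure_lt_le_ofReal (i1.const_mul _) (fun z => by positivity) (by positivity)
    (b := ((n : ℝ) - 1)⁻¹ ^ 2 * (2 * n ^ 2 * ∑ s ∈ noiseSet d m, M.eigval s ^ 2))
    (by rw [integral_const_mul]; exact mul_le_mul_of_nonneg_left i2 (sq_nonneg _)) ?_
  have e2 : 8 * K * c / C ^ 2 * (C * L) ^ 2 = 8 * K * (c * L ^ 2) := by field_simp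
  have hτ0 : 0 ≤ ∑ s ∈ noiseSet d m, M.eigval s ^ 2 := Finset.sum_nonneg fun _ _ => sq_nonneg _
  calc _ = 2 * ((((n : ℝ) - 1)⁻¹ ^ 2 * n ^ 2) * ∑ s ∈ noiseSet d m, M.eigval s ^ 2) := by ring
    _ ≤ 2 * (4 * (c * L ^ 2)) := mul_le_mul_of_nonneg_left
        (mul_le_mul (sq_div_le_four hn) hτ hτ0 (by norm_num)) (by norm_num)
    _ = 8 * 1 * (c * L ^ 2) := by ring
    _ ≤ _ := by rw [e2]; gcongr

lemma measure_quartic_le (hρ : SpheredMoments M.law K) (hc : 1 ≤ c) (hn : 2 ≤ n)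
    (hC : 1 ≤ C) (a b : Option {t : Fin d // t.val < m}) :
    Measure.pi (fun _ : Fin n => M.law) {z | C ^ 2 * n <
      ∑ i, spikeFun d m a (z i) ^ 2 * spikeFun d m b (z i) ^ 2} ≤
      ENNReal.ofReal (8 * K * c / C ^ 2) := by
  obtain ⟨i1, i2⟩ := (M.uncorrelatedWith_spikeFun hρ a).integral_sq_mul_sq_le
    (M.uncorrelatedWith_spikeFun hρ b)
  have hK := hρ.one_le
  have hn0 : (0 : ℝ) < n := by positivity
  have i3 : ∀ i : Fin n, Integrable (fun z : Fin n → Fin d → ℝ => spikeFun d m a (z i) ^ 2 *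
      spikeFun d m b (z i) ^ 2) (Measure.pi fun _ => M.law) := fun i =>
    memLp_one_iff_integrable.1 (memLp_pi_eval (memLp_one_iff_integrable.2 i1) i)
  refine measure_lt_le_ofReal (integrable_finsetSum _ fun i _ => i3 i) (fun z => by positivity)
    (by positivity) (b := n * K) ?_ ?_
  · rw [integral_finsetSum _ fun i _ => i3 i]
    calc _ ≤ ∑ i : Fin n, K := Finset.sum_le_sum fun i _ => by
          rw [integral_pi_eval (f := fun z => spikeFun d m a z ^ 2 * spikeFun d m b z ^ 2) i1.1 i]
          exact i2
      _ = _ := by simp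
  · have : 8 * K * c / C ^ 2 * (C ^ 2 * n) = n * (8 * K * c) := by field_simp
    rw [this]
    exact mul_le_mul_of_nonneg_left (by nlinarith) hn0.le

lemma measure_diag_le (hρ : SpheredMoments M.law K) (hc : 1 ≤ c) (hn : 2 ≤ n)
    (hC : 1 ≤ C) (hL : 0 < L) (hτ : ∑ s ∈ noiseSet d m, M.eigval s ^ 2 ≤ c * L ^ 2) :
    Measure.pi (fun _ : Fin n => M.law) {z | (C * L) ^ 2 < n * ∑ i, M.noiseDiag m z i ^ 2} ≤
      ENNReal.ofReal (8 * K * c / C ^ 2) := by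
  have hK := hρ.one_le
  set f : (Fin d → ℝ) → ℝ := fun x =>
    diagKernel (noiseSet d m) M.eigval x x - ∑ s ∈ noiseSet d m, M.eigval s with hf
  have h2 : MemLp f 2 M.law := (hρ.memLp_diagKernel_self _ _).sub (memLp_const _)
  have i3 : ∀ i : Fin n, Integrable (fun z : Fin n → Fin d → ℝ => f (z i) ^ 2)
      (Measure.pi fun _ => M.law) := fun i => (memLp_pi_eval h2 i).integrable_sq
  have e1 : ∀ z : Fin n → Fin d → ℝ, n * ∑ i, M.noiseDiag m z i ^ 2 =
      n * ((n : ℝ) - 1)⁻¹ ^ 2 * ∑ i, f (z i) ^ 2 := fun z => by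
    simp only [noiseDiag, mul_pow, ← Finset.mul_sum, mul_assoc]
    rfl
  simp only [e1]
  have hτ0 : 0 ≤ ∑ s ∈ noiseSet d m, M.eigval s ^ 2 := Finset.sum_nonneg fun _ _ => sq_nonneg _
  refine measure_lt_le_ofReal ((integrable_finsetSum _ fun i _ => i3 i).const_mul _)
    (fun z => by positivity) (by positivity)
    (b := n * ((n : ℝ) - 1)⁻¹ ^ 2 * (n * (K * ∑ s ∈ noiseSet d m, M.eigval s ^ 2))) ?_ ?_
  · rw [integral_const_mul, integral_finsetSum _ fun i _ => i3 i]
    refine mul_le_mul_of_nonneg_left ?_ (by positivity)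
    calc _ ≤ ∑ i : Fin n, K * ∑ s ∈ noiseSet d m, M.eigval s ^ 2 :=
          Finset.sum_le_sum fun i _ => by
            rw [integral_pi_eval (f := fun x => f x ^ 2) h2.integrable_sq.1 i]
            exact hρ.integral_diagKernel_self_sub_sq_le _ _
      _ = _ := by simp
  · have e2 : 8 * K * c / C ^ 2 * (C * L) ^ 2 = 8 * K * (c * L ^ 2) := by field_simp
    calc _ = K * ((((n : ℝ) - 1)⁻¹ ^ 2 * n ^ 2) * ∑ s ∈ noiseSet d m, M.eigval s ^ 2) := by ring
      _ ≤ K * (4 * (c * L ^ 2)) := mul_le_mul_of_nonneg_left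
          (mul_le_mul (sq_div_le_four hn) hτ hτ0 (by norm_num)) (by linarith)
      _ ≤ K * (8 * (c * L ^ 2)) := by gcongr; norm_num
      _ = _ := by rw [e2]; ring

/-- The threshold here is a fixed fraction of `L`, so enlarging C does not help; instead the mean of
tr O⁴ is small against L⁴, through `e` and 1/n. The factor 16 bounds (n/(n-1))⁴. -/
lemma measure_cycle_le (hρ : SpheredMoments M.law K) (hn : 2 ≤ n)
    (hL : 0 < L) (hτ : ∑ s ∈ noiseSet d m, M.eigval s ^ 2 ≤ c * L ^ 2) {e : ℝ} (he0 : 0 ≤ e)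
    (he : ∀ s ∈ noiseSet d m, M.eigval s ^ 2 ≤ e * ∑ s ∈ noiseSet d m, M.eigval s ^ 2) :
    Measure.pi (fun _ : Fin n => M.law) {z | (L / 8) ^ 4 <
      ∑ i, ∑ j, (∑ k, M.noiseOff m z i k * M.noiseOff m z k j) ^ 2} ≤
      ENNReal.ofReal (8 ^ 4 * 16 * c ^ 2 * (e + 2 * ((2 * K + 4) * K) / n)) := by
  obtain ⟨i1, i2⟩ := integral_sum_sum_sq_offKernel_le (n := n) (S := noiseSet d m)
    (a := M.eigval) hρ
  have hK := hρ.one_le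
  have hn0 : (0 : ℝ) < n := by positivity
  set τ := ∑ s ∈ noiseSet d m, M.eigval s ^ 2 with hτdef
  have hτ0 : 0 ≤ τ := Finset.sum_nonneg fun _ _ => sq_nonneg _
  have e1 : ∀ z : Fin n → Fin d → ℝ,
      ∑ i, ∑ j, (∑ k, M.noiseOff m z i k * M.noiseOff m z k j) ^ 2 =
      ((n : ℝ) - 1)⁻¹ ^ 4 * ∑ i, ∑ j, (∑ k, offKernel (noiseSet d m) M.eigval z i k *
        offKernel (noiseSet d m) M.eigval z k j) ^ 2 := fun z => by
    simp only [Finset.mul_sum]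
    refine Finset.sum_congr rfl fun i _ => Finset.sum_congr rfl fun j _ => ?_
    have e2 : ∀ k, M.noiseOff m z i k * M.noiseOff m z k j = ((n : ℝ) - 1)⁻¹ ^ 2 *
        (offKernel (noiseSet d m) M.eigval z i k * offKernel (noiseSet d m) M.eigval z k j) :=
      fun k => by rw [noiseOff_apply, noiseOff_apply]; ring
    simp only [e2, ← Finset.mul_sum]
    ring
  simp only [e1]
  -- One factor λ_s² is replaced by its maximum eτ: no single noise eigenvalue dominates.
  have hq : ∑ s ∈ noiseSet d m, M.eigval s ^ 4 ≤ e * τ ^ 2 := by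
    calc _ ≤ ∑ s ∈ noiseSet d m, e * τ * M.eigval s ^ 2 := by
          refine Finset.sum_le_sum fun s hs => ?_
          have := mul_le_mul_of_nonneg_right (he s hs) (sq_nonneg (M.eigval s))
          calc M.eigval s ^ 4 = M.eigval s ^ 2 * M.eigval s ^ 2 := by ring
            _ ≤ _ := this
      _ = e * τ ^ 2 := by rw [← Finset.mul_sum]; ring
  refine measure_lt_le_ofReal (i1.const_mul _) (fun z => by positivity) (by positivity)
    (b := ((n : ℝ) - 1)⁻¹ ^ 4 * (n ^ 4 * (e * τ ^ 2) +
      2 * n ^ 3 * ((2 * K + 4) * K * τ ^ 2))) ?_ ?_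
  · rw [integral_const_mul]
    refine mul_le_mul_of_nonneg_left (i2.trans ?_) (by positivity)
    gcongr
  · have h4 : (((n : ℝ) - 1)⁻¹ ^ 2 * n ^ 2) ^ 2 ≤ 4 ^ 2 :=
      pow_le_pow_left₀ (by positivity) (sq_div_le_four hn) 2
    have h5 : τ ^ 2 ≤ (c * L ^ 2) ^ 2 := pow_le_pow_left₀ hτ0 hτ 2
    have h6 : 0 ≤ (e + 2 * ((2 * K + 4) * K) / n) * τ ^ 2 := by positivity
    calc _ = (((n : ℝ) - 1)⁻¹ ^ 2 * n ^ 2) ^ 2 * ((e + 2 * ((2 * K + 4) * K) / n) * τ ^ 2) := by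
          field_simp
      _ ≤ 4 ^ 2 * ((e + 2 * ((2 * K + 4) * K) / n) * τ ^ 2) := mul_le_mul_of_nonneg_right h4 h6
      _ ≤ 4 ^ 2 * ((e + 2 * ((2 * K + 4) * K) / n) * (c * L ^ 2) ^ 2) := by gcongr
      _ = _ := by ring

/-- A sample is typical with high probability. -/
theorem measure_not_typicalSample_le (hρ : SpheredMoments M.law K) (hmd : m ≤ d) (hc : 1 ≤ c)
    (hn : 2 ≤ n) (hC : 1 ≤ C) (hL : 0 < L)
    (hτ : ∑ s ∈ noiseSet d m, M.eigval s ^ 2 ≤ c * L ^ 2) {e : ℝ} (he0 : 0 ≤ e)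
    (he : ∀ s ∈ noiseSet d m, M.eigval s ^ 2 ≤ e * ∑ s ∈ noiseSet d m, M.eigval s ^ 2) :
    Measure.pi (fun _ : Fin n => M.law) {z | ¬ TypicalSample (M.noiseOff m z) (M.noiseDiag m z)
      (spikeVec m z) C L} ≤
      ENNReal.ofReal ((4 * (m + 1) ^ 2 + 1) * (8 * K * c / C ^ 2)) +
        ENNReal.ofReal (8 ^ 4 * 16 * c ^ 2 * (e + 2 * ((2 * K + 4) * K) / n)) := by
  set ν := Measure.pi (fun _ : Fin n => M.law) with hν
  -- Four exceptional events for each of the (m + 1)² pairs, plus the diagonal event, account for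
  -- 4(m + 1)² + 1.
  set G : Option {t : Fin d // t.val < m} × Option {t : Fin d // t.val < m} →
      Set (Fin n → Fin d → ℝ) := fun ab =>
    ({z | C ^ 2 * n < (∑ i, (spikeFun d m ab.1 (z i) * spikeFun d m ab.2 (z i) -
      if ab.1 = ab.2 then 1 else 0)) ^ 2} ∪
    {z | (C * L) ^ 2 < ∑ i, (∑ j, M.noiseOff m z i j * spikeFun d m ab.1 (z j)) ^ 2}) ∪
    ({z | (C * L) ^ 2 < (∑ i, ∑ j, spikeFun d m ab.1 (z i) * M.noiseOff m z i j *
      spikeFun d m ab.2 (z j)) ^ 2} ∪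
    {z | C ^ 2 * n < ∑ i, spikeFun d m ab.1 (z i) ^ 2 * spikeFun d m ab.2 (z i) ^ 2}) with hG
  set D := {z : Fin n → Fin d → ℝ | (C * L) ^ 2 < n * ∑ i, M.noiseDiag m z i ^ 2} with hD
  set E := {z : Fin n → Fin d → ℝ | (L / 8) ^ 4 <
    ∑ i, ∑ j, (∑ k, M.noiseOff m z i k * M.noiseOff m z k j) ^ 2} with hE
  have hsub : {z | ¬ TypicalSample (M.noiseOff m z) (M.noiseDiag m z) (spikeVec m z) C L} ⊆
      ((⋃ ab, G ab) ∪ D) ∪ E := fun z hz => by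
    by_contra hcon
    simp only [Set.mem_union, Set.mem_iUnion, not_or, not_exists, hG, hD, hE, Set.mem_ofPred_eq,
      not_lt, Prod.forall] at hcon
    obtain ⟨⟨hab, h5⟩, h7⟩ := hcon
    have hs : Real.sqrt n ^ 2 = n := Real.sq_sqrt (Nat.cast_nonneg n)
    refine hz ⟨fun t => ?_, fun s t => ?_, fun a => ?_, fun a b => ?_, h5, fun a b => ?_, h7⟩
    · refine abs_le_of_sq_le_sq ?_ (by positivity)
      -- A spiked coordinate paired with the constant function gives its sample sum.
      have := (hab (some t) none).1.1
      simp only [reduceCtorEq, if_false, sub_zero] at this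
      rw [mul_pow, hs]
      simpa [spikeVec_apply, spikeFun] using this
    · refine abs_le_of_sq_le_sq ?_ (by positivity)
      have := (hab (some s) (some t)).1.1
      rw [mul_pow, hs]
      simpa [spikeVec_apply] using this
    · simpa only [spikeVec_apply] using (hab a none).1.2
    · refine abs_le_of_sq_le_sq ?_ (by positivity)
      simpa only [spikeVec_apply] using (hab a b).2.1
    · simpa only [spikeVec_apply] using (hab a b).2.2
  have hGle : ∀ ab, ν (G ab) ≤ ENNReal.ofReal (4 * (8 * K * c / C ^ 2)) := fun ab => by
    have h0 : (0 : ℝ) ≤ 8 * K * c / C ^ 2 := by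
      have := hρ.one_le
      positivity
    have h4 : ENNReal.ofReal (4 * (8 * K * c / C ^ 2)) =
        (ENNReal.ofReal (8 * K * c / C ^ 2) + ENNReal.ofReal (8 * K * c / C ^ 2)) +
        (ENNReal.ofReal (8 * K * c / C ^ 2) + ENNReal.ofReal (8 * K * c / C ^ 2)) := by
      rw [← ENNReal.ofReal_add h0 h0, ← ENNReal.ofReal_add (by positivity) (by positivity)]
      congr 1
      ring
    rw [h4]
    refine (measure_union_le _ _).trans (add_le_add ((measure_union_le _ _).trans (add_le_add ?_ ?_))
      ((measure_union_le _ _).trans (add_le_add ?_ ?_)))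
    · exact M.measure_gram_le hρ hc hn hC _ _
    · exact M.measure_off_le hρ hc hn hC hL hτ _
    · exact M.measure_off_off_le hρ hc hn hC hL hτ _ _
    · exact M.measure_quartic_le hρ hc hn hC _ _
  have hcard : (Finset.univ : Finset (Option {t : Fin d // t.val < m} ×
      Option {t : Fin d // t.val < m})).card = (m + 1) ^ 2 := by
    rw [Finset.card_univ, Fintype.card_prod, Fintype.card_option, card_spike hmd, sq]
  have hU : ν (⋃ ab, G ab) ≤ ENNReal.ofReal (4 * (m + 1) ^ 2 * (8 * K * c / C ^ 2)) := by
    calc _ ≤ ∑ ab, ν (G ab) := measure_iUnion_fintype_le _ _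
      _ ≤ ∑ _ab : Option {t : Fin d // t.val < m} × Option {t : Fin d // t.val < m},
          ENNReal.ofReal (4 * (8 * K * c / C ^ 2)) := Finset.sum_le_sum fun ab _ => hGle ab
      _ = _ := by
          rw [Finset.sum_const, hcard, nsmul_eq_mul, ← ENNReal.ofReal_natCast,
            ← ENNReal.ofReal_mul (by positivity)]
          congr 1
          push_cast
          ring
  have hK := hρ.one_le
  calc ν _ ≤ ν (((⋃ ab, G ab) ∪ D) ∪ E) := measure_mono hsub
    _ ≤ (ν (⋃ ab, G ab) + ν D) + ν E :=
        (measure_union_le _ _).trans (add_le_add_left (measure_union_le _ _) _)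
    _ ≤ (ENNReal.ofReal (4 * (m + 1) ^ 2 * (8 * K * c / C ^ 2)) +
        ENNReal.ofReal (8 * K * c / C ^ 2)) +
        ENNReal.ofReal (8 ^ 4 * 16 * c ^ 2 * (e + 2 * ((2 * K + 4) * K) / n)) :=
        add_le_add (add_le_add hU (M.measure_diag_le hρ hc hn hC hL hτ))
          (M.measure_cycle_le hρ hn hL hτ he0 he)
    _ = _ := by
        rw [← ENNReal.ofReal_add (by positivity) (by positivity)]
        congr 2
        ring

end Events

end Population

/-! ### From the asymptotic conditions to uniform bounds. -/

lemma spheredMoments_of_evariance_lt {d : ℕ} (M : Population d)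
    (hsq : ∀ j₁ j₂ : Fin d, j₁ ≠ j₂ → ∫ z, z j₁ ^ 2 * z j₂ ^ 2 ∂M.law = 1)
    (hfour : ∀ j₁ j₂ j₃ j₄ : Fin d, j₁ ≠ j₂ → j₁ ≠ j₃ → j₁ ≠ j₄ →
      ∫ z, z j₁ * z j₂ * z j₃ * z j₄ ∂M.law = 0)
    {c : ℝ≥0∞} (hc : c ≠ ∞) (hvar : ∀ j : Fin d, evariance (fun z => z j ^ 2) M.law < c) :
    SpheredMoments M.law (c.toReal + 1) := by
  have hmeas : ∀ j : Fin d, AEStronglyMeasurable (fun z : Fin d → ℝ => z j ^ 2) M.law :=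
    fun j => (M.law_memLp j).1.pow 2
  have h2 : ∀ j : Fin d, MemLp (fun z : Fin d → ℝ => z j ^ 2) 2 M.law := fun j =>
    (evariance_lt_top_iff_memLp (hmeas j)).1 ((hvar j).trans_le le_top)
  have h4 : ∀ z : ℝ, (z ^ 2) ^ 2 = z ^ 4 := fun z => by ring
  refine ⟨fun j => ?_, M.law_mean, M.law_cov, hsq, hfour, fun j => ?_, by
    linarith [ENNReal.toReal_nonneg (a := c)]⟩
  · rw [← integrable_norm_rpow_iff (M.law_memLp j).1 (by norm_num) (by norm_num)]
    have h := (h2 j).integrable_sq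
    refine h.congr (Eventually.of_forall fun z => ?_)
    simp only
    rw [h4, Real.norm_eq_abs, show (4 : ℝ≥0∞).toReal = ((4 : ℕ) : ℝ) by norm_num,
      Real.rpow_natCast, Even.pow_abs (by decide)]
  -- Since E z_j² = 1, the fourth moment is the variance of z_j² plus 1.
  · have e1 := variance_eq_sub (h2 j)
    have e2 : Var[fun z : Fin d → ℝ => z j ^ 2; M.law] ≤ c.toReal :=
      ENNReal.toReal_mono hc (hvar j).le
    have e3 : ∫ z, z j ^ 2 ∂M.law = 1 := by
      have := M.law_cov j j
      simpa only [sq, if_true] using this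
    simp only [Pi.pow_apply, h4] at e1
    rw [e3] at e1
    linarith

lemma exists_eventually_lt_of_limsup_lt_top {u : ℕ → ℝ≥0∞} (h : limsup u atTop < ∞) :
    ∃ c : ℝ≥0∞, c ≠ ∞ ∧ ∀ᶠ d in atTop, u d < c := by
  obtain ⟨c, hc, h⟩ := exists_between h
  exact ⟨c, h.ne, eventually_lt_of_limsup_lt hc⟩

lemma MomentCondition.exists_spheredMoments {M : ∀ d, Population d} (hA : MomentCondition M) :
    ∃ K, ∀ᶠ d in atTop, SpheredMoments (M d).law K := by
  obtain ⟨c, hc, hu⟩ := exists_eventually_lt_of_limsup_lt_top hA.limsup_var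
  refine ⟨c.toReal + 1, hu.mono fun d hd => ?_⟩
  exact spheredMoments_of_evariance_lt (M d) (hA.sq_sq d) (hA.four d) hc fun j =>
    (iSup_lt_iff.1 hd).elim fun _ hb => (hb.2 j).trans_lt hb.1

namespace Population

variable {d : ℕ} (M : Population d) {m : ℕ}

lemma trace_sigma2_mul_self :
    (M.sigma2 m * M.sigma2 m).trace = ∑ s ∈ noiseSet d m, M.eigval s ^ 2 := by
  have hsymm : ∀ i j, M.sigma2 m i j = M.sigma2 m j i := fun i j => by
    simp only [sigma2, Matrix.sum_apply, Matrix.smul_apply, outerSelf, Matrix.vecMulVec_apply,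
      mul_comm]
  rw [← sum_sum_ite_smul_outerSelf (noiseSet d m) M.eigval M.eigvec]
  simp only [Matrix.trace, Matrix.diag_apply, Matrix.mul_apply]
  exact Finset.sum_congr rfl fun i _ => Finset.sum_congr rfl fun j _ => by
    rw [hsymm j i]; rfl

lemma eigval_sq_le (hτ : 0 < ∑ s ∈ noiseSet d m, M.eigval s ^ 2) {s : Fin d}
    (hs : s ∈ noiseSet d m) : M.eigval s ^ 2 ≤ M.lam (m + 1) ^ 2 /
      (∑ s ∈ noiseSet d m, M.eigval s ^ 2) * ∑ s ∈ noiseSet d m, M.eigval s ^ 2 := by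
  rw [div_mul_cancel₀ _ hτ.ne']
  have hms : m ≤ s.val := (Finset.mem_filter.1 hs).2
  rw [M.lam_eq (by omega) (by omega)]
  exact pow_le_pow_left₀ (M.eigval_nonneg s)
    (M.eigval_antitone (Fin.le_def.2 (by simpa using hms))) 2

end Population

lemma SpikeCondition.exists_noise_le {m : ℕ} {M : ∀ d, Population d} (hm : 0 < m)
    (hC : SpikeCondition m M) : ∃ c : ℝ, 1 ≤ c ∧ ∀ᶠ d in atTop, 0 < (M d).lam m ∧
      0 < ∑ s ∈ Population.noiseSet d m, (M d).eigval s ^ 2 ∧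
      ∑ s ∈ Population.noiseSet d m, (M d).eigval s ^ 2 ≤ c * (M d).lam m ^ 2 := by
  obtain ⟨r, hr0, hr⟩ := EReal.lt_iff_exists_real_btwn.1 hC.spiked
  have hr0 : 0 < r := by exact_mod_cast hr0
  refine ⟨max 1 r⁻¹, le_max_left _ _, ?_⟩
  filter_upwards [eventually_lt_of_lt_liminf hr, eventually_ge_atTop m] with d hd hmd
  have hd : r < (M d).lam m ^ 2 / ((M d).sigma2 m * (M d).sigma2 m).trace := by exact_mod_cast hd
  rw [Population.trace_sigma2_mul_self] at hd
  set τ := ∑ s ∈ Population.noiseSet d m, (M d).eigval s ^ 2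
  have hτ0 : 0 ≤ τ := Finset.sum_nonneg fun _ _ => sq_nonneg _
  have hpos := hr0.trans hd
  -- The ratio exceeds r > 0, and division by zero gives 0, so numerator and denominator are both
  -- nonzero.
  have hτ : 0 < τ := hτ0.lt_of_ne' fun h => by rw [h, div_zero] at hpos; exact hpos.false
  have hL0 : 0 ≤ (M d).lam m := by
    rw [(M d).lam_eq hm hmd]; exact (M d).eigval_nonneg _
  have hL : 0 < (M d).lam m := hL0.lt_of_ne' fun h => by
    rw [h] at hpos; simp at hpos
  refine ⟨hL, hτ, ?_⟩
  rw [lt_div_iff₀ hτ] at hd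
  calc τ ≤ r⁻¹ * (M d).lam m ^ 2 := by rw [← div_eq_inv_mul, le_div_iff₀ hr0]; linarith
    _ ≤ _ := mul_le_mul_of_nonneg_right (le_max_right _ _) (sq_nonneg _)

/-! ### Typical samples in the limit. -/

section Asymptotics

variable {m : ℕ} {M : ∀ d : ℕ, Population d}
  {ι : Type*} {l : Filter ι} {d n : ι → ℕ} {Ω : ι → Type*} [∀ k, MeasurableSpace (Ω k)]
  {P : ∀ k, Measure (Ω k)} [∀ k, IsProbabilityMeasure (P k)]
  {Z : ∀ k, Fin (n k) → Ω k → (Fin (d k) → ℝ)}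

lemma map_sample_eq_pi (hindep : ∀ k, iIndepFun (Z k) (P k))
    (hlaw : ∀ k i, HasLaw (Z k i) (M (d k)).law (P k)) (k : ι) :
    (P k).map (fun ω i => Z k i ω) = Measure.pi fun _ => (M (d k)).law := by
  rw [(iIndepFun_iff_map_fun_eq_pi_map fun i => (hlaw k i).aemeasurable).1 (hindep k)]
  simp only [(hlaw k _).map_eq]

/-- Samples are typical with high probability, for large dimensions and sample sizes. -/
lemma eventually_measure_not_typicalSample_le (hm : 0 < m) (hA : MomentCondition M)
    (hC : SpikeCondition m M) (hd : Tendsto d l atTop) (hn : Tendsto n l atTop)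
    (hindep : ∀ k, iIndepFun (Z k) (P k))
    (hlaw : ∀ k i, HasLaw (Z k i) (M (d k)).law (P k)) {ε : ℝ≥0∞} (hε : 0 < ε) :
    ∃ C : ℝ, 1 ≤ C ∧ ∀ᶠ k in l, P k {ω | ¬ TypicalSample
      ((M (d k)).noiseOff m fun i => Z k i ω) ((M (d k)).noiseDiag m fun i => Z k i ω)
      (Population.spikeVec m fun i => Z k i ω) C ((M (d k)).lam m)} ≤ ε := by
  obtain ⟨K, hK⟩ := hA.exists_spheredMoments
  obtain ⟨c, hc, hc'⟩ := hC.exists_noise_le hm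
  have hε2 : 0 < ε / 2 := ENNReal.half_pos hε.ne'
  have t1 : Tendsto (fun C : ℝ => ENNReal.ofReal
      ((4 * ((m : ℝ) + 1) ^ 2 + 1) * (8 * K * c / C ^ 2))) atTop (𝓝 0) := by
    rw [← ENNReal.ofReal_zero]
    refine (ENNReal.continuous_ofReal.tendsto _).comp ?_
    have := (tendsto_const_nhds (x := 8 * K * c)).div_atTop
      (tendsto_pow_atTop (α := ℝ) two_ne_zero)
    simpa using this.const_mul (4 * ((m : ℝ) + 1) ^ 2 + 1)
  -- C is fixed first, by the Chebyshev terms; the cycle term does not involve C and tends to zero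
  -- along `l`.
  obtain ⟨C, hC1, hCε⟩ := ((eventually_ge_atTop (1 : ℝ)).and (t1.eventually_le_const hε2)).exists
  refine ⟨C, hC1, ?_⟩
  have t2 : Tendsto (fun k => ENNReal.ofReal (8 ^ 4 * 16 * c ^ 2 *
      ((M (d k)).lam (m + 1) ^ 2 / (∑ s ∈ Population.noiseSet (d k) m, (M (d k)).eigval s ^ 2) +
        2 * ((2 * K + 4) * K) / n k))) l (𝓝 0) := by
    rw [← ENNReal.ofReal_zero]
    refine (ENNReal.continuous_ofReal.tendsto _).comp ?_
    have e1 := hC.noise.comp hd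
    have e2 := (tendsto_const_nhds (x := 2 * ((2 * K + 4) * K))).div_atTop
      ((tendsto_natCast_atTop_atTop (R := ℝ)).comp hn)
    have := (e1.add e2).const_mul (8 ^ 4 * 16 * c ^ 2)
    simpa [Population.trace_sigma2_mul_self] using this
  filter_upwards [hd.eventually hK, hd.eventually hc', hd.eventually_ge_atTop m,
    hn.eventually_ge_atTop 2, t2.eventually_le_const hε2] with k kK ⟨kL, kτ, kc⟩ kd kn kε
  have h1 := (M (d k)).measure_not_typicalSample_le kK kd hc kn hC1 kL kc
    (e := (M (d k)).lam (m + 1) ^ 2 / ∑ s ∈ Population.noiseSet (d k) m, (M (d k)).eigval s ^ 2)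
    (by positivity) (fun s hs => (M (d k)).eigval_sq_le kτ hs)
  rw [← map_sample_eq_pi hindep hlaw k] at h1
  have hmeas : AEMeasurable (fun ω i => Z k i ω) (P k) :=
    aemeasurable_pi_lambda _ fun i => (hlaw k i).aemeasurable
  -- This inequality holds for every set, so the measurability of the typical set plays no role.
  refine (Measure.le_map_apply hmeas _).trans (h1.trans ?_)
  calc _ ≤ ε / 2 + ε / 2 := add_le_add hCε kε
    _ = ε := ENNReal.add_halves ε

end Asymptotics

/-! ### Measurability of the sum of leading eigenvalues. -/

section KyFan

open scoped InnerProductSpace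

variable {d m : ℕ}

/-- The sum of the `m` leading eigenvalues bounds the trace of every `m`-dimensional compression. -/
lemma sum_sum_mul_inner_sq_le (hm : 0 < m) (hmd : m ≤ d) {ev : Fin d → ℝ} (hev : Antitone ev)
    (b h : OrthonormalBasis (Fin d) ℝ (EuclideanSpace ℝ (Fin d))) :
    ∑ a : Fin d with a.val < m, ∑ s, ev s * (⟪b s, h a⟫_ℝ * ⟪b s, h a⟫_ℝ) ≤
      ∑ s : Fin d with s.val < m, ev s := by
  -- The weights lie in [0, 1] and add up to m, so ∑ ev_s w_s is largest when they sit on the m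
  -- leading indices; comparison with the threshold ev_m shows it.
  set w : Fin d → ℝ := fun s => ∑ a : Fin d with a.val < m, ⟪b s, h a⟫_ℝ * ⟪b s, h a⟫_ℝ with hw
  set t := ev ⟨m - 1, by omega⟩ with ht
  have hw0 : ∀ s, 0 ≤ w s := fun s => Finset.sum_nonneg fun a _ => mul_self_nonneg _
  have hw1 : ∀ s, w s ≤ 1 := fun s => by
    have e1 := h.sum_sq_inner_left (b s)
    rw [b.norm_eq_one, one_pow] at e1
    simp only [sq] at e1
    rw [← e1]
    exact Finset.sum_le_sum_of_subset_of_nonneg (Finset.filter_subset _ _)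
      fun a _ _ => mul_self_nonneg _
  have hws : ∑ s, w s = m := by
    rw [hw, Finset.sum_comm]
    have e1 : ∀ a, ∑ s, ⟪b s, h a⟫_ℝ * ⟪b s, h a⟫_ℝ = 1 := fun a => by
      have e1 := b.sum_sq_inner_right (h a)
      rw [h.norm_eq_one, one_pow] at e1
      simpa only [sq] using e1
    simp only [e1, Finset.sum_const, Fin.card_filter_val_lt, min_eq_right hmd, nsmul_eq_mul,
      mul_one]
  have h1 : ∑ a : Fin d with a.val < m, ∑ s, ev s * (⟪b s, h a⟫_ℝ * ⟪b s, h a⟫_ℝ) =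
      ∑ s, ev s * w s := by
    rw [Finset.sum_comm]
    simp only [hw, Finset.mul_sum]
  have h2 : ∑ s : Fin d, (if s.val < m then (1 : ℝ) else 0) = m := by
    rw [← Finset.sum_filter, Finset.sum_const, Fin.card_filter_val_lt, min_eq_right hmd,
      nsmul_eq_mul, mul_one]
  have h3 : ∑ s, (ev s - t) * (w s - if s.val < m then 1 else 0) ≤ 0 := by
    refine Finset.sum_nonpos fun s _ => ?_
    split_ifs with hs
    · exact mul_nonpos_of_nonneg_of_nonpos
        (sub_nonneg.2 (hev (Fin.le_def.2 (by simp only; omega)))) (by linarith [hw1 s])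
    · exact mul_nonpos_of_nonpos_of_nonneg
        (sub_nonpos.2 (hev (Fin.le_def.2 (by simp only; omega)))) (by linarith [hw0 s])
  rw [h1, Finset.sum_filter]
  have h4 : ∀ s, (ev s - t) * (w s - if s.val < m then 1 else 0) = ev s * w s -
      (if s.val < m then ev s else 0) - t * w s + t * (if s.val < m then 1 else 0) := fun s => by
    split_ifs <;> ring
  simp only [h4, Finset.sum_add_distrib, Finset.sum_sub_distrib, ← Finset.mul_sum, hws, h2] at h3
  linarith

/-- The supremum of the traces of the `m`-dimensional compressions of the matrix `S`. -/
def kyFan (m : ℕ) (S : Matrix (Fin d) (Fin d) ℝ) : EReal :=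
  ⨆ h : OrthonormalBasis (Fin d) ℝ (EuclideanSpace ℝ (Fin d)),
    ((∑ a : Fin d with a.val < m, ∑ i, ∑ j, S i j * (h a i * h a j) : ℝ) : EReal)

lemma kyFan_eq_sum (hm : 0 < m) (hmd : m ≤ d) {S : Matrix (Fin d) (Fin d) ℝ} {ev : Fin d → ℝ}
    {b : OrthonormalBasis (Fin d) ℝ (EuclideanSpace ℝ (Fin d))}
    (hS : IsEigenDecomposition S ev b) :
    kyFan m S = ((∑ s : Fin d with s.val < m, ev s : ℝ) : EReal) := by
  have e1 : ∀ v : EuclideanSpace ℝ (Fin d), ∑ i, ∑ j, S i j * (v i * v j) =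
      ∑ s, ev s * (⟪b s, v⟫_ℝ * ⟪b s, v⟫_ℝ) := fun v => by
    rw [hS.eq_sum, sum_mul_sum_smul_outerSelf]
  simp only [kyFan, e1]
  refine le_antisymm (iSup_le fun h => EReal.coe_le_coe_iff.2
    (sum_sum_mul_inner_sq_le hm hmd hS.antitone b h)) (le_iSup_of_le b (EReal.coe_le_coe_iff.2 ?_))
  refine Finset.sum_le_sum fun a _ => le_of_eq ?_
  rw [Finset.sum_eq_single_of_mem a (Finset.mem_univ a) fun s _ hs => by
    rw [b.inner_eq_zero hs]; ring, real_inner_self_eq_norm_sq, b.norm_eq_one]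
  ring

/-- A supremum of continuous functions over an uncountable family is still lower semicontinuous. -/
lemma measurable_kyFan {X : Type*} [TopologicalSpace X] [MeasurableSpace X] [OpensMeasurableSpace X]
    {S : X → Matrix (Fin d) (Fin d) ℝ} (hS : ∀ i j, Continuous fun x => S x i j) :
    Measurable fun x => kyFan m (S x) := by
  refine LowerSemicontinuous.measurable (lowerSemicontinuous_iSup fun h => ?_)
  refine Continuous.lowerSemicontinuous (continuous_coe_real_ereal.comp ?_)
  fun_prop

end KyFan

lemma continuous_sampleCov_apply {d n : ℕ} (M : Population d) (i j : Fin d) :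
    Continuous fun z : Fin n → Fin d → ℝ => sampleCov (fun i' => M.observation (z i')) i j := by
  have h : ∀ i' : Fin n, Continuous fun z : Fin n → Fin d → ℝ => M.observation (z i') := fun i' => by
    unfold Population.observation
    fun_prop
  simp only [sampleCov, outerSelf, Matrix.smul_apply, Matrix.sum_apply, Matrix.vecMulVec_apply,
    smul_eq_mul]
  fun_prop

/-- The sum of the leading sample eigenvalues is measurable. -/
lemma aemeasurable_sum_ev {d n m : ℕ} (hm : 0 < m) (hmd : m ≤ d) (M : Population d) {Ω : Type*}
    [MeasurableSpace Ω] {P : Measure Ω} {Z : Fin n → Ω → Fin d → ℝ}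
    (hZ : ∀ i, AEMeasurable (Z i) P) {ev : Ω → Fin d → ℝ}
    {b : Ω → OrthonormalBasis (Fin d) ℝ (EuclideanSpace ℝ (Fin d))}
    (hdec : ∀ ω, IsEigenDecomposition (sampleCov fun i => M.observation (Z i ω)) (ev ω) (b ω)) :
    AEMeasurable (fun ω => ∑ s : Fin d with s.val < m, ev ω s) P := by
  -- The decomposition is chosen separately for each ω with no regularity in ω, but the sum depends
  -- on the matrix alone.
  have h1 : ∀ ω, ∑ s : Fin d with s.val < m, ev ω s =
      (kyFan m (sampleCov fun i => M.observation (Z i ω))).toReal := fun ω => by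
    rw [kyFan_eq_sum hm hmd (hdec ω), EReal.toReal_coe]
  simp only [h1]
  have h2 := (measurable_kyFan (m := m) (continuous_sampleCov_apply (n := n) M)).ereal_toReal
  exact h2.comp_aemeasurable (aemeasurable_pi_lambda _ hZ)

lemma Population.lam_le_lam_one {d m : ℕ} (M : Population d) (hm : 0 < m) (hmd : m ≤ d) :
    M.lam m ≤ M.lam 1 := by
  rw [M.lam_eq hm hmd, M.lam_eq zero_lt_one (by omega)]
  exact M.eigval_antitone (Fin.le_def.2 (by simp))

lemma exists_notMem_of_measure_le_quarter {Ω : Type*} [MeasurableSpace Ω] {P : Measure Ω}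
    [IsProbabilityMeasure P] {A B : Set Ω} (hA : P A ≤ 1 / 4) (hB : P B ≤ 1 / 4) :
    ∃ ω, ω ∉ A ∪ B := by
  by_contra! h
  have h1 : P (A ∪ B) ≤ 1 / 4 + 1 / 4 := (measure_union_le _ _).trans (add_le_add hA hB)
  rw [Set.eq_univ_of_forall h, measure_univ] at h1
  have h2 := ENNReal.toReal_mono (by finiteness) h1
  rw [ENNReal.toReal_add (by finiteness) (by finiteness)] at h2
  norm_num at h2

/-! ### The two remainder terms. -/

section Remainders

variable {m : ℕ} {M : ∀ d : ℕ, Population d} {ι : Type*} {d n : ι → ℕ} {Ω : ι → Type*}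

/-- The relative error of the sum of the bias-corrected leading sample eigenvalues. -/
def relativeBias (m : ℕ) (M : ∀ d : ℕ, Population d) {ι : Type*} {d : ι → ℕ} (n : ι → ℕ)
    {Ω : ι → Type*} (ev : ∀ k, Ω k → Fin (d k) → ℝ) (k : ι) (ω : Ω k) : ℝ :=
  -- The default 0 makes this measurable also for the k with d k < m, to which the Ky Fan formula
  -- does not apply.
  if m ≤ d k then (∑ s : Fin (d k) with s.val < m, ev k ω s - m * (M (d k)).delta m (n k)) /
    (∑ s ∈ Finset.Icc 1 m, (M (d k)).lam s) - 1 else 0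

/-- The normalized remainder in the expansion of the squared distance of the leading parts. -/
def remainder (m : ℕ) (M : ∀ d : ℕ, Population d) {ι : Type*} {d : ι → ℕ} (n : ι → ℕ)
    {Ω : ι → Type*} (ev : ∀ k, Ω k → Fin (d k) → ℝ)
    (b : ∀ k, Ω k → OrthonormalBasis (Fin (d k)) ℝ (EuclideanSpace ℝ (Fin (d k))))
    (k : ι) (ω : Ω k) : ℝ :=
  (frobNorm (sigma1Hat m (ev k ω) (b k ω) - (M (d k)).sigma1 m) ^ 2 -
    (m * (M (d k)).delta m (n k) ^ 2
      + 2 * (∑ s ∈ Finset.Icc 1 m, (M (d k)).lam s * (M (d k)).delta m (n k)) *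
        (1 + relativeBias m M n ev k ω))) / ((M (d k)).lam 1 ^ 2 / n k)

variable {ev : ∀ k, Ω k → Fin (d k) → ℝ}
  {b : ∀ k, Ω k → OrthonormalBasis (Fin (d k)) ℝ (EuclideanSpace ℝ (Fin (d k)))}
  {k : ι} {z : Fin (n k) → Fin (d k) → ℝ} {C : ℝ} {ω : Ω k}

lemma lam_one_le_sum_lam (hm : 0 < m) {d : ℕ} (M : Population d) (hmd : m ≤ d) :
    M.lam 1 ≤ ∑ s ∈ Finset.Icc 1 m, M.lam s := by
  refine Finset.single_le_sum (f := M.lam) (fun s hs => ?_) (Finset.mem_Icc.2 ⟨le_rfl, hm⟩)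
  have := Finset.mem_Icc.1 hs
  rw [M.lam_eq (by omega) (by omega)]
  exact M.eigval_nonneg _

lemma abs_relativeBias_le (hm : 0 < m) (hn : 2 ≤ n k) (hmd : m ≤ d k)
    (hL : 0 < (M (d k)).lam m) (hv : TypicalSample ((M (d k)).noiseOff m z)
      ((M (d k)).noiseDiag m z) (Population.spikeVec m z) C ((M (d k)).lam m)) (hC : 1 ≤ C)
    (hCn : 12 * (m * (16 * C ^ 2)) ≤ Real.sqrt (n k))
    (hdec : IsEigenDecomposition (sampleCov fun i => (M (d k)).observation (z i)) (ev k ω)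
      (b k ω)) :
    |relativeBias m M n ev k ω| ≤ 7 * m ^ 2 * (m * (16 * C ^ 2) * (Real.sqrt (n k))⁻¹) := by
  have h := ((M (d k)).of_typicalSample hn hm hmd hL hv hC hCn hdec).2.1
  have hS := lam_one_le_sum_lam hm (M (d k)) hmd
  have hΛ := hL.trans_le ((M (d k)).lam_le_lam_one hm hmd)
  have hpos := hΛ.trans_le hS
  rw [← Population.sum_lam_eq _ hmd] at h
  rw [relativeBias, if_pos hmd, div_sub_one hpos.ne', abs_div, abs_of_pos hpos, div_le_iff₀ hpos]
  exact h.trans (mul_le_mul_of_nonneg_left hS (by positivity))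

lemma abs_remainder_le (hm : 0 < m) (hn : 2 ≤ n k) (hmd : m ≤ d k)
    (hL : 0 < (M (d k)).lam m) (hv : TypicalSample ((M (d k)).noiseOff m z)
      ((M (d k)).noiseDiag m z) (Population.spikeVec m z) C ((M (d k)).lam m)) (hC : 1 ≤ C)
    (hCn : 12 * (m * (16 * C ^ 2)) ≤ Real.sqrt (n k))
    (hdec : IsEigenDecomposition (sampleCov fun i => (M (d k)).observation (z i)) (ev k ω)
      (b k ω)) :
    |remainder m M n ev b k ω| ≤ 125 * m ^ 4 * (m * (16 * C ^ 2)) ^ 2 := by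
  have h := ((M (d k)).of_typicalSample hn hm hmd hL hv hC hCn hdec).2.2
  have hΛ := hL.trans_le ((M (d k)).lam_le_lam_one hm hmd)
  have hpos := hΛ.trans_le (lam_one_le_sum_lam hm (M (d k)) hmd)
  have hn0 : (0 : ℝ) < n k := by positivity
  have hden : 0 < (M (d k)).lam 1 ^ 2 / n k := by positivity
  -- `relativeBias` is defined so that this identity is exact: the random middle term is 2δ∑(λ̂_s -
  -- δ).
  have e1 : 2 * (∑ s ∈ Finset.Icc 1 m, (M (d k)).lam s * (M (d k)).delta m (n k)) *
      (1 + relativeBias m M n ev k ω) = 2 * (M (d k)).delta m (n k) *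
        (∑ s : Fin (d k) with s.val < m, ev k ω s - m * (M (d k)).delta m (n k)) := by
    rw [← Finset.sum_mul, relativeBias, if_pos hmd]
    field_simp
    ring
  rw [remainder, e1, abs_div, abs_of_pos hden, div_le_iff₀ hden]
  refine h.trans (le_of_eq ?_)
  rw [mul_pow _ (Real.sqrt _)⁻¹, inv_pow, Real.sq_sqrt hn0.le]
  ring

end Remainders

end

/-! ### Conclusion. -/

theorem propositionA2 (m : ℕ) (hm : 0 < m) (M : ∀ d : ℕ, Population d)
    (hA : MomentCondition M) (hC : SpikeCondition m M)
    {ι : Type*} (l : Filter ι) (d n : ι → ℕ) (hd : Tendsto d l atTop) (hn : Tendsto n l atTop)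
    {Ω : ι → Type*} [∀ k, MeasurableSpace (Ω k)]
    (P : ∀ k, Measure (Ω k)) [∀ k, IsProbabilityMeasure (P k)]
    (Z : ∀ k, Fin (n k) → Ω k → (Fin (d k) → ℝ))
    (hindep : ∀ k, iIndepFun (Z k) (P k))
    (hlaw : ∀ k i, HasLaw (Z k i) (M (d k)).law (P k))
    (evHat : ∀ k, Ω k → Fin (d k) → ℝ)
    (hHat : ∀ k, Ω k → OrthonormalBasis (Fin (d k)) ℝ (EuclideanSpace ℝ (Fin (d k))))
    (hdec : ∀ k ω, IsEigenDecomposition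
      (sampleCov fun i => (M (d k)).observation (Z k i ω)) (evHat k ω) (hHat k ω)) :
    (∃ R₁ R₂ : ∀ k, Ω k → ℝ,
      (∀ k, AEMeasurable (R₁ k) (P k)) ∧ IsLittleOPOne l P R₁ ∧ IsBigOPOne l P R₂ ∧
      ∀ᶠ k in l, ∀ ω,
        frobNorm (sigma1Hat m (evHat k ω) (hHat k ω) - (M (d k)).sigma1 m) ^ 2 =
          m * (M (d k)).delta m (n k) ^ 2
          + 2 * (∑ s ∈ Finset.Icc 1 m, (M (d k)).lam s * (M (d k)).delta m (n k)) * (1 + R₁ k ω)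
          + (M (d k)).lam 1 ^ 2 / n k * R₂ k ω) ∧
    (IsLittleOPOne l P (fun k ω =>
        frobNorm (sigma1Hat m (evHat k ω) (hHat k ω) - (M (d k)).sigma1 m) ^ 2
          / (M (d k)).lam m ^ 2) →
      Tendsto (fun k => (M (d k)).delta m (n k) / (M (d k)).lam m) l (𝓝 0)) := by
  have hn0 : ∀ᶠ k in l, 2 ≤ n k := hn.eventually_ge_atTop 2
  have hmd : ∀ᶠ k in l, m ≤ d k := hd.eventually_ge_atTop m
  obtain ⟨c, -, hc⟩ := hC.exists_noise_le hm
  have hL : ∀ᶠ k in l, 0 < (M (d k)).lam m := (hd.eventually hc).mono fun k hk => hk.1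
  have htypical := fun (ε : ℝ≥0∞) (hε : 0 < ε) =>
    eventually_measure_not_typicalSample_le hm hA hC hd hn hindep hlaw hε
  have hq : ∀ C : ℝ, Tendsto (fun k => m * (16 * C ^ 2) * (Real.sqrt (n k))⁻¹) l (𝓝 0) := fun C => by
    have h1 : Tendsto (fun k => (Real.sqrt (n k))⁻¹) l (𝓝 0) := tendsto_inv_atTop_zero.comp
      (Real.tendsto_sqrt_atTop.comp (tendsto_natCast_atTop_atTop.comp hn))
    simpa using h1.const_mul (m * (16 * C ^ 2))
  have hsqrt : ∀ C : ℝ, ∀ᶠ k in l, C ≤ Real.sqrt (n k) := fun C =>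
    (Real.tendsto_sqrt_atTop.comp (tendsto_natCast_atTop_atTop.comp hn)).eventually_ge_atTop C
  constructor
  · refine ⟨relativeBias m M n evHat, remainder m M n evHat hHat, fun k => ?_, ?_, ?_, ?_⟩
    · unfold relativeBias
      split_ifs with hk
      · have h1 := aemeasurable_sum_ev hm hk (M (d k)) (fun i => (hlaw k i).aemeasurable) (hdec k)
        exact ((h1.sub_const _).div_const _).sub_const _
      · exact aemeasurable_const
    · refine fun ε hε => ENNReal.tendsto_nhds_zero.2 fun η hη => ?_
      obtain ⟨C, hC1, hCη⟩ := htypical η hη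
      have h7 : Tendsto (fun k => 7 * (m : ℝ) ^ 2 * (m * (16 * C ^ 2) * (Real.sqrt (n k))⁻¹)) l
          (𝓝 0) := by simpa using (hq C).const_mul (7 * (m : ℝ) ^ 2)
      filter_upwards [hCη, hn0, hmd, hL, hsqrt (12 * (m * (16 * C ^ 2))), h7.eventually_le_const hε]
        with k h1 h2 h3 h4 h5 h6
      refine (measure_mono fun ω hω hT => ?_).trans h1
      exact absurd ((abs_relativeBias_le hm h2 h3 h4 hT hC1 h5 (hdec k ω)).trans h6)
        (not_le.2 hω)
    · intro η hη
      obtain ⟨C, hC1, hCη⟩ := htypical η hη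
      refine ⟨125 * m ^ 4 * (m * (16 * C ^ 2)) ^ 2, ?_⟩
      filter_upwards [hCη, hn0, hmd, hL, hsqrt (12 * (m * (16 * C ^ 2)))] with k h1 h2 h3 h4 h5
      refine (measure_mono fun ω hω hT => ?_).trans h1
      exact absurd (abs_remainder_le hm h2 h3 h4 hT hC1 h5 (hdec k ω)) (not_le.2 hω)
    -- The expansion holds identically, as the second remainder is the normalized difference of the
    -- two sides; only a nonzero normalization is needed.
    · filter_upwards [hn0, hmd, hL] with k h2 h3 h4 ω
      have hn' : (n k : ℝ) ≠ 0 := by positivity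
      have hΛ := (h4.trans_le ((M (d k)).lam_le_lam_one hm h3)).ne'
      rw [remainder, mul_div_cancel₀ _ (by positivity)]
      ring
  · intro ho
    refine Metric.tendsto_nhds.2 fun ε hε => ?_
    obtain ⟨C, hC1, hCη⟩ := htypical (1 / 4) (by norm_num)
    have h3 : Tendsto (fun k => 3 * (m * (16 * C ^ 2) * (Real.sqrt (n k))⁻¹)) l (𝓝 0) := by
      simpa using (hq C).const_mul 3
    -- The Frobenius distance and the eigenvalue error get ε/2 each, relative to λ_m; the distance
    -- enters squared, hence (ε/2)².
    filter_upwards [hCη, hn0, hmd, hL, hsqrt (12 * (m * (16 * C ^ 2))),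
      h3.eventually_lt_const (half_pos hε),
      (ho ((ε / 2) ^ 2) (by positivity)).eventually_le_const (show (0 : ℝ≥0∞) < 1 / 4 by norm_num)]
      with k k1 k2 k3 k4 k5 k6 k7
    -- δ/λ_m is not random, so one sample that is typical and has a small estimation error decides.
    obtain ⟨ω, hω⟩ := exists_notMem_of_measure_le_quarter k1 k7
    simp only [Set.mem_union, Set.mem_ofPred_eq, not_or, not_not, not_lt] at hω
    obtain ⟨hT, hF⟩ := hω
    have h5 := (M (d k)).delta_le_of_typicalSample k2 hm k3 k4 hT hC1 k5 (hdec k ω)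
    have h6 := (M (d k)).delta_nonneg m k2
    rw [← div_pow, abs_of_nonneg (sq_nonneg _)] at hF
    have h7 := (abs_le_of_sq_le_sq' hF (half_pos hε).le).2
    rw [div_le_iff₀ k4] at h7
    rw [dist_zero_right, Real.norm_of_nonneg (div_nonneg h6 k4.le), div_lt_iff₀ k4]
    have h8 := mul_lt_mul_of_pos_left k6 k4
    linarith
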